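/- **Setting.** Let $\mathcal A\subseteq\mathbb M_{d_{\mathcal A}}$ and $\mathcal B\subseteq\mathbb M_{d_{\mathcal B}}$ be unital $*$-subalgebras of matrix algebras, let $N\ge 1$ and $l,r\in\mathbb N$. A state $\omega$ of the chain algebra $\mathcal A^{\otimes N}$ is identified with its density matrix in $\mathcal A^{\otimes N}$; $\omega_{[a,b]}$ is its marginal on the sites $a,\dots,b$, and intervals that stick out of $[1,N]$ are cut off to $[\max(a,1),\min(b,N)]$. For $0\le j\le N$ let $\Omega^{[i,j,k]}:\mathcal A_{[j+1,k]}\to\mathcal A_{[i,j]}^*$ be the map $\Omega^{[i,j,k]}[X](Y)=\omega(\mathds 1\otimes Y\otimes X\otimes\mathds 1)$. The state is *$(l,r,m)$-finitely correlated* if $m_j:=\operatorname{rank}\Omega^{[j-l+1,j,j+r]}=\operatorname{rank}\Omega^{[1,j,N]}\le m$ for all $0\le j\le N$. It is a *$C^*$-finitely correlated state with memory algebra $\mathcal B$* if there are a state $\rho_0$ of $\mathcal B$ and completely positive unital maps $\mathcal E^{(1)},\dots,\mathcal E^{(N)}:\mathcal A\otimes\mathcal B\to\mathcal B$ with $$\omega(X_1\otimes\cdots\otimes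 X_N)=\rho_0\,\mathcal E^{(1)}_{X_1}\cdots\mathcal E^{(N)}_{X_N}(\mathds 1_{\mathcal B}),\qquad \mathcal E^{(j)}_X(b)=\mathcal E^{(j)}(X\otimes b).$$ Let $\sigma_j>0$ be the smallest nonzero (that is, the $m_j$-th) singular value of $\Omega^{[j-l+1,j,j+r]}$ with respect to the Hilbert–Schmidt structures, let $d_{\mathrm{Tr}}(\omega,\omega')=\frac12\|\omega-\omega'\|_1$, and for $0<\epsilon<1$ put $$\varepsilon=\min_{0\le j\le N}\frac{\epsilon\,\sigma_j^3}{20\,N\,d_{\mathcal B}\sqrt{d_{\mathcal A}}}.$$ **Algorithm.** Let a *tomography subroutine* be any measurement on at most $n$ copies of the unknown state which acts, jointly over the copies, on a block of at most $l+r+1$ neighbouring sites of each copy, and whose outcome is turned into estimates of the marginals $\omega_{[j-l+1,j+r]}$ and $\omega_{[j-l,j+r]}$, $j=1,\dots,N$. Given a threshold $\eta$, the algorithm runs the subroutine, forms from the estimates the corresponding maps $\hat\Omega^{[j-l+1,j,j+r]}$ and $\hat\Omega^{[j-l,j-1,j+r]}_A:=\hat\Omega^{[j-l,j-1,j+r]}[A\otimes\cdot\,]$,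 lets $\hat U_j$ consist of the left singular vectors of $\hat\Omega^{[j-l+1,j,j+r]}$ with singular value at least $\eta$ (for $1\le j\le N-1$), and outputs the (not necessarily positive) matrix $\hat\omega$ with $$\hat\omega(X_1\otimes\cdots\otimes X_N)=\hat{\mathbb K}^{(1)}_{X_1}\cdots\hat{\mathbb K}^{(N)}_{X_N},\qquad \hat{\mathbb K}^{(j)}_A=\hat U_{j-1}^\dagger\,\hat\Omega_A^{[j-l,j-1,j+r]}\,\big(\hat U_j^\dagger\hat\Omega^{[j-l+1,j,j+r]}\big)^+,$$ where $^+$ is the Moore–Penrose pseudo-inverse, the factor $\hat U_0^\dagger$ is omitted for $j=1$, and the pseudo-inverse is omitted for $j=N$ (with $\hat\Omega_A^{[N-l,N-1,N]}$ evaluated on $A$). **Theorem.** Fix $n$, the tomography subroutine and $\eta\in\mathbb R$. The algorithm uses at most $n$ copies and measures only marginals on at most $l+r+1$ neighbouring sites. For all $\mathcal A$, $\mathcal B$ and $m$, all $(l,r,m)$-finitely correlated states $\omega$ on $\mathcal A^{\otimes N}$ that are $C^*$-finitely correlated with memory algebra $\mathcal B\subseteq\mathbb M_{d_{\mathcal B}}$,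 all $0<\epsilon<1$ and all $\delta$: if $$\tfrac12\min_{0\le j\le N}\sigma_j\;\ge\;\eta\;\ge\;2\varepsilon$$ and the copies suffice for the subroutine to learn all the marginals $\omega_{[j-l+1,j+r]}$ and $\omega_{[j-l,j+r]}$, $j=1,\dots,N$, at precision $\varepsilon$ in Hilbert–Schmidt distance with probability at least $1-\delta$, then the output of the algorithm satisfies, with probability at least $1-\delta$, $$d_{\mathrm{Tr}}(\hat\omega,\omega)\le\epsilon .$$ -/

import Mathlib

open scoped ComplexOrder TensorProduct

noncomputable section

namespace SpinChain

/-! ### Operators on a finite chain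

The sites `1, …, N` are the elements of `Fin N`, so site `k` has value `k - 1`. The block of sites
with values in `[a, b)` is the interval `[a + 1, b]` of the chain; bounds that stick out of the chain
are cut off automatically, because only elements of `Fin N` occur and `a - b` on `ℕ` stops at `0`. -/

/-- Basis labels of the block of sites with values in `[a, b)`. -/
abbrev Cfg (d N a b : ℕ) : Type := {x : Fin N // a ≤ x.val ∧ x.val < b} → Fin d

/-- Operators on the block `[a, b)`: `d`-dimensional qudits, one for each site. -/
abbrev Op (d N a b : ℕ) : Type := Matrix (Cfg d N a b) (Cfg d N a b) ℂ

/-- Operators on the whole chain. -/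
abbrev ChainOp (d N : ℕ) : Type := Matrix (Fin N → Fin d) (Fin N → Fin d) ℂ

/-- Restriction of a label to a smaller block. -/
def Cfg.res {d N a b : ℕ} (a' b' : ℕ) (ha : a ≤ a') (hb : b' ≤ b) (p : Cfg d N a b) :
    Cfg d N a' b' :=
  fun x => p ⟨x.1, ha.trans x.2.1, x.2.2.trans_le hb⟩

/-- The tensor product `Y ⊗ X` of operators on the neighbouring blocks `[a, j)` and `[j, b)`. -/
def tensorOp {d N a j b : ℕ} (haj : a ≤ j) (hjb : j ≤ b) (Y : Op d N a j) (X : Op d N j b) :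
    Op d N a b :=
  Matrix.of fun p q =>
    Y (p.res a j le_rfl hjb) (q.res a j le_rfl hjb) *
      X (p.res j b haj le_rfl) (q.res j b haj le_rfl)

/-- The product operator `X₁ ⊗ ⋯ ⊗ X_N`. -/
def prodOp {d N : ℕ} (X : Fin N → Matrix (Fin d) (Fin d) ℂ) : ChainOp d N :=
  Matrix.of fun p q => ∏ i, X i (p i) (q i)

/-- The marginal (partial trace over all other sites) of a chain operator on the block `[a, b)`. -/
def marginal {d N : ℕ} (ω : ChainOp d N) (a b : ℕ) : Op d N a b :=
  Matrix.of fun p q =>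
    ∑ e : {x : Fin N // ¬(a ≤ x.val ∧ x.val < b)} → Fin d,
      ω ((Equiv.piEquivPiSubtypeProd (fun x : Fin N => a ≤ x.val ∧ x.val < b)
            (fun _ => Fin d)).symm (p, e))
        ((Equiv.piEquivPiSubtypeProd (fun x : Fin N => a ≤ x.val ∧ x.val < b)
            (fun _ => Fin d)).symm (q, e))

/-! ### Norms and singular values -/

section Norms

variable {m n : Type} [Fintype m] [Fintype n] [DecidableEq m] [DecidableEq n]

/-- The singular values in decreasing order, numbered from `0`, continued by zeros. -/
def singVal (M : Matrix m n ℂ) (k : ℕ) : ℝ := (Matrix.toEuclideanLin M).singularValues k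

/-- The Hilbert–Schmidt norm. -/
def hsNorm (M : Matrix m n ℂ) : ℝ := √(∑ i, ∑ j, ‖M i j‖ ^ 2)

/-- The trace norm: the sum of the singular values. -/
def traceNorm (M : Matrix n n ℂ) : ℝ := ∑ k ∈ Finset.range (Fintype.card n), singVal M k

/-- The trace distance `½ ‖M - M'‖₁`. -/
def traceDist (M M' : Matrix n n ℂ) : ℝ := traceNorm (M - M') / 2

/-- The pseudo-inverse of the truncated singular value decomposition of `M`: if
`M = ∑ σᵢ uᵢ vᵢ†`, this is the sum of `σᵢ⁻¹ vᵢ uᵢ†` over the `i` with `σᵢ ≥ η` (and `σᵢ ≠ 0`).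
If `U` has the left singular vectors with `σᵢ ≥ η` as columns, it equals `(U† M)⁺ U†`. -/
def truncPinv (η : ℝ) (M : Matrix m n ℂ) : Matrix n m ℂ :=
  (Matrix.isHermitian_conjTranspose_mul_self M).cfc (fun x => if η ≤ √x then x⁻¹ else 0) *
    M.conjTranspose

end Norms

/-! ### States, correlation maps and finitely correlated states -/

/-- The chain algebra `𝒜 ⊗ ⋯ ⊗ 𝒜`, spanned by the products of elements of the site algebra. -/
def chainAlgebra {d : ℕ} (A : StarSubalgebra ℂ (Matrix (Fin d) (Fin d) ℂ)) (N : ℕ) :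
    Submodule ℂ (ChainOp d N) :=
  Submodule.span ℂ (Set.range fun X : Fin N → A =>
    prodOp fun i => (X i : Matrix (Fin d) (Fin d) ℂ))

/-- `ω` is the density matrix of a state of the chain algebra: every state of `𝒜 ⊗ ⋯ ⊗ 𝒜` is
`X ↦ Tr (ω X)` for exactly one such `ω`. -/
structure IsState {d N : ℕ} (A : StarSubalgebra ℂ (Matrix (Fin d) (Fin d) ℂ))
    (ω : ChainOp d N) : Prop where
  mem : ω ∈ chainAlgebra A N
  posSemidef : ω.PosSemidef
  trace_eq_one : ω.trace = 1

/-- For a functional `M` (a density matrix) on `[a, b)` and a cut `j`, the number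
`Ω[X](Y) = M(Y ⊗ X)`, for `X` on the right block `[j, b)` and `Y` on the left block `[a, j)`. -/
def corr {d N a j b : ℕ} (haj : a ≤ j) (hjb : j ≤ b) (M : Op d N a b) (X : Op d N j b)
    (Y : Op d N a j) : ℂ :=
  (M * tensorOp haj hjb Y X).trace

/-- The map `Ω`, from operators on the right block to functionals on the left block, in the
Hilbert–Schmidt orthonormal bases of matrix units: the entry at `(y, y'), (x, x')` is
`Ω[e_{x x'}](e_{y y'})`. -/
def corrMat {d N a j b : ℕ} (haj : a ≤ j) (hjb : j ≤ b) (M : Op d N a b) :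
    Matrix (Cfg d N a j × Cfg d N a j) (Cfg d N j b × Cfg d N j b) ℂ :=
  Matrix.of fun y x => corr haj hjb M (Matrix.single x.1 x.2 1) (Matrix.single y.1 y.2 1)

/-- The map `Ω^{[j-l+1, j, j+r]}` of a state: `l` sites to the left and `r` sites to the right of the
cut after site `j`. -/
def localCorr {d N : ℕ} (ω : ChainOp d N) (l r j : ℕ) :
    Matrix (Cfg d N (j - l) j × Cfg d N (j - l) j) (Cfg d N j (j + r) × Cfg d N j (j + r)) ℂ :=
  corrMat (Nat.sub_le j l) (Nat.le_add_right j r) (marginal ω (j - l) (j + r))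

/-- `(l, r, m)`-finitely correlated states: at each cut `j = 0, …, N` the map for the whole chain,
`Ω^{[1, j, N]}`, has the same rank as the local one, and this rank `m_j` is at most `m`. -/
def IsFinitelyCorrelated {d N : ℕ} (l r m : ℕ) (ω : ChainOp d N) : Prop :=
  ∀ (j : ℕ) (hj : j ≤ N),
    (corrMat (Nat.zero_le j) hj (marginal ω 0 N)).rank = (localCorr ω l r j).rank ∧
      (localCorr ω l r j).rank ≤ m

/-- The smallest nonzero singular value of `Ω^{[j-l+1, j, j+r]}`, that is, the one with number
`m_j = rank`. -/
def sigmaMin {d N : ℕ} (ω : ChainOp d N) (l r j : ℕ) : ℝ :=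
  singVal (localCorr ω l r j) ((localCorr ω l r j).rank - 1)

/-! ### `C*`-realizations -/

section Realization

variable {dA dB : ℕ}

/-- The embedding `a ⊗ b ↦ a ⊗ b` of `𝒜 ⊗ ℬ` into the matrices on `ℂ^dA ⊗ ℂ^dB`. -/
def tensorToMatrix (A : StarSubalgebra ℂ (Matrix (Fin dA) (Fin dA) ℂ))
    (B : StarSubalgebra ℂ (Matrix (Fin dB) (Fin dB) ℂ)) :
    A ⊗[ℂ] B →ₗ[ℂ] Matrix (Fin dA × Fin dB) (Fin dA × Fin dB) ℂ :=
  TensorProduct.lift (LinearMap.compl₁₂ (Matrix.kroneckerBilinear (R := ℂ) (α := ℂ))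
    A.subtype.toAlgHom.toLinearMap B.subtype.toAlgHom.toLinearMap)

/-- The map `E : 𝒜 ⊗ ℬ → ℬ` is completely positive: for each `k`, `id ⊗ E` sends positive elements
of `M_k ⊗ 𝒜 ⊗ ℬ` to positive elements of `M_k ⊗ ℬ`. -/
def IsCompletelyPositive {A : StarSubalgebra ℂ (Matrix (Fin dA) (Fin dA) ℂ)}
    {B : StarSubalgebra ℂ (Matrix (Fin dB) (Fin dB) ℂ)} (E : A ⊗[ℂ] B →ₗ[ℂ] B) : Prop :=
  ∀ (k : ℕ) (X : Matrix (Fin k) (Fin k) (A ⊗[ℂ] B)),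
    (Matrix.of fun p q : Fin k × (Fin dA × Fin dB) =>
      tensorToMatrix A B (X p.1 q.1) p.2 q.2).PosSemidef →
    (Matrix.of fun p q : Fin k × Fin dB =>
      (E (X p.1 q.1) : Matrix (Fin dB) (Fin dB) ℂ) p.2 q.2).PosSemidef

/-- The data of a `C*`-realization on a chain of length `N`: a state `ρ₀` of the memory algebra `ℬ`
and completely positive unital maps `𝓔⁽¹⁾, …, 𝓔⁽ᴺ⁾ : 𝒜 ⊗ ℬ → ℬ`. -/
structure CStarRealization (A : StarSubalgebra ℂ (Matrix (Fin dA) (Fin dA) ℂ))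
    (B : StarSubalgebra ℂ (Matrix (Fin dB) (Fin dB) ℂ)) (N : ℕ) where
  /-- the initial state of the memory -/
  rho : B →ₗ[ℂ] ℂ
  rho_nonneg : ∀ b : B, (b : Matrix (Fin dB) (Fin dB) ℂ).PosSemidef → 0 ≤ rho b
  rho_one : rho 1 = 1
  /-- the maps that generate the state -/
  E : Fin N → A ⊗[ℂ] B →ₗ[ℂ] B
  E_cp : ∀ i, IsCompletelyPositive (E i)
  E_unital : ∀ i, E i (1 ⊗ₜ[ℂ] 1) = 1

/-- `ω(X₁ ⊗ ⋯ ⊗ X_N) = ρ₀ 𝓔⁽¹⁾_{X₁} ⋯ 𝓔⁽ᴺ⁾_{X_N}(1)`, where `𝓔_X(b) = 𝓔(X ⊗ b)`. -/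
def CStarRealization.Generates {A : StarSubalgebra ℂ (Matrix (Fin dA) (Fin dA) ℂ)}
    {B : StarSubalgebra ℂ (Matrix (Fin dB) (Fin dB) ℂ)} {N : ℕ}
    (R : CStarRealization A B N) (ω : ChainOp dA N) : Prop :=
  ∀ X : Fin N → A,
    (ω * prodOp fun i => (X i : Matrix (Fin dA) (Fin dA) ℂ)).trace =
      R.rho (Fin.foldr N (fun i b => R.E i (X i ⊗ₜ[ℂ] b)) 1)

end Realization

/-! ### Measurements on copies of the state -/

/-- A measurement procedure for states on a chain of `N` qudits. It takes `copies` copies, keeps a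
block of at most `w` neighbouring sites of each of them, makes a joint measurement of all these
blocks (a positive operator valued measure on the tensor product of the block spaces) and turns the
outcome into an element of `Out`. -/
structure LocalProtocol (d N w : ℕ) (Out : Type) where
  /-- the number of copies that are used -/
  copies : ℕ
  /-- the left ends of the blocks -/
  lo : Fin copies → ℕ
  /-- the right ends of the blocks -/
  hi : Fin copies → ℕ
  size_le : ∀ c, hi c ≤ lo c + w
  /-- the measurement outcomes -/
  Outcome : Type
  /-- the events -/
  [measurableSpace : MeasurableSpace Outcome]
  /-- the positive operator of an event -/
  effect : Set Outcome →
    Matrix (∀ c, Cfg d N (lo c) (hi c)) (∀ c, Cfg d N (lo c) (hi c)) ℂ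
  effect_posSemidef : ∀ S, MeasurableSet S → (effect S).PosSemidef
  effect_univ : effect Set.univ = 1
  effect_iUnion : ∀ S : ℕ → Set Outcome, (∀ i, MeasurableSet (S i)) →
    Pairwise (Function.onFun Disjoint S) → HasSum (fun i => effect (S i)) (effect (⋃ i, S i))
  /-- the classical processing of the outcome -/
  output : Outcome → Out

attribute [instance] LocalProtocol.measurableSpace

namespace LocalProtocol

variable {d N w : ℕ} {Out Out' : Type}

/-- The joint state of the measured blocks of the copies: the tensor product of the marginals. -/
def jointState (P : LocalProtocol d N w Out) (ω : ChainOp d N) :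
    Matrix (∀ c, Cfg d N (P.lo c) (P.hi c)) (∀ c, Cfg d N (P.lo c) (P.hi c)) ℂ :=
  Matrix.of fun p q => ∏ c, marginal ω (P.lo c) (P.hi c) (p c) (q c)

/-- The probability of an event when the procedure runs on copies of `ω` (Born rule). -/
def prob (P : LocalProtocol d N w Out) (ω : ChainOp d N) (S : Set P.Outcome) : ℝ :=
  (P.effect S * P.jointState ω).trace.re

/-- On copies of `ω`, the output has the property `good` with probability at least `p`. -/
def SucceedsWithProb (P : LocalProtocol d N w Out) (ω : ChainOp d N) (good : Out → Prop)
    (p : ℝ) : Prop :=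
  ∃ S : Set P.Outcome, MeasurableSet S ∧ (∀ x ∈ S, good (P.output x)) ∧ p ≤ P.prob ω S

/-- The same measurement, followed by the classical computation `f`. -/
def postprocess (P : LocalProtocol d N w Out) (f : Out → Out') : LocalProtocol d N w Out' :=
  { P with output := f ∘ P.output }

end LocalProtocol

/-! ### The learning algorithm -/

/-- Estimates (arbitrary matrices) of the marginals of a state on the blocks `[j-l+1, j+r]` and
`[j-l, j+r]` of the chain. Only `short 1, …, short N` and `long 0, …, long (N-1)` are used. -/
structure MarginalEstimates (d N l r : ℕ) where
  /-- `short j`: the estimate for the sites `j - l + 1, …, j + r` -/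
  short : ∀ j : ℕ, Op d N (j - l) (j + r)
  /-- `long i`, for `i = j - 1`: the estimate for the sites `j - l, …, j + r` -/
  long : ∀ i : ℕ, Op d N (i - l) (i + 1 + r)

/-- All the marginals are estimated at precision `prec` in Hilbert–Schmidt distance. -/
def MarginalEstimates.Accurate {d N l r : ℕ} (est : MarginalEstimates d N l r) (ω : ChainOp d N)
    (prec : ℝ) : Prop :=
  (∀ j, 1 ≤ j → j ≤ N → hsNorm (est.short j - marginal ω (j - l) (j + r)) ≤ prec) ∧
    ∀ i, i < N → hsNorm (est.long i - marginal ω (i - l) (i + 1 + r)) ≤ prec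

section Reconstruction

variable {d N l r : ℕ}

/-- The functional `Ω̂_A^{[i-l+1, i, i+1+r]}[W]`, that is, `Y ↦ ω̂(Y ⊗ A ⊗ W)`, on the `l` sites to the
left of the cut `i`, where `A` lives on site `i + 1` and `W` on the `r` sites after it. -/
def siteFunctional (est : MarginalEstimates d N l r) (i : ℕ) (A : Op d N i (i + 1))
    (W : Op d N (i + 1) (i + 1 + r)) (Y : Op d N (i - l) i) : ℂ :=
  corr (Nat.sub_le i l) ((Nat.le_add_right i 1).trans (Nat.le_add_right (i + 1) r)) (est.long i)
    (tensorOp (Nat.le_add_right i 1) (Nat.le_add_right (i + 1) r) A W) Y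

/-- The truncated pseudo-inverse of `Ω̂^{[i-l+1, i, i+r]}`, from functionals on the left block to
operators on the right block. -/
def liftFunctional (η : ℝ) (est : MarginalEstimates d N l r) (i : ℕ)
    (φ : Op d N (i - l) i → ℂ) : Op d N i (i + r) :=
  Matrix.of fun x x' =>
    (truncPinv η (corrMat (Nat.sub_le i l) (Nat.le_add_right i r) (est.short i))).mulVec
      (fun y => φ (Matrix.single y.1 y.2 1)) (x, x')

/-- For the `k` sites after the cut `i`, with the operators `A i, A (i + 1), …` on them: the operator
on the block `[i, i + r)` that is obtained by applying, from the right to the left, `siteFunctional`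
and `liftFunctional` in turn.

If the columns of `Û_j` are the left singular vectors of `Ω̂^{[j-l+1, j, j+r]}` with singular value at
least `η`, and `K̂⁽ʲ⁾_A = Û_{j-1}† Ω̂_A^{[j-l, j-1, j+r]} (Û_j† Ω̂^{[j-l+1, j, j+r]})⁺` (without `Û_0†`
for `j = 1`, and without the pseudo-inverse for `j = N`), then the pseudo-inverse in
`liftFunctional` is `(Û_j† Ω̂^{[j-l+1, j, j+r]})⁺ Û_j†`. Hence, for `k = N - i`, this operator is
`(Û_i† Ω̂^{[i-l+1, i, i+r]})⁺ K̂⁽ⁱ⁺¹⁾_{A i} ⋯ K̂⁽ᴺ⁾_{A (N-1)}`. -/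
def tailOp (η : ℝ) (est : MarginalEstimates d N l r) (A : ∀ i, Op d N i (i + 1)) :
    (k : ℕ) → (i : ℕ) → Op d N i (i + r)
  | 0, _ => 1
  | k + 1, i => liftFunctional η est i (siteFunctional est i (A i) (tailOp η est A k (i + 1)))

/-- The value `K̂⁽¹⁾_{A 0} ⋯ K̂⁽ᴺ⁾_{A (N-1)}` of the reconstructed functional on
`A 0 ⊗ ⋯ ⊗ A (N - 1)`. -/
def reconstructedValue (η : ℝ) (est : MarginalEstimates d N l r) (A : ∀ i, Op d N i (i + 1)) : ℂ :=
  siteFunctional est 0 (A 0) (tailOp η est A (N - 1) (0 + 1)) 1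

/-- The spectral state reconstruction: the matrix `ω̂` with `Tr (ω̂ X)` equal to the reconstructed
value for each product `X` of matrix units, hence for all `X` by linearity. -/
def spectralReconstruction (η : ℝ) (est : MarginalEstimates d N l r) : ChainOp d N :=
  Matrix.of fun q p =>
    reconstructedValue η est fun _ => Matrix.single (fun x => p x.1) (fun x => q x.1) 1

end Reconstruction

/-- The learning algorithm with threshold `η`: run the tomography subroutine `T` and apply the
spectral state reconstruction to its estimates. It measures nothing else, and it uses nothing about
the state but these estimates. -/
def learn {d N l r w : ℕ} (T : LocalProtocol d N w (MarginalEstimates d N l r)) (η : ℝ) :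
    LocalProtocol d N w (ChainOp d N) :=
  T.postprocess (spectralReconstruction η)

/-- The precision
`min_{j = 0, …, N} ε σ³(Ω^{[j-l+1, j, j+r]}) / (20 N d_ℬ √d_𝒜)`. -/
def requiredPrecision {d N : ℕ} (ω : ChainOp d N) (l r dB : ℕ) (ε : ℝ) : ℝ :=
  ⨅ j : Fin (N + 1), ε * sigmaMin ω l r j ^ 3 / (20 * N * dB * √d)

end SpinChain

end

/-! The output is a product of estimated transfer matrices. A site by site comparison of these
matrices would lose a factor from the inverse singular values at every site. The proof therefore
rewrites the reconstruction as an evolution in the memory algebra `ℬ`, where the exact steps are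
contractions, so that the errors only add up.

Each `𝓔⁽ⁱ⁾` is extended from `𝒜` to all matrices by the trace preserving conditional expectation.
This does not change `ω`, and the extension is completely positive and unital, hence completely
contractive (`IsChannel.bnorm_amp_le`).

Sweeping from right to left, every intermediate operator `tailOp` gets a representative `memElt` in
`ℬ` that induces the same functional on all sites to its left (`Setting.leftFun_memElt`). The
representatives evolve by `𝓔⁽ⁱ⁾ + Δᵢ`, with `Δᵢ` the map `stepError`. A correction built from local
data is enough because of the rank condition: a functional induced by the tail on the whole left
part is determined by its restriction to the last `l` sites, and it is already induced by an
operator on the next `r` sites (`Realizes.factor`).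

The norm of `Δᵢ` is at most the product of three factors. The pseudo-inverse that lifts a functional
back to an operator gives `1/σᵢ`. The one-step error of the estimated matrices gives `6e/σᵢ`, for
estimates of precision `e` (`IsEstimate.norm_step_le`); here Weyl's inequality puts the threshold
inside a gap of the estimated singular values (`sqrt_eigenvalues_gap`). Reading off the tail
operator from its functional gives `2√d_𝒜/σᵢ₊₁` (`IsEstimate.exists_leftInverse`,
`Realizes.vnorm_spread_le`).

The trace norm is a supremum over contractions on the whole chain, possibly entangled, so `Δᵢ` is
amplified by the identity on all earlier sites. As its values are `d_ℬ × d_ℬ` matrices, this costs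
at most a factor `d_ℬ` (`bnorm_amplify_le`). The prescribed precision makes each amplified error at
most `κ = ε/N`. The total is at most `(1 + κ)^N - 1 ≤ exp ε - 1 ≤ 2ε` in trace norm, that is, `ε` in
trace distance. -/

noncomputable section

namespace SpinChain

set_option linter.unusedSectionVars false

open scoped Matrix.Norms.L2Operator
open Matrix

/-! ### Perturbation of singular values. -/

section SingularValues

open Module

variable {E F : Type*} [NormedAddCommGroup E] [InnerProductSpace ℂ E] [FiniteDimensional ℂ E]
  [NormedAddCommGroup F] [InnerProductSpace ℂ F] [FiniteDimensional ℂ F]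

/-- The form `⟨v, T†T v⟩` is diagonal in an eigenbasis of `T†T`, with the squared singular values as
eigenvalues. -/
lemma norm_sq_apply_eq_sum_singularValues (T : E →ₗ[ℂ] F) {n : ℕ} (hn : finrank ℂ E = n) (v : E) :
    ‖T v‖ ^ 2 = ∑ i : Fin n, T.singularValues i ^ 2 *
      ‖(T.isSymmetric_adjoint_comp_self.eigenvectorBasis hn).repr v i‖ ^ 2 := by
  set b := T.isSymmetric_adjoint_comp_self.eigenvectorBasis hn
  have h1 : (‖T v‖ ^ 2 : ℝ) = RCLike.re (inner ℂ v ((LinearMap.adjoint T ∘ₗ T) v)) := by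
    rw [LinearMap.comp_apply, LinearMap.adjoint_inner_right, inner_self_eq_norm_sq]
  have h2 : inner ℂ v ((LinearMap.adjoint T ∘ₗ T) v) =
      ∑ i, inner ℂ (b.repr v i) (b.repr ((LinearMap.adjoint T ∘ₗ T) v) i) := by
    rw [← b.repr.inner_map_map, PiLp.inner_apply]
  rw [h1, h2, map_sum]
  refine Finset.sum_congr rfl fun i _ => ?_
  rw [LinearMap.IsSymmetric.eigenvectorBasis_apply_self_apply, T.sq_singularValues_fin hn,
    ← smul_eq_mul, inner_smul_right, inner_self_eq_norm_sq_to_K]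
  norm_cast

/-- Weyl's perturbation inequality for singular values. -/
lemma singularValues_le_add (T T' : E →ₗ[ℂ] F) {e : ℝ} (he : 0 ≤ e)
    (h : ∀ v, ‖T v - T' v‖ ≤ e * ‖v‖) (k : ℕ) :
    T.singularValues k ≤ T'.singularValues k + e := by
  classical
  by_cases hk : finrank ℂ E ≤ k
  · rw [T.singularValues_of_finrank_le hk, T'.singularValues_of_finrank_le hk, zero_add]
    exact he
  push Not at hk
  set n := finrank ℂ E with hn
  set b := T.isSymmetric_adjoint_comp_self.eigenvectorBasis hn.symm
  set b' := T'.isSymmetric_adjoint_comp_self.eigenvectorBasis hn.symm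
  -- a nonzero vector in the span of the top `k + 1` vectors of `b` and orthogonal to
  -- the top `k` vectors of `b'`
  let Φ : E →ₗ[ℂ] ({i : Fin n // k < i.val} ⊕ {i : Fin n // i.val < k} → ℂ) :=
    LinearMap.pi (Sum.elim (fun i => (b.toBasis.coord i.1)) (fun i => (b'.toBasis.coord i.1)))
  -- The first basis imposes `n - 1 - k` linear conditions and the second one `k`, together one
  -- fewer than the dimension.
  have hcard : Fintype.card ({i : Fin n // k < i.val} ⊕ {i : Fin n // i.val < k}) < n := by
    have h1 : Fintype.card ({i : Fin n // k < i.val} ⊕ {i : Fin n // i.val < k}) =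
        Fintype.card {i : Fin n // i ≠ ⟨k, hk⟩} := by
      rw [Fintype.card_sum, ← Fintype.card_subtype_or_disjoint]
      · refine Fintype.card_congr (Equiv.subtypeEquivRight fun i => ?_)
        rw [Ne, Fin.ext_iff]; simp; omega
      · rw [Pi.disjoint_iff]; intro i; simp only [Prop.disjoint_iff]; omega
    rw [h1, Fintype.card_subtype_compl, Fintype.card_fin, Fintype.card_subtype_eq]
    omega
  have hker : LinearMap.ker Φ ≠ ⊥ := by
    apply LinearMap.ker_ne_bot_of_finrank_lt
    rw [Module.finrank_fintype_fun_eq_card]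
    exact hcard
  obtain ⟨v, hv, hv0⟩ := Submodule.exists_mem_ne_zero_of_ne_bot hker
  rw [LinearMap.mem_ker] at hv
  have hvb : ∀ i : Fin n, k < i.val → b.repr v i = 0 := fun i hi => by
    simpa [Φ] using congrFun hv (Sum.inl ⟨i, hi⟩)
  have hvb' : ∀ i : Fin n, i.val < k → b'.repr v i = 0 := fun i hi => by
    simpa [Φ] using congrFun hv (Sum.inr ⟨i, hi⟩)
  have hvpos : 0 < ‖v‖ := norm_pos_iff.2 hv0
  have hnorm : ∀ c : OrthonormalBasis (Fin n) ℂ E, ‖v‖ ^ 2 = ∑ i, ‖c.repr v i‖ ^ 2 := fun c => by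
    rw [← c.repr.norm_map v, EuclideanSpace.norm_sq_eq]
  have hlow : T.singularValues k * ‖v‖ ≤ ‖T v‖ := by
    refine le_of_sq_le_sq ?_ (norm_nonneg _)
    rw [mul_pow, norm_sq_apply_eq_sum_singularValues T hn.symm, hnorm b, Finset.mul_sum]
    refine Finset.sum_le_sum fun i _ => ?_
    rcases lt_or_ge k i.val with hi | hi
    · have := hvb i hi
      simp [b] at this ⊢
      simp [this]
    · gcongr
      · exact T.singularValues_nonneg _
      · exact T.singularValues_antitone hi
  have hup : ‖T' v‖ ≤ T'.singularValues k * ‖v‖ := by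
    refine le_of_sq_le_sq ?_ (mul_nonneg (T'.singularValues_nonneg _) hvpos.le)
    rw [mul_pow, norm_sq_apply_eq_sum_singularValues T' hn.symm, hnorm b', Finset.mul_sum]
    refine Finset.sum_le_sum fun i _ => ?_
    rcases lt_or_ge i.val k with hi | hi
    · have := hvb' i hi
      simp [b'] at this ⊢
      simp [this]
    · gcongr
      · exact T'.singularValues_nonneg _
      · exact T'.singularValues_antitone hi
  have h3 : ‖T v‖ ≤ ‖T' v‖ + ‖T v - T' v‖ := by
    simpa using norm_add_le (T' v) (T v - T' v)
  have h4 := h v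
  refine le_of_mul_le_mul_right ?_ hvpos
  linarith

end SingularValues

/-! ### Operator norm and Hilbert–Schmidt norm. -/

section MatrixNorms

variable {m n : Type} [Fintype m] [Fintype n] [DecidableEq m] [DecidableEq n]

lemma norm_toLp_mulVec_le (M : Matrix m n ℂ) (v : n → ℂ) :
    ‖WithLp.toLp 2 (M *ᵥ v)‖ ≤ ‖M‖ * ‖WithLp.toLp 2 v‖ :=
  Matrix.l2_opNorm_mulVec M (WithLp.toLp 2 v)

lemma l2_opNorm_le_of_mulVec (M : Matrix m n ℂ) {c : ℝ} (hc : 0 ≤ c)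
    (h : ∀ v : n → ℂ, ‖WithLp.toLp 2 (M *ᵥ v)‖ ≤ c * ‖WithLp.toLp 2 v‖) : ‖M‖ ≤ c := by
  rw [Matrix.l2_opNorm_def]
  refine ContinuousLinearMap.opNorm_le_bound _ hc fun v => ?_
  exact h v.ofLp

lemma hsNorm_nonneg (M : Matrix m n ℂ) : 0 ≤ hsNorm M := Real.sqrt_nonneg _

lemma hsNorm_sq (M : Matrix m n ℂ) : hsNorm M ^ 2 = ∑ i, ∑ j, ‖M i j‖ ^ 2 :=
  Real.sq_sqrt (by positivity)

lemma l2_opNorm_le_hsNorm (M : Matrix m n ℂ) : ‖M‖ ≤ hsNorm M := by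
  refine l2_opNorm_le_of_mulVec M (hsNorm_nonneg M) fun v => ?_
  refine le_of_sq_le_sq ?_ (mul_nonneg (hsNorm_nonneg M) (norm_nonneg _))
  rw [mul_pow, hsNorm_sq, EuclideanSpace.norm_sq_eq, EuclideanSpace.norm_sq_eq, Finset.sum_mul]
  refine Finset.sum_le_sum fun i _ => ?_
  simp only [Matrix.mulVec, dotProduct]
  calc ‖∑ j, M i j * v j‖ ^ 2 ≤ (∑ j, ‖M i j‖ * ‖v j‖) ^ 2 := by
        gcongr
        exact (norm_sum_le _ _).trans_eq (Finset.sum_congr rfl fun j _ => norm_mul _ _)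
    _ ≤ _ := Finset.sum_mul_sq_le_sq_mul_sq _ _ _

lemma norm_sq_le_of_mul_conjTranspose (M : Matrix m n ℂ) {c : ℝ} (h : ‖M * Mᴴ‖ ≤ c ^ 2)
    (hc : 0 ≤ c) : ‖M‖ ≤ c := by
  have := Matrix.l2_opNorm_conjTranspose_mul_self Mᴴ
  rw [Matrix.conjTranspose_conjTranspose, Matrix.l2_opNorm_conjTranspose] at this
  exact abs_le_of_sq_le_sq' (by nlinarith) hc |>.2

lemma norm_le_of_conjTranspose_mul (M : Matrix m n ℂ) {c : ℝ} (h : ‖Mᴴ * M‖ ≤ c ^ 2)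
    (hc : 0 ≤ c) : ‖M‖ ≤ c := by
  have := Matrix.l2_opNorm_conjTranspose_mul_self M
  exact abs_le_of_sq_le_sq' (by nlinarith) hc |>.2

end MatrixNorms

/-! ### Functional calculus of a Hermitian matrix. -/

section FunctionalCalculus

variable {n : Type} [Fintype n] [DecidableEq n] {H : Matrix n n ℂ} (hH : H.IsHermitian)

lemma cfc_mul_cfc (f g : ℝ → ℝ) : hH.cfc f * hH.cfc g = hH.cfc (fun x => f x * g x) := by
  simp only [Matrix.IsHermitian.cfc, ← map_mul, Matrix.diagonal_mul_diagonal]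
  congr 2
  funext i
  simp

lemma cfc_sub_cfc (f g : ℝ → ℝ) : hH.cfc f - hH.cfc g = hH.cfc (fun x => f x - g x) := by
  simp only [Matrix.IsHermitian.cfc, ← map_sub, Matrix.diagonal_sub]
  congr 2
  funext i
  simp

lemma cfc_id' : hH.cfc (fun x => x) = H := hH.spectral_theorem.symm

lemma cfc_const_one : hH.cfc (fun _ => 1) = 1 := by
  have : (RCLike.ofReal ∘ (fun _ => (1 : ℝ)) ∘ hH.eigenvalues : n → ℂ) = fun _ => 1 := by
    funext i; simp
  simp only [Matrix.IsHermitian.cfc, this, Matrix.diagonal_one, map_one]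

lemma cfc_conjTranspose (f : ℝ → ℝ) : (hH.cfc f)ᴴ = hH.cfc f := by
  rw [← Matrix.star_eq_conjTranspose]
  simp only [Matrix.IsHermitian.cfc, ← map_star, Matrix.star_eq_conjTranspose,
    Matrix.diagonal_conjTranspose]
  congr 2
  funext i
  simp

lemma cfc_congr' {f g : ℝ → ℝ} (h : ∀ i, f (hH.eigenvalues i) = g (hH.eigenvalues i)) :
    hH.cfc f = hH.cfc g := by
  simp only [Matrix.IsHermitian.cfc]
  congr 2
  funext i
  simp [h i]

lemma trace_cfc (f : ℝ → ℝ) : (hH.cfc f).trace = ∑ i, (f (hH.eigenvalues i) : ℂ) := by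
  simp only [Matrix.IsHermitian.cfc, Unitary.conjStarAlgAut_apply]
  rw [Matrix.trace_mul_comm, ← mul_assoc]
  simp [Matrix.trace]

lemma norm_cfc_le (f : ℝ → ℝ) {c : ℝ} (hc : 0 ≤ c) (h : ∀ i, |f (hH.eigenvalues i)| ≤ c) :
    ‖hH.cfc f‖ ≤ c := by
  have : ‖hH.cfc f‖ = ‖(Matrix.diagonal (RCLike.ofReal ∘ f ∘ hH.eigenvalues) : Matrix n n ℂ)‖ := by
    simp only [Matrix.IsHermitian.cfc, Unitary.conjStarAlgAut_apply]
    rw [← Unitary.coe_star, CStarRing.norm_mul_coe_unitary, CStarRing.norm_coe_unitary_mul]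
  rw [this, Matrix.l2_opNorm_diagonal, pi_norm_le_iff_of_nonneg hc]
  intro i
  simpa using h i

end FunctionalCalculus

/-! ### Trace norm duality and truncated pseudo-inverses. -/

section Pinv

variable {m n : Type} [Fintype m] [Fintype n] [DecidableEq m] [DecidableEq n]

lemma adjoint_comp_toEuclideanLin (M : Matrix m n ℂ) :
    LinearMap.adjoint (Matrix.toEuclideanLin M) ∘ₗ Matrix.toEuclideanLin M =
      Matrix.toEuclideanLin (Mᴴ * M) := by
  rw [← Matrix.toEuclideanLin_conjTranspose_eq_adjoint]
  ext v i
  simp [Matrix.toLpLin_apply]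

lemma singularValues_toEuclideanLin (M : Matrix m n ℂ) (i : Fin (Fintype.card n)) :
    singVal M i = √((Matrix.isHermitian_conjTranspose_mul_self M).eigenvalues₀ i) := by
  have hc : Module.finrank ℂ (EuclideanSpace ℂ n) = Fintype.card n := finrank_euclideanSpace
  rw [singVal, LinearMap.singularValues_fin _ hc]
  congr 1
  have key : ∀ (T T' : EuclideanSpace ℂ n →ₗ[ℂ] EuclideanSpace ℂ n) (h : T = T')
      (hT : T.IsSymmetric) (hT' : T'.IsSymmetric), hT.eigenvalues hc i = hT'.eigenvalues hc i := by
    rintro T _ rfl _ _; rfl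
  exact key _ _ (adjoint_comp_toEuclideanLin M) _ _

lemma sqrt_eigenvalues_eq_singVal (M : Matrix m n ℂ) (i : n) :
    ∃ k, √((Matrix.isHermitian_conjTranspose_mul_self M).eigenvalues i) = singVal M k :=
  ⟨_, (singularValues_toEuclideanLin M _).symm⟩

lemma traceNorm_eq_sum (M : Matrix n n ℂ) :
    traceNorm M = ∑ i, √((Matrix.isHermitian_conjTranspose_mul_self M).eigenvalues i) := by
  rw [traceNorm, Finset.sum_range]
  simp_rw [singularValues_toEuclideanLin]
  exact (Equiv.sum_comp (Fintype.equivOfCardEq (Fintype.card_fin _)).symm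
    (fun k => √((Matrix.isHermitian_conjTranspose_mul_self M).eigenvalues₀ k))).symm

lemma eigenvalues_conjTranspose_mul_self_nonneg (M : Matrix m n ℂ) (i : n) :
    0 ≤ (Matrix.isHermitian_conjTranspose_mul_self M).eigenvalues i :=
  (Matrix.posSemidef_conjTranspose_mul_self M).eigenvalues_nonneg i

/-- The trace norm is attained by duality with a contraction. -/
lemma exists_traceNorm_eq (M : Matrix n n ℂ) :
    ∃ X : Matrix n n ℂ, ‖X‖ ≤ 1 ∧ (traceNorm M : ℂ) = (M * X).trace := by
  set hH := Matrix.isHermitian_conjTranspose_mul_self M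
  have hnn := eigenvalues_conjTranspose_mul_self_nonneg M
  -- The witness is `(M†M)^(-1/2) M†`, the adjoint of the partial isometry of the polar
  -- decomposition; the convention `0⁻¹ = 0` handles the kernel.
  refine ⟨hH.cfc (fun x => (√x)⁻¹) * Mᴴ, ?_, ?_⟩
  · refine norm_sq_le_of_mul_conjTranspose _ ?_ zero_le_one
    rw [Matrix.conjTranspose_mul, Matrix.conjTranspose_conjTranspose, cfc_conjTranspose,
      Matrix.mul_assoc, ← Matrix.mul_assoc Mᴴ]
    nth_rw 2 [← cfc_id' hH]
    rw [cfc_mul_cfc, cfc_mul_cfc]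
    refine norm_cfc_le _ _ (by norm_num) fun i => ?_
    rcases (hnn i).eq_or_lt with h | h
    · simp [← h]
    · have : √(hH.eigenvalues i) ≠ 0 := (Real.sqrt_pos.2 h).ne'
      have h2 := Real.mul_self_sqrt h.le
      have : (√(hH.eigenvalues i))⁻¹ * (hH.eigenvalues i * (√(hH.eigenvalues i))⁻¹) = 1 := by
        field_simp; nlinarith
      rw [this]; norm_num
  · rw [Matrix.trace_mul_comm, Matrix.mul_assoc]
    nth_rw 2 [← cfc_id' hH]
    rw [cfc_mul_cfc, trace_cfc, traceNorm_eq_sum]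
    push_cast
    refine Finset.sum_congr rfl fun i _ => ?_
    norm_cast
    rcases (hnn i).eq_or_lt with h | h
    · simp [← h]
    · have : √(hH.eigenvalues i) ≠ 0 := (Real.sqrt_pos.2 h).ne'
      have h2 := Real.mul_self_sqrt h.le
      field_simp; nlinarith

lemma singVal_le_add (M M' : Matrix m n ℂ) (k : ℕ) : singVal M k ≤ singVal M' k + ‖M - M'‖ := by
  refine singularValues_le_add _ _ (norm_nonneg _) (fun v => ?_) k
  rw [← LinearMap.sub_apply, ← map_sub]
  exact norm_toLp_mulVec_le (M - M') v.ofLp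

lemma finrank_range_toEuclideanLin (M : Matrix m n ℂ) :
    Module.finrank ℂ (Matrix.toEuclideanLin M).range = M.rank := by
  rw [Matrix.rank_eq_finrank_range_toLin M (EuclideanSpace.basisFun m ℂ).toBasis
    (EuclideanSpace.basisFun n ℂ).toBasis, Matrix.toEuclideanLin_eq_toLin_orthonormal]

/-- The singular values of a perturbation of `M` are either small or almost as large as the
smallest nonzero singular value of `M`. -/
lemma sqrt_eigenvalues_gap (M M' : Matrix m n ℂ) {e : ℝ} (he : ‖M' - M‖ ≤ e) (i : n) :
    √((Matrix.isHermitian_conjTranspose_mul_self M').eigenvalues i) ≤ e ∨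
      singVal M (M.rank - 1) - e ≤
        √((Matrix.isHermitian_conjTranspose_mul_self M').eigenvalues i) := by
  obtain ⟨k, hk⟩ := sqrt_eigenvalues_eq_singVal M' i
  rw [hk]
  -- Below the rank the singular value of `M` is at least its smallest nonzero one, from the rank on
  -- it is zero; Weyl's inequality moves each by at most `e`.
  rcases lt_or_ge k M.rank with h | h
  · right
    have h1 : singVal M (M.rank - 1) ≤ singVal M k :=
      LinearMap.singularValues_antitone _ (by omega)
    have h2 := singVal_le_add M M' k
    rw [norm_sub_rev] at h2
    linarith
  · left
    have h1 : singVal M k = 0 := by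
      rw [singVal, LinearMap.singularValues_eq_zero_iff_le_finrank_range,
        finrank_range_toEuclideanLin]
      exact h
    have h2 := singVal_le_add M' M k
    linarith

lemma singVal_pos (M : Matrix m n ℂ) (hM : M ≠ 0) : 0 < singVal M (M.rank - 1) := by
  rw [singVal, LinearMap.singularValues_pos_iff_lt_finrank_range, finrank_range_toEuclideanLin]
  have : M.rank ≠ 0 := by
    rwa [Ne, ← finrank_range_toEuclideanLin, Submodule.finrank_eq_zero, LinearMap.range_eq_bot,
      LinearEquiv.map_eq_zero_iff]
  omega

/-- This is the spectral projection onto the kept right singular vectors; positivity of `η` ensures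
that no zero eigenvalue is inverted. -/
lemma truncPinv_mul_self (M : Matrix m n ℂ) {η : ℝ} (hη : 0 < η) :
    truncPinv η M * M =
      (Matrix.isHermitian_conjTranspose_mul_self M).cfc (fun x => if η ≤ √x then 1 else 0) := by
  rw [truncPinv, Matrix.mul_assoc]
  nth_rw 2 [← cfc_id' (Matrix.isHermitian_conjTranspose_mul_self M)]
  rw [cfc_mul_cfc]
  refine cfc_congr' _ fun i => ?_
  split_ifs with h
  · refine inv_mul_cancel₀ fun h0 => ?_
    rw [h0, Real.sqrt_zero] at h
    linarith
  · simp

lemma norm_truncPinv_le (M : Matrix m n ℂ) {η τ : ℝ} (hτ : 0 < τ)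
    (h : ∀ i, η ≤ √((Matrix.isHermitian_conjTranspose_mul_self M).eigenvalues i) →
      τ ≤ √((Matrix.isHermitian_conjTranspose_mul_self M).eigenvalues i)) :
    ‖truncPinv η M‖ ≤ τ⁻¹ := by
  refine norm_sq_le_of_mul_conjTranspose _ ?_ (inv_nonneg.2 hτ.le)
  rw [truncPinv, Matrix.conjTranspose_mul, Matrix.conjTranspose_conjTranspose, cfc_conjTranspose,
    Matrix.mul_assoc, ← Matrix.mul_assoc Mᴴ]
  nth_rw 2 [← cfc_id' (Matrix.isHermitian_conjTranspose_mul_self M)]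
  rw [cfc_mul_cfc, cfc_mul_cfc]
  refine norm_cfc_le _ _ (by positivity) fun i => ?_
  split_ifs with hi
  · have h1 := h i hi
    set x := (Matrix.isHermitian_conjTranspose_mul_self M).eigenvalues i
    have hx : 0 < x := Real.sqrt_pos.1 (hτ.trans_le h1)
    have : x⁻¹ * (x * x⁻¹) = x⁻¹ := by field_simp
    rw [this, abs_of_pos (inv_pos.2 hx), inv_pow]
    gcongr
    exact (Real.le_sqrt' hτ).1 h1
  · simp; positivity

/-- The product is self-adjoint and idempotent, so its norm `t` satisfies `t = t * t`. -/
lemma norm_mul_truncPinv_le (M : Matrix m n ℂ) {η : ℝ} (hη : 0 < η) :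
    ‖M * truncPinv η M‖ ≤ 1 := by
  set hH := Matrix.isHermitian_conjTranspose_mul_self M
  have h1 : (M * truncPinv η M)ᴴ * (M * truncPinv η M) = M * truncPinv η M := by
    have h2 : (M * truncPinv η M)ᴴ = M * truncPinv η M := by
      rw [truncPinv, Matrix.conjTranspose_mul, Matrix.conjTranspose_mul,
        Matrix.conjTranspose_conjTranspose, cfc_conjTranspose, Matrix.mul_assoc]
    rw [h2, Matrix.mul_assoc, ← Matrix.mul_assoc _ M, truncPinv_mul_self M hη, truncPinv,
      ← Matrix.mul_assoc (hH.cfc _), cfc_mul_cfc]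
    congr 3
    funext x
    split_ifs <;> simp
  have h3 := Matrix.l2_opNorm_conjTranspose_mul_self (M * truncPinv η M)
  rw [h1] at h3
  nlinarith [norm_nonneg (M * truncPinv η M)]

/-- Only the discarded singular values survive on the left, and `h` says that they are not merely
below `η` but at most `e`. -/
lemma norm_mul_one_sub_truncPinv_mul_le (M : Matrix m n ℂ) {η e : ℝ} (hη : 0 < η) (he : 0 ≤ e)
    (h : ∀ i, ¬ η ≤ √((Matrix.isHermitian_conjTranspose_mul_self M).eigenvalues i) →
      √((Matrix.isHermitian_conjTranspose_mul_self M).eigenvalues i) ≤ e) :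
    ‖M * (1 - truncPinv η M * M)‖ ≤ e := by
  refine norm_le_of_conjTranspose_mul _ ?_ he
  rw [truncPinv_mul_self M hη, ← cfc_const_one (Matrix.isHermitian_conjTranspose_mul_self M),
    cfc_sub_cfc, Matrix.conjTranspose_mul, cfc_conjTranspose, Matrix.mul_assoc,
    ← Matrix.mul_assoc Mᴴ]
  nth_rw 2 [← cfc_id' (Matrix.isHermitian_conjTranspose_mul_self M)]
  rw [cfc_mul_cfc, cfc_mul_cfc]
  refine norm_cfc_le _ _ (by positivity) fun i => ?_
  by_cases hi : η ≤ √((Matrix.isHermitian_conjTranspose_mul_self M).eigenvalues i)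
  · simp [hi]; positivity
  · have h1 := h i hi
    have h0 := eigenvalues_conjTranspose_mul_self_nonneg M i
    simp only [hi, if_false, sub_zero, mul_one, one_mul, abs_of_nonneg h0]
    exact (Real.sqrt_le_left he).1 h1

/-- The pseudo-inverse at the smallest nonzero singular value is an inverse on the range. -/
lemma mul_truncPinv_mul_self (M : Matrix m n ℂ) (hM : M ≠ 0) :
    M * truncPinv (singVal M (M.rank - 1)) M * M = M := by
  have hpos := singVal_pos M hM
  -- With no perturbation the gap says that a singular value is either zero or at least the smallest
  -- nonzero one, so the truncation discards only zeros.
  have hgap : ∀ i, _ := sqrt_eigenvalues_gap M M (e := 0) (by simp)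
  have h := norm_mul_one_sub_truncPinv_mul_le M hpos le_rfl fun i hi => by
    rcases hgap i with h | h
    · exact h
    · exact absurd (by simpa using h) hi
  have h0 := norm_le_zero_iff.1 h
  rw [Matrix.mul_sub, Matrix.mul_one, sub_eq_zero, ← Matrix.mul_assoc] at h0
  exact h0.symm

lemma norm_truncPinv_singVal_le (M : Matrix m n ℂ) (hM : M ≠ 0) :
    ‖truncPinv (singVal M (M.rank - 1)) M‖ ≤ (singVal M (M.rank - 1))⁻¹ :=
  norm_truncPinv_le M (singVal_pos M hM) fun _ hi => hi

end Pinv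

/-! ### The trace preserving conditional expectation. -/

section CondExp

variable {n : Type} [Fintype n] [DecidableEq n]

lemma eq_of_forall_trace_mul_eq (C : StarSubalgebra ℂ (Matrix n n ℂ)) {x y : Matrix n n ℂ}
    (hx : x ∈ C) (hy : y ∈ C) (h : ∀ z ∈ C, (z * x).trace = (z * y).trace) : x = y := by
  have h1 := h (star (x - y)) (star_mem (sub_mem hx hy))
  rw [← sub_eq_zero, ← Matrix.trace_sub, ← Matrix.mul_sub, Matrix.star_eq_conjTranspose,
    Matrix.trace_conjTranspose_mul_self_eq_zero_iff] at h1
  exact sub_eq_zero.1 h1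

/-- The orthogonal projection of a positive matrix onto a `*`-subalgebra is positive. -/
lemma posSemidef_of_forall_trace_mul_eq (C : StarSubalgebra ℂ (Matrix n n ℂ))
    {h x : Matrix n n ℂ} (hC : h ∈ C) (hx : x.PosSemidef)
    (htr : ∀ z ∈ C, (z * h).trace = (z * x).trace) : h.PosSemidef := by
  -- The adjoint of `h` also lies in `C` and represents the same functional on `C`, because `x` is
  -- Hermitian.
  have hH : h.IsHermitian := by
    refine eq_of_forall_trace_mul_eq C (star_mem hC) hC fun z hz => ?_
    have h1 := htr (star z) (star_mem hz)
    have h2 := congrArg star h1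
    rw [← Matrix.trace_conjTranspose, ← Matrix.trace_conjTranspose, Matrix.conjTranspose_mul,
      Matrix.conjTranspose_mul, Matrix.star_eq_conjTranspose, Matrix.conjTranspose_conjTranspose,
      hx.1.eq, Matrix.trace_mul_comm, Matrix.trace_mul_comm x] at h2
    rw [htr z hz]
    exact h2
  rw [hH.posSemidef_iff_eigenvalues_nonneg]
  intro i
  -- The spectral projection `z` of `h` at one eigenvalue `λ` lies in `C`. Then `λ Tr z = Tr (z h) =
  -- Tr (z x z) ≥ 0` while `Tr z > 0`, so `λ ≥ 0`.
  set f : ℝ → ℝ := fun t => if t = hH.eigenvalues i then 1 else 0 with hf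
  have hclosed : IsClosed (C : Set (Matrix n n ℂ)) :=
    Submodule.closed_of_finiteDimensional C.toSubalgebra.toSubmodule
  have hzC : hH.cfc f ∈ C := by
    rw [← hH.cfc_eq f]
    exact cfc_mem (𝕜' := ℂ) (hs := hclosed) f hC
  have hzz : hH.cfc f * hH.cfc f = hH.cfc f := by
    rw [cfc_mul_cfc]
    congr 1
    funext t
    simp only [hf]
    split_ifs <;> simp
  have h1 : 0 ≤ (hH.cfc f * h).trace := by
    rw [htr _ hzC, ← hzz, Matrix.mul_assoc, Matrix.trace_mul_comm]
    nth_rw 2 [← cfc_conjTranspose hH f]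
    exact (hx.mul_mul_conjTranspose_same _).trace_nonneg
  nth_rw 2 [← cfc_id' hH] at h1
  rw [cfc_mul_cfc, trace_cfc] at h1
  norm_cast at h1
  have h2 : ∑ j, f (hH.eigenvalues j) * hH.eigenvalues j =
      (∑ j, f (hH.eigenvalues j)) * hH.eigenvalues i := by
    rw [Finset.sum_mul]
    refine Finset.sum_congr rfl fun j _ => ?_
    simp only [hf]
    split_ifs with hj
    · rw [hj]
    · simp
  rw [h2] at h1
  have h3 : 0 < ∑ j, f (hH.eigenvalues j) := by
    refine Finset.sum_pos' (fun j _ => ?_) ⟨i, Finset.mem_univ _, ?_⟩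
    · simp only [hf]; split_ifs <;> norm_num
    · simp [hf]
  exact nonneg_of_mul_nonneg_right h1 h3

/-- The trace form is nondegenerate on `C`, since `C` contains adjoints; hence every functional `y ↦
Tr (y x)` on `C` is represented inside `C`. -/
lemma exists_condExp (C : StarSubalgebra ℂ (Matrix n n ℂ)) :
    ∃ P : Matrix n n ℂ →ₗ[ℂ] C, ∀ x, ∀ y ∈ C,
      (y * (P x : Matrix n n ℂ)).trace = (y * x).trace := by
  let tr : Matrix n n ℂ →ₗ[ℂ] Matrix n n ℂ →ₗ[ℂ] ℂ :=
    (LinearMap.mul ℂ (Matrix n n ℂ)).flip.compr₂ (Matrix.traceLinearMap n ℂ ℂ)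
  let S : C →ₗ[ℂ] Matrix n n ℂ := C.subtype.toAlgHom.toLinearMap
  let Φ : Matrix n n ℂ →ₗ[ℂ] Module.Dual ℂ C := (LinearMap.lcomp ℂ ℂ S).comp tr
  let Ψ : C →ₗ[ℂ] Module.Dual ℂ C := Φ.comp S
  have hinj : Function.Injective Ψ := by
    rw [← LinearMap.ker_eq_bot, LinearMap.ker_eq_bot']
    intro x hx
    refine Subtype.ext (eq_of_forall_trace_mul_eq C x.2 (zero_mem C) fun z hz => ?_)
    have := LinearMap.congr_fun hx ⟨z, hz⟩
    simpa [Ψ, Φ, tr, S] using this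
  have hfin : FiniteDimensional ℂ C :=
    inferInstanceAs (FiniteDimensional ℂ C.toSubalgebra.toSubmodule)
  let e := LinearEquiv.ofInjectiveOfFinrankEq Ψ hinj Subspace.dual_finrank_eq.symm
  refine ⟨e.symm.toLinearMap.comp Φ, fun x y hy => ?_⟩
  have h1 : Ψ (e.symm (Φ x)) = Φ x := e.apply_symm_apply (Φ x)
  have := LinearMap.congr_fun h1 ⟨y, hy⟩
  simpa [Ψ, Φ, tr, S] using this

/-- The trace preserving conditional expectation onto a `*`-subalgebra. -/
def condExp (C : StarSubalgebra ℂ (Matrix n n ℂ)) : Matrix n n ℂ →ₗ[ℂ] C :=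
  (exists_condExp C).choose

lemma trace_mul_condExp (C : StarSubalgebra ℂ (Matrix n n ℂ)) (x : Matrix n n ℂ)
    {y : Matrix n n ℂ} (hy : y ∈ C) :
    (y * (condExp C x : Matrix n n ℂ)).trace = (y * x).trace :=
  (exists_condExp C).choose_spec x y hy

lemma condExp_of_mem (C : StarSubalgebra ℂ (Matrix n n ℂ)) (x : C) :
    condExp C (x : Matrix n n ℂ) = x :=
  Subtype.ext (eq_of_forall_trace_mul_eq C (condExp C x).2 x.2 fun _ hz =>
    trace_mul_condExp C _ hz)

variable {κ : Type} [Fintype κ] [DecidableEq κ]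

/-- The matrices with blocks in a `*`-subalgebra. -/
def blockSubalgebra (κ : Type) [Fintype κ] [DecidableEq κ] (C : StarSubalgebra ℂ (Matrix n n ℂ)) :
    StarSubalgebra ℂ (Matrix (κ × n) (κ × n) ℂ) where
  carrier := {X | ∀ i j, (Matrix.of fun s t => X (i, s) (j, t)) ∈ C}
  mul_mem' {X Y} hX hY i j := by
    have : (Matrix.of fun s t => (X * Y) (i, s) (j, t)) =
        ∑ k, (Matrix.of fun s t => X (i, s) (k, t)) * (Matrix.of fun s t => Y (k, s) (j, t)) := by
      ext s t
      simp [Matrix.mul_apply, Fintype.sum_prod_type, Matrix.sum_apply]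
    rw [this]
    exact sum_mem fun k _ => mul_mem (hX i k) (hY k j)
  add_mem' {X Y} hX hY i j := add_mem (hX i j) (hY i j)
  algebraMap_mem' c i j := by
    by_cases h : i = j
    · subst h
      have : (Matrix.of fun s t => (algebraMap ℂ (Matrix (κ × n) (κ × n) ℂ) c) (i, s) (i, t)) =
          algebraMap ℂ _ c := by
        ext s t
        simp [Matrix.algebraMap_matrix_apply]
      rw [this]
      exact algebraMap_mem C c
    · have : (Matrix.of fun s t => (algebraMap ℂ (Matrix (κ × n) (κ × n) ℂ) c) (i, s) (j, t)) =
          0 := by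
        ext s t
        simp [Matrix.algebraMap_matrix_apply, h]
      rw [this]
      exact zero_mem C
  star_mem' {X} hX i j := star_mem (hX j i)

/-- The conditional expectation is completely positive. -/
lemma posSemidef_condExp_blocks (C : StarSubalgebra ℂ (Matrix n n ℂ))
    {Y : Matrix (κ × n) (κ × n) ℂ} (hY : Y.PosSemidef) :
    (Matrix.of fun p q : κ × n =>
      (condExp C (Matrix.of fun s t => Y (p.1, s) (q.1, t)) : Matrix n n ℂ) p.2 q.2).PosSemidef := by
  -- Applied block by block, the conditional expectation is the orthogonal projection onto the
  -- `*`-algebra of matrices with blocks in `C`, so the positivity criterion applies there.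
  refine posSemidef_of_forall_trace_mul_eq (blockSubalgebra κ C) (fun i j => ?_) hY fun z hz => ?_
  · exact (condExp C (Matrix.of fun s t => Y (i, s) (j, t))).2
  · have key : ∀ X : Matrix (κ × n) (κ × n) ℂ, (z * X).trace = ∑ i, ∑ k,
        ((Matrix.of fun s t => z (i, s) (k, t)) * (Matrix.of fun s t => X (k, s) (i, t))).trace := by
      intro X
      simp only [Matrix.trace, Matrix.diag, Matrix.mul_apply, Fintype.sum_prod_type, Matrix.of_apply]
      exact Finset.sum_congr rfl fun i _ => Finset.sum_comm
    rw [key, key]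
    refine Finset.sum_congr rfl fun i _ => Finset.sum_congr rfl fun k _ => ?_
    exact trace_mul_condExp C (Matrix.of fun s t => Y (k, s) (i, t)) (hz i k)

end CondExp

/-! ### Completely positive unital maps are complete contractions. -/

section Channels

variable {dA dB : ℕ} {B : StarSubalgebra ℂ (Matrix (Fin dB) (Fin dB) ℂ)}
variable {κ κ' ι : Type} [Fintype κ] [DecidableEq κ] [Fintype κ'] [DecidableEq κ']
  [Fintype ι] [DecidableEq ι]

/-- The complex matrix with the given blocks in `ℬ`. -/
def blockMat (x : Matrix κ κ B) : Matrix (κ × Fin dB) (κ × Fin dB) ℂ :=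
  Matrix.of fun p q => (x p.1 q.1 : Matrix (Fin dB) (Fin dB) ℂ) p.2 q.2

/-- The operator norm of a matrix with entries in `ℬ`. -/
def bnorm (x : Matrix κ κ B) : ℝ := ‖blockMat x‖

lemma bnorm_nonneg (x : Matrix κ κ B) : 0 ≤ bnorm x := norm_nonneg _

lemma blockMat_smul (c : ℂ) (x : Matrix κ κ B) : blockMat (c • x) = c • blockMat x := rfl

lemma blockMat_one : blockMat (1 : Matrix κ κ B) = 1 := by
  ext ⟨a, s⟩ ⟨b, t⟩
  by_cases h : a = b
  · subst h; simp [blockMat, Matrix.one_apply]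
  · simp [blockMat, Matrix.one_apply, h]

lemma bnorm_add_le (x y : Matrix κ κ B) : bnorm (x + y) ≤ bnorm x + bnorm y := norm_add_le _ _

lemma bnorm_smul (c : ℂ) (x : Matrix κ κ B) : bnorm (c • x) = ‖c‖ * bnorm x := by
  rw [bnorm, blockMat_smul, norm_smul, bnorm]

lemma l2_opNorm_submatrix_equiv {m n : Type} [Fintype m] [DecidableEq m] [Fintype n]
    [DecidableEq n] (M : Matrix m m ℂ) (e : n ≃ m) : ‖M.submatrix e e‖ = ‖M‖ := by
  have key : ∀ {m n : Type} [Fintype m] [DecidableEq m] [Fintype n] [DecidableEq n]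
      (M : Matrix m m ℂ) (e : n ≃ m), ‖M.submatrix e e‖ ≤ ‖M‖ := by
    intro m n _ _ _ _ M e
    have hn : ∀ w : m → ℂ, ‖WithLp.toLp 2 (w ∘ e)‖ = ‖WithLp.toLp 2 w‖ := fun w => by
      rw [EuclideanSpace.norm_eq, EuclideanSpace.norm_eq]
      congr 1
      exact e.sum_comp (fun i => ‖w i‖ ^ 2)
    refine l2_opNorm_le_of_mulVec _ (norm_nonneg _) fun v => ?_
    have h1 : M.submatrix e e *ᵥ v = (M *ᵥ (v ∘ e.symm)) ∘ e := Matrix.submatrix_mulVec_equiv M v e e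
    have h2 := norm_toLp_mulVec_le M (v ∘ e.symm)
    rw [h1, hn]
    rwa [← hn (v ∘ e.symm), Function.comp_assoc, e.symm_comp_self, Function.comp_id] at h2
  refine le_antisymm (key M e) ?_
  have := key (M.submatrix e e) e.symm
  simpa using this

lemma bnorm_submatrix_equiv (x : Matrix κ κ B) (e : κ' ≃ κ) :
    bnorm (x.submatrix e e) = bnorm x :=
  l2_opNorm_submatrix_equiv (blockMat x) (e.prodCongr (Equiv.refl _))

/-- The amplification of a map from `M_ι ⊗ ℬ` to `ℬ`, given by its values on matrix units. -/
def amp (φ : ι → ι → B →ₗ[ℂ] B) (x : Matrix (κ × ι) (κ × ι) B) : Matrix κ κ B :=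
  Matrix.of fun a b => ∑ p, ∑ q, φ p q (x (a, p) (b, q))

/-- A completely positive unital map from `M_ι ⊗ ℬ` to `ℬ`, given by its values on matrix units. -/
structure IsChannel (φ : ι → ι → B →ₗ[ℂ] B) : Prop where
  unital : ∑ p, φ p p 1 = 1
  pos : ∀ (k : ℕ) (x : Matrix (Fin k × ι) (Fin k × ι) B), (blockMat x).PosSemidef →
    (blockMat (amp φ x)).PosSemidef

lemma amp_add (φ : ι → ι → B →ₗ[ℂ] B) (x y : Matrix (κ × ι) (κ × ι) B) :
    amp φ (x + y) = amp φ x + amp φ y := by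
  ext1 a b
  simp [amp, Finset.sum_add_distrib]

lemma amp_smul (φ : ι → ι → B →ₗ[ℂ] B) (c : ℂ) (x : Matrix (κ × ι) (κ × ι) B) :
    amp φ (c • x) = c • amp φ x := by
  ext1 a b
  simp [amp, Finset.smul_sum]

lemma IsChannel.posSemidef_amp {φ : ι → ι → B →ₗ[ℂ] B} (h : IsChannel φ)
    {x : Matrix (κ × ι) (κ × ι) B} (hx : (blockMat x).PosSemidef) :
    (blockMat (amp φ x)).PosSemidef := by
  let e := (Fintype.equivFin κ).symm
  have h1 := h.pos _ (x.submatrix (e.prodCongr (Equiv.refl ι)) (e.prodCongr (Equiv.refl ι)))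
    (hx.submatrix ((e.prodCongr (Equiv.refl ι)).prodCongr (Equiv.refl (Fin dB))))
  have h2 := h1.submatrix (e.symm.prodCongr (Equiv.refl (Fin dB)))
  convert h2 using 1
  ext ⟨a, s⟩ ⟨b, t⟩
  simp [blockMat, amp]

/-- The Schur complement of the upper left identity is `1 - X†X`. This turns a norm bound into a
positivity statement, which completely positive maps preserve. -/
lemma l2_opNorm_le_one_iff {m n : Type} [Fintype m] [DecidableEq m] [Fintype n] [DecidableEq n]
    (X : Matrix m n ℂ) : ‖X‖ ≤ 1 ↔ (Matrix.fromBlocks 1 X Xᴴ 1).PosSemidef := by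
  have : Invertible (1 : Matrix m m ℂ) := invertibleOne
  rw [Matrix.PosDef.fromBlocks₁₁ X 1 Matrix.PosDef.one, inv_one, Matrix.mul_one]
  have hq : ∀ v : n → ℂ, star v ⬝ᵥ ((1 - Xᴴ * X) *ᵥ v) =
      ((‖WithLp.toLp 2 v‖ ^ 2 - ‖WithLp.toLp 2 (X *ᵥ v)‖ ^ 2 : ℝ) : ℂ) := by
    intro v
    rw [Matrix.sub_mulVec, Matrix.one_mulVec, dotProduct_sub, ← Matrix.mulVec_mulVec,
      Matrix.dotProduct_mulVec _ Xᴴ, ← Matrix.star_mulVec, EuclideanSpace.norm_sq_eq,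
      EuclideanSpace.norm_sq_eq]
    simp only [dotProduct, Pi.star_apply, RCLike.star_def, RCLike.conj_mul]
    push_cast
    rfl
  rw [Matrix.posSemidef_iff_dotProduct_mulVec]
  constructor
  · refine fun h => ⟨Matrix.isHermitian_one.sub (Matrix.isHermitian_conjTranspose_mul_self X),
      fun v => ?_⟩
    rw [hq]
    have h1 := norm_toLp_mulVec_le X v
    have h2 : ‖WithLp.toLp 2 (X *ᵥ v)‖ ≤ ‖WithLp.toLp 2 v‖ :=
      h1.trans (mul_le_of_le_one_left (norm_nonneg _) h)
    norm_cast
    nlinarith [norm_nonneg (WithLp.toLp 2 (X *ᵥ v))]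
  · refine fun h => l2_opNorm_le_of_mulVec X zero_le_one fun v => ?_
    have h1 := h.2 v
    rw [hq] at h1
    norm_cast at h1
    rw [one_mul]
    exact le_of_sq_le_sq (by linarith) (norm_nonneg _)

/-- The map is applied to the positive `2 × 2` block matrix with diagonal `1` and off-diagonal
entries `x`, `x†`: unitality keeps the diagonal and complete positivity keeps the matrix positive.
-/
lemma IsChannel.bnorm_amp_le_one {φ : ι → ι → B →ₗ[ℂ] B} (h : IsChannel φ)
    (x : Matrix (κ × ι) (κ × ι) B) (hx : bnorm x ≤ 1) : bnorm (amp φ x) ≤ 1 := by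
  let e : (κ ⊕ κ) × ι ≃ κ × ι ⊕ κ × ι := Equiv.sumProdDistrib κ κ ι
  let e' : (κ × ι ⊕ κ × ι) × Fin dB ≃ (κ × ι) × Fin dB ⊕ (κ × ι) × Fin dB :=
    Equiv.sumProdDistrib _ _ _
  let X : Matrix (κ × ι ⊕ κ × ι) (κ × ι ⊕ κ × ι) B := Matrix.fromBlocks 1 x xᴴ 1
  have h1 := (l2_opNorm_le_one_iff (blockMat x)).1 hx
  have h2 : blockMat (X.submatrix e e) =
      (Matrix.fromBlocks 1 (blockMat x) (blockMat x)ᴴ 1).submatrix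
        ((e.prodCongr (Equiv.refl (Fin dB))).trans e')
        ((e.prodCongr (Equiv.refl (Fin dB))).trans e') := by
    rw [← blockMat_one (B := B)]
    ext ⟨⟨a | a, p⟩, s⟩ ⟨⟨b | b, q⟩, t⟩ <;> simp [X, e, e', blockMat]
  have h3 := h.posSemidef_amp (x := X.submatrix e e) (by rw [h2]; exact h1.submatrix _)
  have hone : amp φ (1 : Matrix (κ × ι) (κ × ι) B) = 1 := by
    ext1 a b
    by_cases hab : a = b
    · subst hab
      simp only [amp, Matrix.of_apply, Matrix.one_apply, Prod.mk.injEq, true_and, apply_ite, map_zero,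
        Finset.sum_ite_eq, Finset.mem_univ, if_true]
      exact h.unital
    · simp [amp, Matrix.one_apply, hab]
  have h4 : (blockMat (amp φ (X.submatrix e e))).submatrix (Equiv.sumProdDistrib κ κ (Fin dB)).symm
      (Equiv.sumProdDistrib κ κ (Fin dB)).symm =
      Matrix.fromBlocks 1 (blockMat (amp φ x)) (blockMat (amp φ xᴴ)) 1 := by
    rw [← blockMat_one (B := B), ← hone]
    ext (⟨a, s⟩ | ⟨a, s⟩) (⟨b, t⟩ | ⟨b, t⟩) <;> simp [X, e, blockMat, amp]
  have h5 := h3.submatrix (Equiv.sumProdDistrib κ κ (Fin dB)).symm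
  rw [h4] at h5
  have h6 := h5.1
  rw [Matrix.isHermitian_fromBlocks_iff] at h6
  rw [← h6.2.1] at h5
  exact (l2_opNorm_le_one_iff _).2 h5

/-- Completely positive unital maps are completely contractive. -/
lemma IsChannel.bnorm_amp_le {φ : ι → ι → B →ₗ[ℂ] B} (h : IsChannel φ)
    (x : Matrix (κ × ι) (κ × ι) B) : bnorm (amp φ x) ≤ bnorm x := by
  rcases (bnorm_nonneg x).eq_or_lt with h0 | h0
  · have hx : x = 0 := by
      have : blockMat x = 0 := norm_eq_zero.1 h0.symm
      ext1 a b
      refine Subtype.ext ?_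
      ext s t
      exact congrFun (congrFun this (a, s)) (b, t)
    subst hx
    have : amp φ (0 : Matrix (κ × ι) (κ × ι) B) = 0 := by
      ext1 a b
      simp [amp]
    rw [this]
    exact h0 ▸ (by simp [bnorm, blockMat, Matrix.zero_apply]; rfl)
  · have h1 := h.bnorm_amp_le_one (((bnorm x)⁻¹ : ℂ) • x) (by
      rw [bnorm_smul, norm_inv, Complex.norm_real, Real.norm_of_nonneg h0.le,
        inv_mul_cancel₀ h0.ne'])
    rw [amp_smul, bnorm_smul, norm_inv, Complex.norm_real, Real.norm_of_nonneg h0.le,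
      inv_mul_le_iff₀ h0, mul_one] at h1
    exact h1

variable {A : StarSubalgebra ℂ (Matrix (Fin dA) (Fin dA) ℂ)}

/-- The map `b ↦ E (a ⊗ b)`, extended from `a ∈ 𝒜` to all matrices by the conditional expectation. -/
def extend (E : A ⊗[ℂ] B →ₗ[ℂ] B) : Matrix (Fin dA) (Fin dA) ℂ →ₗ[ℂ] B →ₗ[ℂ] B :=
  ((TensorProduct.mk ℂ A B).compr₂ E).comp (condExp A)

lemma extend_apply (E : A ⊗[ℂ] B →ₗ[ℂ] B) (a : Matrix (Fin dA) (Fin dA) ℂ) (b : B) :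
    extend E a b = E (condExp A a ⊗ₜ[ℂ] b) := rfl

lemma tensorToMatrix_tmul (a : A) (b : B) (p q : Fin dA × Fin dB) :
    tensorToMatrix A B (a ⊗ₜ[ℂ] b) p q = a.1 p.1 q.1 * b.1 p.2 q.2 := rfl

/-- Complete positivity passes through the composition: the conditional expectation turns a positive
matrix into a positive element of `M_k ⊗ 𝒜 ⊗ ℬ`, to which the hypothesis on `E` applies. -/
lemma isChannel_extend (E : A ⊗[ℂ] B →ₗ[ℂ] B) (hE : IsCompletelyPositive E)
    (hE1 : E (1 ⊗ₜ[ℂ] 1) = 1) :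
    IsChannel fun p q => extend E (Matrix.single p q 1) := by
  constructor
  · simp only [extend_apply]
    have h1 : (1 : Matrix (Fin dA) (Fin dA) ℂ) = ∑ p, Matrix.single p p 1 := by
      ext i j
      simp [Matrix.sum_apply, Matrix.one_apply, Matrix.single_apply, Finset.sum_ite_eq', ite_and]
    rw [← map_sum, ← TensorProduct.sum_tmul, ← map_sum, ← h1]
    have : condExp A (1 : Matrix (Fin dA) (Fin dA) ℂ) = 1 := condExp_of_mem A 1
    rw [this, hE1]
  · intro k x hx
    let X : Matrix (Fin k) (Fin k) (A ⊗[ℂ] B) := Matrix.of fun a b =>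
      ∑ p, ∑ q, condExp A (Matrix.single p q 1) ⊗ₜ[ℂ] x (a, p) (b, q)
    -- The index of `𝒜` is moved to the end, so that all the other indices label blocks for the
    -- conditional expectation.
    let f : (Fin k × Fin dB) × Fin dA ≃ (Fin k × Fin dA) × Fin dB :=
      ⟨fun y => ((y.1.1, y.2), y.1.2), fun y => ((y.1.1, y.2), y.1.2), fun _ => rfl, fun _ => rfl⟩
    have h2 := posSemidef_condExp_blocks A (κ := Fin k × Fin dB) (hx.submatrix f)
    let g : Fin k × (Fin dA × Fin dB) → (Fin k × Fin dB) × Fin dA :=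
      fun y => ((y.1, y.2.2), y.2.1)
    have h3 := hE k X (by
      convert h2.submatrix g using 1
      ext ⟨a, s, t⟩ ⟨b, s', t'⟩
      simp only [X, Matrix.of_apply, map_sum, Matrix.sum_apply, tensorToMatrix_tmul,
        Matrix.submatrix_apply, g, f, Equiv.coe_fn_mk, blockMat]
      rw [Matrix.matrix_eq_sum_single (Matrix.of fun s s' => _)]
      simp only [map_sum, AddSubmonoidClass.coe_finsetSum, Matrix.sum_apply, Matrix.of_apply]
      refine Finset.sum_congr rfl fun p _ => Finset.sum_congr rfl fun q _ => ?_
      have hs : ∀ c : ℂ, Matrix.single p q c = c • Matrix.single p q (1 : ℂ) := fun c => by simp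
      rw [hs ((x (a, p) (b, q)).1 t t'), map_smul]
      exact mul_comm _ _)
    convert h3 using 1
    ext ⟨a, s⟩ ⟨b, t⟩
    simp [blockMat, amp, X, extend_apply]

end Channels

/-! ### Labels of neighbouring blocks and entries of correlation matrices. -/

section Configurations

variable {d N : ℕ}

/-- A label of a block is the same as labels of its left and right parts. -/
def Cfg.split {a j b : ℕ} (haj : a ≤ j) (hjb : j ≤ b) :
    Cfg d N a b ≃ Cfg d N a j × Cfg d N j b where
  toFun p := (p.res a j le_rfl hjb, p.res j b haj le_rfl)
  invFun pq x := if h : x.1.val < j then pq.1 ⟨x.1, x.2.1, h⟩ else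
    pq.2 ⟨x.1, not_lt.1 h, x.2.2⟩
  left_inv p := by
    funext x
    simp only [Cfg.res]
    split_ifs <;> rfl
  right_inv pq := by
    refine Prod.ext ?_ ?_
    · funext x
      simp [Cfg.res, x.2.2]
    · funext x
      have : ¬ x.1.val < j := not_lt.2 x.2.1
      simp [Cfg.res, this]

lemma Cfg.split_apply {a j b : ℕ} (haj : a ≤ j) (hjb : j ≤ b) (p : Cfg d N a b) :
    Cfg.split haj hjb p = (p.res a j le_rfl hjb, p.res j b haj le_rfl) := rfl

lemma Cfg.res_split_symm_left {a j b : ℕ} (haj : a ≤ j) (hjb : j ≤ b)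
    (pq : Cfg d N a j × Cfg d N j b) :
    Cfg.res a j le_rfl hjb ((Cfg.split haj hjb).symm pq) = pq.1 :=
  congrArg Prod.fst ((Cfg.split haj hjb).apply_symm_apply pq)

lemma Cfg.res_split_symm_right {a j b : ℕ} (haj : a ≤ j) (hjb : j ≤ b)
    (pq : Cfg d N a j × Cfg d N j b) :
    Cfg.res j b haj le_rfl ((Cfg.split haj hjb).symm pq) = pq.2 :=
  congrArg Prod.snd ((Cfg.split haj hjb).apply_symm_apply pq)

/-- Restriction of a label of the whole chain to a block. -/
def restr (a b : ℕ) (p : Fin N → Fin d) : Cfg d N a b := fun x => p x.1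

lemma res_restr {a b a' b' : ℕ} (ha : a ≤ a') (hb : b' ≤ b) (p : Fin N → Fin d) :
    (restr a b p).res a' b' ha hb = restr a' b' p := rfl

/-- The entries of the correlation matrix. -/
lemma corrMat_apply {a j b : ℕ} (haj : a ≤ j) (hjb : j ≤ b) (M : Op d N a b)
    (y : Cfg d N a j × Cfg d N a j) (x : Cfg d N j b × Cfg d N j b) :
    corrMat haj hjb M y x =
      M ((Cfg.split haj hjb).symm (y.2, x.2)) ((Cfg.split haj hjb).symm (y.1, x.1)) := by
  simp only [corrMat, corr, Matrix.of_apply, Matrix.trace, Matrix.diag, Matrix.mul_apply, tensorOp]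
  rw [Finset.sum_eq_single ((Cfg.split haj hjb).symm (y.2, x.2)),
    Finset.sum_eq_single ((Cfg.split haj hjb).symm (y.1, x.1))]
  · simp [Cfg.res_split_symm_left, Cfg.res_split_symm_right]
  · intro p _ hp
    have : ¬ (y.1 = p.res a j le_rfl hjb ∧ x.1 = p.res j b haj le_rfl) := fun h => hp (by
      rw [Equiv.eq_symm_apply, Cfg.split_apply, h.1, h.2])
    simp only [Matrix.single_apply]
    rw [not_and_or] at this
    rcases this with h | h <;> simp [h]
  · simp
  · intro q _ hq
    have : ¬ (y.2 = q.res a j le_rfl hjb ∧ x.2 = q.res j b haj le_rfl) := fun h => hq (by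
      rw [Equiv.eq_symm_apply, Cfg.split_apply, h.1, h.2])
    refine Finset.sum_eq_zero fun p _ => ?_
    simp only [Matrix.single_apply]
    rw [not_and_or] at this
    rcases this with h | h <;> simp [h]
  · simp

lemma tensorOp_add_right {a j b : ℕ} (haj : a ≤ j) (hjb : j ≤ b) (Y : Op d N a j)
    (X X' : Op d N j b) :
    tensorOp haj hjb Y (X + X') = tensorOp haj hjb Y X + tensorOp haj hjb Y X' := by
  ext p q
  simp [tensorOp, mul_add]

lemma tensorOp_smul_right {a j b : ℕ} (haj : a ≤ j) (hjb : j ≤ b) (Y : Op d N a j)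
    (c : ℂ) (X : Op d N j b) :
    tensorOp haj hjb Y (c • X) = c • tensorOp haj hjb Y X := by
  ext p q
  simp [tensorOp, mul_left_comm]

/-- The correlation functional is given by the correlation matrix. -/
lemma corr_single {a j b : ℕ} (haj : a ≤ j) (hjb : j ≤ b) (M : Op d N a b) (X : Op d N j b)
    (y : Cfg d N a j × Cfg d N a j) :
    corr haj hjb M X (Matrix.single y.1 y.2 1) =
      (corrMat haj hjb M *ᵥ fun x => X x.1 x.2) y := by
  let L : Op d N j b →ₗ[ℂ] ℂ :=
    { toFun := fun X => corr haj hjb M X (Matrix.single y.1 y.2 1)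
      map_add' := fun X X' => by
        simp [corr, tensorOp_add_right, Matrix.mul_add]
      map_smul' := fun c X => by
        simp [corr, tensorOp_smul_right] }
  have hs : ∀ (i j : Cfg d N j b) (c : ℂ), Matrix.single i j c = c • Matrix.single i j (1 : ℂ) :=
    fun i j c => by simp
  have h1 : L X = ∑ i, ∑ k, X i k * L (Matrix.single i k 1) := by
    conv_lhs => rw [Matrix.matrix_eq_sum_single X]
    simp only [map_sum]
    refine Finset.sum_congr rfl fun i _ => Finset.sum_congr rfl fun k _ => ?_
    rw [hs, map_smul, smul_eq_mul]
  have h2 : L X = corr haj hjb M X (Matrix.single y.1 y.2 1) := rfl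
  rw [← h2, h1]
  simp only [Matrix.mulVec, dotProduct, Fintype.sum_prod_type]
  refine Finset.sum_congr rfl fun i _ => Finset.sum_congr rfl fun k _ => ?_
  rw [mul_comm]
  rfl

lemma corrMat_sub {a j b : ℕ} (haj : a ≤ j) (hjb : j ≤ b) (M M' : Op d N a b) :
    corrMat haj hjb (M - M') = corrMat haj hjb M - corrMat haj hjb M' := by
  ext y x
  simp [corrMat_apply]

lemma hsNorm_corrMat {a j b : ℕ} (haj : a ≤ j) (hjb : j ≤ b) (M : Op d N a b) :
    hsNorm (corrMat haj hjb M) = hsNorm M := by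
  let e : (Cfg d N a j × Cfg d N a j) × (Cfg d N j b × Cfg d N j b) ≃ Cfg d N a b × Cfg d N a b :=
    (Equiv.prodProdProdComm _ _ _ _).trans ((Equiv.prodComm _ _).trans
      ((Cfg.split haj hjb).symm.prodCongr (Cfg.split haj hjb).symm))
  rw [hsNorm, hsNorm, ← Fintype.sum_prod_type', ← Fintype.sum_prod_type']
  congr 1
  refine Fintype.sum_equiv e _ _ fun z => ?_
  rw [corrMat_apply]
  rfl

end Configurations

/-! ### Ordered products of noncommuting factors. -/

section ListProd

/-- Each `h y` has to move left only past those `g x` with `y < x`, and only these commutations are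
assumed. -/
lemma prod_ofFn_mul_prod_ofFn {M : Type*} [Monoid M] : ∀ {n : ℕ} (g h : Fin n → M),
    (∀ x y, y < x → Commute (g x) (h y)) →
      (List.ofFn g).prod * (List.ofFn h).prod = (List.ofFn fun x => g x * h x).prod
  | 0, g, h, _ => by simp
  | n + 1, g, h, hc => by
    simp only [List.ofFn_succ, List.prod_cons]
    rw [← prod_ofFn_mul_prod_ofFn (fun i => g i.succ) (fun i => h i.succ)
      fun x y hxy => hc _ _ (Fin.succ_lt_succ_iff.2 hxy)]
    have h1 : Commute (List.ofFn fun i : Fin n => g i.succ).prod (h 0) := by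
      refine (Commute.list_prod_right _ _ fun z hz => ?_).symm
      obtain ⟨i, rfl⟩ := (List.mem_ofFn' _ _).1 hz
      exact (hc _ _ (Fin.succ_pos i)).symm
    rw [mul_assoc, mul_assoc, ← mul_assoc _ (h 0), h1.eq, mul_assoc]

lemma prod_ofFn_eq_single {M : Type*} [Monoid M] : ∀ {n : ℕ} (g : Fin n → M) (j : Fin n),
    (∀ x, x ≠ j → g x = 1) → (List.ofFn g).prod = g j
  | 0, _, j, _ => j.elim0
  | n + 1, g, j, h => by
    rw [List.ofFn_succ, List.prod_cons]
    induction j using Fin.cases with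
    | zero =>
      rw [List.prod_eq_one, mul_one]
      intro z hz
      obtain ⟨i, rfl⟩ := (List.mem_ofFn' _ _).1 hz
      exact h _ (Fin.succ_ne_zero i)
    | succ j =>
      rw [h 0 (Fin.succ_ne_zero j).symm, one_mul]
      exact prod_ofFn_eq_single (fun i => g i.succ) j fun x hx => h _ fun hx' =>
        hx (Fin.succ_injective _ hx')

end ListProd

/-! ### Composition of the site maps over a block. -/

section BlockMaps

variable {d N dB : ℕ} {B : StarSubalgebra ℂ (Matrix (Fin dB) (Fin dB) ℂ)}

/-- The composition of the maps of the sites in the block `[a, b)`, at a matrix unit. -/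
def blockMap (φ : Fin N → Fin d → Fin d → B →ₗ[ℂ] B) (a b : ℕ) (p q : Cfg d N a b) :
    Module.End ℂ B :=
  (List.ofFn fun x : Fin N => if h : a ≤ x.val ∧ x.val < b then
    (φ x (p ⟨x, h⟩) (q ⟨x, h⟩) : Module.End ℂ B) else 1).prod

variable (φ : Fin N → Fin d → Fin d → B →ₗ[ℂ] B)

/-- All three products run over the whole chain, with factor `1` outside their blocks, so the
commutations needed for interleaving the right-hand side are trivial. -/
lemma blockMap_split {a j b : ℕ} (haj : a ≤ j) (hjb : j ≤ b) (p q : Cfg d N a b) :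
    blockMap φ a b p q = blockMap φ a j (p.res a j le_rfl hjb) (q.res a j le_rfl hjb) *
      blockMap φ j b (p.res j b haj le_rfl) (q.res j b haj le_rfl) := by
  rw [blockMap, blockMap, blockMap, prod_ofFn_mul_prod_ofFn]
  · congr 2
    funext x
    by_cases h1 : x.val < j
    · have h2 : ¬ (j ≤ x.val ∧ x.val < b) := by omega
      rw [dif_neg h2, mul_one]
      by_cases h3 : a ≤ x.val
      · rw [dif_pos ⟨h3, h1.trans_le hjb⟩, dif_pos ⟨h3, h1⟩]
        rfl
      · rw [dif_neg (by omega), dif_neg (by omega)]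
    · have h2 : ¬ (a ≤ x.val ∧ x.val < j) := by omega
      rw [dif_neg h2, one_mul]
      by_cases h3 : x.val < b
      · rw [dif_pos ⟨by omega, h3⟩, dif_pos ⟨by omega, h3⟩]
        rfl
      · rw [dif_neg (by omega), dif_neg (by omega)]
  · intro x y hxy
    by_cases h1 : x.val < j
    · have h2 : ¬ (j ≤ y.val ∧ y.val < b) := by omega
      rw [dif_neg h2]
      exact Commute.one_right _
    · have h2 : ¬ (a ≤ x.val ∧ x.val < j) := by omega
      rw [dif_neg h2]
      exact Commute.one_left _

lemma blockMap_eq_one {a b : ℕ} (h : ∀ x : Fin N, ¬ (a ≤ x.val ∧ x.val < b)) (p q : Cfg d N a b) :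
    blockMap φ a b p q = 1 := by
  rw [blockMap]
  refine List.prod_eq_one fun z hz => ?_
  obtain ⟨x, rfl⟩ := (List.mem_ofFn' _ _).1 hz
  exact dif_neg (h x)

lemma blockMap_site {j : ℕ} (hj : j < N) (p q : Cfg d N j (j + 1)) :
    blockMap φ j (j + 1) p q = φ ⟨j, hj⟩ (p ⟨⟨j, hj⟩, le_rfl, Nat.lt_succ_self j⟩)
      (q ⟨⟨j, hj⟩, le_rfl, Nat.lt_succ_self j⟩) := by
  rw [blockMap, prod_ofFn_eq_single _ ⟨j, hj⟩]
  · exact dif_pos ⟨le_rfl, Nat.lt_succ_self j⟩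
  · intro x hx
    refine dif_neg fun h => hx (Fin.ext ?_)
    show x.val = j
    omega

variable {κ ι ι₁ ι₂ : Type} [Fintype κ] [DecidableEq κ] [Fintype ι] [DecidableEq ι] [Fintype ι₁]
  [DecidableEq ι₁] [Fintype ι₂] [DecidableEq ι₂]

lemma amp_comp (e : ι ≃ ι₁ × ι₂) {ψ : ι → ι → B →ₗ[ℂ] B} {ψ₁ : ι₁ → ι₁ → B →ₗ[ℂ] B}
    {ψ₂ : ι₂ → ι₂ → B →ₗ[ℂ] B}
    (h : ∀ p q, ψ p q = ψ₁ (e p).1 (e q).1 ∘ₗ ψ₂ (e p).2 (e q).2) (x : Matrix (κ × ι) (κ × ι) B) :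
    amp ψ x = amp ψ₁ (amp ψ₂ (x.submatrix (fun y : (κ × ι₁) × ι₂ => (y.1.1, e.symm (y.1.2, y.2)))
      (fun y : (κ × ι₁) × ι₂ => (y.1.1, e.symm (y.1.2, y.2))))) := by
  ext1 a b
  simp only [amp, Matrix.of_apply, Matrix.submatrix_apply, map_sum]
  rw [← e.symm.sum_comp, Fintype.sum_prod_type]
  refine Finset.sum_congr rfl fun p₁ _ => ?_
  rw [Finset.sum_comm' (t' := Finset.univ) (s' := fun _ => Finset.univ) (by simp)]
  rw [← e.symm.sum_comp, Fintype.sum_prod_type]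
  refine Finset.sum_congr rfl fun q₁ _ => ?_
  rw [Finset.sum_comm]
  refine Finset.sum_congr rfl fun p₂ _ => Finset.sum_congr rfl fun q₂ _ => ?_
  simp [h]

lemma IsChannel.comp (e : ι ≃ ι₁ × ι₂) {ψ : ι → ι → B →ₗ[ℂ] B} {ψ₁ : ι₁ → ι₁ → B →ₗ[ℂ] B}
    {ψ₂ : ι₂ → ι₂ → B →ₗ[ℂ] B}
    (h : ∀ p q, ψ p q = ψ₁ (e p).1 (e q).1 ∘ₗ ψ₂ (e p).2 (e q).2) (h₁ : IsChannel ψ₁)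
    (h₂ : IsChannel ψ₂) : IsChannel ψ := by
  constructor
  · rw [← e.symm.sum_comp, Fintype.sum_prod_type]
    simp only [h, Equiv.apply_symm_apply, LinearMap.comp_apply, ← map_sum, h₂.unital, h₁.unital]
  · intro k x hx
    rw [amp_comp e h]
    refine h₁.posSemidef_amp (h₂.posSemidef_amp ?_)
    exact hx.submatrix fun y : ((Fin k × ι₁) × ι₂) × Fin dB =>
      ((y.1.1.1, e.symm (y.1.1.2, y.1.2)), y.2)

lemma IsChannel.reindex (e : ι ≃ ι₁) {ψ : ι → ι → B →ₗ[ℂ] B} {ψ₁ : ι₁ → ι₁ → B →ₗ[ℂ] B}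
    (h : ∀ p q, ψ p q = ψ₁ (e p) (e q)) (h₁ : IsChannel ψ₁) : IsChannel ψ := by
  constructor
  · rw [← e.symm.sum_comp]
    simp only [h, Equiv.apply_symm_apply, h₁.unital]
  · intro k x hx
    have : amp ψ x = amp ψ₁ (x.submatrix (Prod.map id e.symm) (Prod.map id e.symm)) := by
      ext1 a b
      simp only [amp, Matrix.of_apply, Matrix.submatrix_apply]
      rw [← e.symm.sum_comp]
      refine Finset.sum_congr rfl fun p _ => ?_
      rw [← e.symm.sum_comp]
      simp [h]
    rw [this]
    exact h₁.pos _ _ (hx.submatrix (Prod.map (Prod.map id e.symm) id))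

lemma isChannel_one [Unique ι] {ψ : ι → ι → B →ₗ[ℂ] B} (h : ∀ p q, ψ p q = LinearMap.id) :
    IsChannel ψ := by
  constructor
  · simp [h]
  · intro k x hx
    convert hx.submatrix (fun y : Fin k × Fin dB => ((y.1, default), y.2)) using 1
    ext ⟨a, s⟩ ⟨b, t⟩
    simp [blockMat, amp, h]

variable {φ}

lemma isChannel_blockMap_site (hφ : ∀ x, IsChannel (φ x)) (j : ℕ) : IsChannel (blockMap φ j (j + 1)) := by
  by_cases hj : j < N
  · let i : {x : Fin N // j ≤ x.val ∧ x.val < j + 1} := ⟨⟨j, hj⟩, le_rfl, Nat.lt_succ_self j⟩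
    have hi : ∀ x, x = i := fun x => by
      refine Subtype.ext (Fin.ext ?_)
      have := x.2
      show x.1.val = j
      omega
    let e : Cfg d N j (j + 1) ≃ Fin d :=
      ⟨fun p => p i, fun c _ => c, fun p => funext fun x => by rw [hi x], fun _ => rfl⟩
    exact (hφ ⟨j, hj⟩).reindex e fun p q => blockMap_site φ hj p q
  · have he : ∀ x : Fin N, ¬ (j ≤ x.val ∧ x.val < j + 1) := fun x => by omega
    have : IsEmpty {x : Fin N // j ≤ x.val ∧ x.val < j + 1} := ⟨fun x => he x.1 x.2⟩
    exact isChannel_one fun p q => blockMap_eq_one φ he p q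

lemma isChannel_blockMap (hφ : ∀ x, IsChannel (φ x)) (a k : ℕ) : IsChannel (blockMap φ a (a + k)) := by
  induction k with
  | zero =>
    have he : ∀ x : Fin N, ¬ (a ≤ x.val ∧ x.val < a + 0) := fun x => by omega
    have : IsEmpty {x : Fin N // a ≤ x.val ∧ x.val < a + 0} := ⟨fun x => he x.1 x.2⟩
    exact isChannel_one fun p q => blockMap_eq_one φ he p q
  | succ k ih =>
    exact IsChannel.comp (Cfg.split (Nat.le_add_right a k) (Nat.le_succ _))
      (fun p q => blockMap_split φ (Nat.le_add_right a k) (Nat.le_succ _) p q) ih (isChannel_blockMap_site hφ _)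

lemma isChannel_blockMap_of_le (hφ : ∀ x, IsChannel (φ x)) {a b : ℕ} (hab : a ≤ b) : IsChannel (blockMap φ a b) := by
  obtain ⟨k, rfl⟩ := Nat.exists_eq_add_of_le hab
  exact isChannel_blockMap hφ a k

end BlockMaps

/-! ### Norm estimates for matrices with entries in the memory algebra. -/

section BlockNorms

variable {dB : ℕ} {B : StarSubalgebra ℂ (Matrix (Fin dB) (Fin dB) ℂ)}
variable {κ ι L : Type} [Fintype κ] [DecidableEq κ] [Fintype ι] [DecidableEq ι] [Fintype L]
  [DecidableEq L]

/-- The Euclidean norm of a function on a finite type. -/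
def vnorm (v : ι → ℂ) : ℝ := ‖WithLp.toLp 2 v‖

lemma vnorm_nonneg (v : ι → ℂ) : 0 ≤ vnorm v := norm_nonneg _

lemma vnorm_sq (v : ι → ℂ) : vnorm v ^ 2 = ∑ i, ‖v i‖ ^ 2 := EuclideanSpace.norm_sq_eq _

lemma vnorm_mulVec_le (M : Matrix κ ι ℂ) (v : ι → ℂ) : vnorm (M *ᵥ v) ≤ ‖M‖ * vnorm v :=
  norm_toLp_mulVec_le M v

lemma vnorm_smul (c : ℂ) (v : ι → ℂ) : vnorm (c • v) = ‖c‖ * vnorm v := by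
  rw [vnorm, WithLp.toLp_smul, norm_smul]
  rfl

lemma vnorm_sum_le (s : Finset κ) (f : κ → ι → ℂ) : vnorm (∑ a ∈ s, f a) ≤ ∑ a ∈ s, vnorm (f a) := by
  rw [vnorm, WithLp.toLp_sum]
  exact norm_sum_le _ _

lemma vnorm_sum_smul_sq_le (c : κ → ℂ) (f : κ → ι → ℂ) :
    vnorm (∑ a, c a • f a) ^ 2 ≤ (∑ a, ‖c a‖ ^ 2) * ∑ a, vnorm (f a) ^ 2 := by
  calc vnorm (∑ a, c a • f a) ^ 2 ≤ (∑ a, ‖c a‖ * vnorm (f a)) ^ 2 := by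
        gcongr
        · exact vnorm_nonneg _
        · refine (vnorm_sum_le _ _).trans_eq ?_
          simp_rw [vnorm_smul]
    _ ≤ _ := Finset.sum_mul_sq_le_sq_mul_sq _ _ _

lemma vnorm_uncurry_sq (η : κ → ι → ℂ) :
    vnorm (fun p : κ × ι => η p.1 p.2) ^ 2 = ∑ a, vnorm (η a) ^ 2 := by
  simp_rw [vnorm_sq, Fintype.sum_prod_type]

lemma blockMat_mulVec (x : Matrix κ κ B) (η : κ → Fin dB → ℂ) :
    blockMat x *ᵥ (fun p => η p.1 p.2) = fun p => (∑ b, (x p.1 b).1 *ᵥ η b) p.2 := by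
  funext p
  simp only [Matrix.mulVec, dotProduct, Fintype.sum_prod_type, blockMat, Matrix.of_apply,
    Finset.sum_apply]

lemma bnorm_apply_le (x : Matrix κ κ B) (η : κ → Fin dB → ℂ) :
    ∑ a, vnorm (∑ b, (x a b).1 *ᵥ η b) ^ 2 ≤ bnorm x ^ 2 * ∑ b, vnorm (η b) ^ 2 := by
  have h := vnorm_mulVec_le (blockMat x) (fun p => η p.1 p.2)
  rw [blockMat_mulVec] at h
  have h2 := pow_le_pow_left₀ (vnorm_nonneg _) h 2
  rw [mul_pow, vnorm_uncurry_sq, vnorm_uncurry_sq (fun a => ∑ b, (x a b).1 *ᵥ η b)] at h2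
  exact h2

lemma bnorm_le_of (x : Matrix κ κ B) {c : ℝ} (hc : 0 ≤ c)
    (h : ∀ η : κ → Fin dB → ℂ,
      ∑ a, vnorm (∑ b, (x a b).1 *ᵥ η b) ^ 2 ≤ c ^ 2 * ∑ b, vnorm (η b) ^ 2) : bnorm x ≤ c := by
  refine l2_opNorm_le_of_mulVec _ hc fun v => ?_
  refine le_of_sq_le_sq ?_ (mul_nonneg hc (norm_nonneg _))
  have h1 := h fun a s => v (a, s)
  have h2 := blockMat_mulVec x fun a s => v (a, s)
  rw [← vnorm_uncurry_sq, ← vnorm_uncurry_sq (fun b s => v (b, s)), ← h2,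
    ← mul_pow] at h1
  exact h1

lemma bnorm_column_le (x : Matrix κ κ B) (c' : κ) (η : Fin dB → ℂ) :
    ∑ c, vnorm ((x c c').1 *ᵥ η) ^ 2 ≤ bnorm x ^ 2 * vnorm η ^ 2 := by
  have h := bnorm_apply_le x (Pi.single c' η)
  have h1 : ∀ a, ∑ b, (x a b).1 *ᵥ (Pi.single c' η : κ → Fin dB → ℂ) b = (x a c').1 *ᵥ η := by
    intro a
    rw [Finset.sum_eq_single c']
    · simp
    · intro b _ hb
      simp [hb]
    · simp
  have h2 : ∑ b, vnorm ((Pi.single c' η : κ → Fin dB → ℂ) b) ^ 2 = vnorm η ^ 2 := by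
    rw [Finset.sum_eq_single c']
    · simp
    · intro b _ hb
      simp [hb, vnorm]
    · simp
  simp_rw [h1, h2] at h
  exact h

lemma bnorm_diagonal_le (v : B) : bnorm (Matrix.diagonal fun _ : κ => v) ≤ ‖v.1‖ := by
  refine bnorm_le_of _ (norm_nonneg _) fun η => ?_
  rw [Finset.mul_sum]
  refine Finset.sum_le_sum fun a _ => ?_
  have : ∑ b, (Matrix.diagonal (fun _ : κ => v) a b).1 *ᵥ η b = v.1 *ᵥ η a := by
    rw [Finset.sum_eq_single a]
    · simp
    · intro b _ hb
      simp [Matrix.diagonal_apply_ne' _ hb]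
    · simp
  rw [this, ← mul_pow]
  exact pow_le_pow_left₀ (vnorm_nonneg _) (vnorm_mulVec_le _ _) 2

/-- The norm of a product of a row of scalar matrices with a column in `ℬ`. -/
lemma bnorm_sum_smul_le (Y : κ → Matrix ι ι ℂ) (x : κ → B) {K : ℝ} (hK : 0 ≤ K)
    (hx : ∀ η, ∑ c, vnorm ((x c).1 *ᵥ η) ^ 2 ≤ K ^ 2 * vnorm η ^ 2) :
    bnorm (Matrix.of fun i j => ∑ c, Y c i j • x c) ≤
      √(∑ c, ∑ i, ∑ j, ‖Y c i j‖ ^ 2) * K := by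
  refine bnorm_le_of _ (by positivity) fun η => ?_
  rw [mul_pow, Real.sq_sqrt (by positivity)]
  have h1 : ∀ i, ∑ j, ((Matrix.of fun i j => ∑ c, Y c i j • x c : Matrix ι ι B) i j).1 *ᵥ η j =
      ∑ p : κ × ι, Y p.1 i p.2 • ((x p.1).1 *ᵥ η p.2) := by
    intro i
    rw [Fintype.sum_prod_type_right]
    refine Finset.sum_congr rfl fun j _ => ?_
    simp only [Matrix.of_apply, AddSubmonoidClass.coe_finsetSum, Matrix.sum_mulVec]
    refine Finset.sum_congr rfl fun c _ => ?_
    rw [← Matrix.smul_mulVec]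
    rfl
  calc ∑ i, vnorm (∑ j, ((Matrix.of fun i j => ∑ c, Y c i j • x c : Matrix ι ι B) i j).1 *ᵥ η j) ^ 2
      ≤ ∑ i, (∑ p : κ × ι, ‖Y p.1 i p.2‖ ^ 2) * ∑ p : κ × ι, vnorm ((x p.1).1 *ᵥ η p.2) ^ 2 := by
        refine Finset.sum_le_sum fun i _ => ?_
        rw [h1]
        exact vnorm_sum_smul_sq_le _ _
    _ = (∑ c, ∑ i, ∑ j, ‖Y c i j‖ ^ 2) * ∑ j, ∑ c, vnorm ((x c).1 *ᵥ η j) ^ 2 := by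
        rw [← Finset.sum_mul, Fintype.sum_prod_type_right]
        congr 1
        simp_rw [Fintype.sum_prod_type]
        exact Finset.sum_comm
    _ ≤ (∑ c, ∑ i, ∑ j, ‖Y c i j‖ ^ 2) * ∑ j, K ^ 2 * vnorm (η j) ^ 2 := by
        gcongr
        exact hx _
    _ = _ := by rw [← Finset.mul_sum, mul_assoc]

lemma l2_opNorm_le_of_dotProduct {m n : Type} [Fintype m] [DecidableEq m] [Fintype n]
    [DecidableEq n] (M : Matrix m n ℂ) {c : ℝ} (hc : 0 ≤ c)
    (h : ∀ (η : m → ℂ) (ξ : n → ℂ), ‖star η ⬝ᵥ (M *ᵥ ξ)‖ ≤ c * vnorm η * vnorm ξ) : ‖M‖ ≤ c := by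
  refine l2_opNorm_le_of_mulVec M hc fun v => ?_
  have h1 := h (M *ᵥ v) v
  have h2 : star (M *ᵥ v) ⬝ᵥ (M *ᵥ v) = ((vnorm (M *ᵥ v) ^ 2 : ℝ) : ℂ) := by
    rw [vnorm_sq]
    simp only [dotProduct, Pi.star_apply, RCLike.star_def, RCLike.conj_mul]
    push_cast
    rfl
  rw [h2, Complex.norm_real, Real.norm_of_nonneg (by positivity)] at h1
  change vnorm (M *ᵥ v) ≤ c * vnorm v
  rcases (vnorm_nonneg (M *ᵥ v)).eq_or_lt with h0 | h0
  · rw [← h0]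
    exact mul_nonneg hc (vnorm_nonneg v)
  · nlinarith

lemma norm_entry_le {m n : Type} [Fintype m] [DecidableEq m] [Fintype n]
    [DecidableEq n] (M : Matrix m n ℂ) (i : m) (j : n) : ‖M i j‖ ≤ ‖M‖ := by
  have h := vnorm_mulVec_le M (Pi.single j 1)
  have h1 : vnorm (Pi.single j (1 : ℂ)) = 1 := by
    rw [vnorm]
    simp
  rw [Matrix.mulVec_single_one, h1, mul_one] at h
  refine le_trans ?_ h
  refine le_of_sq_le_sq ?_ (vnorm_nonneg _)
  rw [vnorm_sq]
  exact Finset.single_le_sum (f := fun k => ‖M.col j k‖ ^ 2) (fun _ _ => by positivity)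
    (Finset.mem_univ i)

/-- The compressed matrix is `V_η† x V_ξ`, where `V_ξ` maps `ζ` to `ξ ⊗ ζ` and has norm at most that
of `ξ`. -/
lemma bnorm_compress_le (x : Matrix (κ × ι) (κ × ι) B) (η ξ : κ → ℂ) :
    bnorm (Matrix.of fun c c' => ∑ a, ∑ b, (star (η a) * ξ b) • x (a, c) (b, c')) ≤
      vnorm η * vnorm ξ * bnorm x := by
  refine bnorm_le_of _ (mul_nonneg (mul_nonneg (vnorm_nonneg _) (vnorm_nonneg _)) (bnorm_nonneg x))
    fun ζ => ?_
  have h1 : ∀ c, ∑ c', ((Matrix.of fun c c' => ∑ a, ∑ b, (star (η a) * ξ b) • x (a, c) (b, c') :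
      Matrix ι ι B) c c').1 *ᵥ ζ c' =
      ∑ a, star (η a) • ∑ q : κ × ι, (x (a, c) q).1 *ᵥ (ξ q.1 • ζ q.2) := by
    intro c
    simp only [Matrix.of_apply, AddSubmonoidClass.coe_finsetSum, Matrix.sum_mulVec]
    rw [Finset.sum_comm]
    refine Finset.sum_congr rfl fun a _ => ?_
    rw [Fintype.sum_prod_type_right, Finset.smul_sum]
    refine Finset.sum_congr rfl fun c' _ => ?_
    rw [Finset.smul_sum]
    refine Finset.sum_congr rfl fun b _ => ?_
    rw [Matrix.mulVec_smul, smul_smul, ← Matrix.smul_mulVec]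
    rfl
  have h2 := bnorm_apply_le x fun q : κ × ι => ξ q.1 • ζ q.2
  have h3 : ∑ q : κ × ι, vnorm (ξ q.1 • ζ q.2) ^ 2 = vnorm ξ ^ 2 * ∑ c, vnorm (ζ c) ^ 2 := by
    simp_rw [vnorm_smul, mul_pow, Fintype.sum_prod_type, ← Finset.mul_sum, ← Finset.sum_mul,
      vnorm_sq ξ]
  calc _ ≤ ∑ c, (∑ a, ‖star (η a)‖ ^ 2) *
          ∑ a, vnorm (∑ q : κ × ι, (x (a, c) q).1 *ᵥ (ξ q.1 • ζ q.2)) ^ 2 := by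
        refine Finset.sum_le_sum fun c _ => ?_
        rw [h1]
        exact vnorm_sum_smul_sq_le _ _
    _ = vnorm η ^ 2 * ∑ p : κ × ι, vnorm (∑ q : κ × ι, (x p q).1 *ᵥ (ξ q.1 • ζ q.2)) ^ 2 := by
        rw [← Finset.mul_sum, Fintype.sum_prod_type_right]
        simp_rw [norm_star, vnorm_sq η]
    _ ≤ vnorm η ^ 2 * (bnorm x ^ 2 * (vnorm ξ ^ 2 * ∑ c, vnorm (ζ c) ^ 2)) := by
        rw [← h3]
        gcongr
    _ = _ := by ring

/-- A bounded map into `ℬ ⊆ M_{dB}` is completely bounded, with at most `dB` times the bound. -/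
lemma bnorm_amplify_le (T : Matrix ι ι B →ₗ[ℂ] B) {k : ℝ} (hk : 0 ≤ k)
    (hT : ∀ x, ‖(T x).1‖ ≤ k * bnorm x) (x : Matrix (κ × ι) (κ × ι) B) :
    bnorm (Matrix.of fun a b => T (Matrix.of fun c c' => x (a, c) (b, c'))) ≤
      dB * k * bnorm x := by
  refine l2_opNorm_le_of_dotProduct _ (by have := bnorm_nonneg x; positivity) fun η ξ => ?_
  -- Splitting `η` and `ξ` along the index of `ℂ^dB` turns the pairing into entries of `T` at
  -- compressions of `x`, so only the unamplified bound on `T` is needed.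
  have h1 : star η ⬝ᵥ (blockMat (Matrix.of fun a b =>
      T (Matrix.of fun c c' => x (a, c) (b, c'))) *ᵥ ξ) =
      ∑ s, ∑ t, (T (Matrix.of fun c c' => ∑ a, ∑ b,
        (star (η (a, s)) * ξ (b, t)) • x (a, c) (b, c'))).1 s t := by
    have h2 : ∀ s t, (Matrix.of fun c c' => ∑ a, ∑ b,
        (star (η (a, s)) * ξ (b, t)) • x (a, c) (b, c') : Matrix ι ι B) =
        ∑ a, ∑ b, (star (η (a, s)) * ξ (b, t)) • Matrix.of fun c c' => x (a, c) (b, c') := by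
      intro s t
      ext1 c c'
      simp [Matrix.sum_apply]
    simp only [h2, map_sum, map_smul, AddSubmonoidClass.coe_finsetSum, Matrix.sum_apply]
    simp only [dotProduct, Matrix.mulVec, Fintype.sum_prod_type, Pi.star_apply, blockMat,
      Matrix.of_apply, Finset.mul_sum]
    rw [Finset.sum_comm]
    refine Finset.sum_congr rfl fun s _ => ?_
    rw [Finset.sum_comm (s := Finset.univ (α := Fin dB))]
    refine Finset.sum_congr rfl fun a _ => ?_
    rw [Finset.sum_comm]
    refine Finset.sum_congr rfl fun t _ => Finset.sum_congr rfl fun b _ => ?_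
    change _ = (star (η (a, s)) * ξ (b, t)) *
      (T (Matrix.of fun c c' => x (a, c) (b, c'))).1 s t
    ring
  rw [h1]
  calc _ ≤ ∑ s, ∑ t, k * (vnorm (fun a => η (a, s)) * vnorm (fun b => ξ (b, t)) * bnorm x) := by
        refine (norm_sum_le _ _).trans (Finset.sum_le_sum fun s _ => ?_)
        refine (norm_sum_le _ _).trans (Finset.sum_le_sum fun t _ => ?_)
        refine (norm_entry_le _ s t).trans ((hT _).trans ?_)
        gcongr
        exact bnorm_compress_le x _ _
    _ = k * bnorm x * ((∑ s, vnorm fun a => η (a, s)) * ∑ t, vnorm fun b => ξ (b, t)) := by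
        rw [Finset.sum_mul_sum, Finset.mul_sum]
        simp_rw [Finset.mul_sum]
        refine Finset.sum_congr rfl fun s _ => Finset.sum_congr rfl fun t _ => ?_
        ring
    -- Cauchy–Schwarz over the `dB` components costs `√dB` for each of the two vectors, which gives
    -- the factor `dB`.
    _ ≤ k * bnorm x * ((√dB * vnorm η) * (√dB * vnorm ξ)) := by
        have key : ∀ ζ : κ × Fin dB → ℂ, ∑ s, vnorm (fun a => ζ (a, s)) ≤ √dB * vnorm ζ := by
          intro ζ
          refine le_of_sq_le_sq ?_ (mul_nonneg (Real.sqrt_nonneg _) (vnorm_nonneg _))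
          rw [mul_pow, Real.sq_sqrt (by positivity)]
          refine sq_sum_le_card_mul_sum_sq.trans_eq ?_
          rw [Finset.card_univ, Fintype.card_fin]
          simp_rw [vnorm_sq, Fintype.sum_prod_type_right]
        have := bnorm_nonneg x
        have h4 := key η
        have h5 := key ξ
        have h6 : 0 ≤ √dB * vnorm η := mul_nonneg (Real.sqrt_nonneg _) (vnorm_nonneg _)
        have h7 : 0 ≤ ∑ t, vnorm fun b => ξ (b, t) := Finset.sum_nonneg fun _ _ => vnorm_nonneg _
        gcongr
    _ = _ := by
        have := Real.mul_self_sqrt (Nat.cast_nonneg (α := ℝ) dB)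
        linear_combination (k * bnorm x * vnorm η * vnorm ξ) * this

end BlockNorms

/-! ### Realizations on full matrix algebras, and marginals in terms of them. -/

section Realizes

variable {d N dB : ℕ} {B : StarSubalgebra ℂ (Matrix (Fin dB) (Fin dB) ℂ)}

/-- A realization of a state on the full matrix algebras of the sites, given by its values on matrix
units. -/
structure Realizes (φ : Fin N → Fin d → Fin d → B →ₗ[ℂ] B) (ρ : B →ₗ[ℂ] ℂ) (ω : ChainOp d N) :
    Prop where
  channel : ∀ x, IsChannel (φ x)
  rho_le : ∀ b : B, ‖ρ b‖ ≤ ‖b.1‖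
  apply : ∀ p q, ω q p = ρ (blockMap φ 0 N (restr 0 N p) (restr 0 N q) 1)

lemma prodOp_mul (Y X : Fin N → Matrix (Fin d) (Fin d) ℂ) :
    prodOp Y * prodOp X = prodOp fun i => Y i * X i := by
  ext p q
  simp only [Matrix.mul_apply, prodOp, Matrix.of_apply, ← Finset.prod_mul_distrib]
  rw [Finset.prod_univ_sum, Fintype.piFinset_univ]

lemma trace_prodOp (X : Fin N → Matrix (Fin d) (Fin d) ℂ) :
    (prodOp X).trace = ∏ i, (X i).trace := by
  simp only [Matrix.trace, Matrix.diag, prodOp, Matrix.of_apply]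
  rw [Finset.prod_univ_sum, Fintype.piFinset_univ]

/-- For products of elements of `𝒜` the trace factors over the sites, and at each site this is the
defining property of the conditional expectation; the general case follows by linearity. -/
lemma trace_mul_prodOp_condExp {A : StarSubalgebra ℂ (Matrix (Fin d) (Fin d) ℂ)} {ω : ChainOp d N}
    (hω : ω ∈ chainAlgebra A N) (X : Fin N → Matrix (Fin d) (Fin d) ℂ) :
    (ω * prodOp fun i => (condExp A (X i) : Matrix (Fin d) (Fin d) ℂ)).trace =
      (ω * prodOp X).trace := by
  induction hω using Submodule.span_induction with
  | mem x hx =>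
    obtain ⟨Y, rfl⟩ := hx
    simp only [prodOp_mul, trace_prodOp]
    exact Finset.prod_congr rfl fun i _ => trace_mul_condExp A (X i) (Y i).2
  | zero => simp
  | add x y _ _ hx hy => simp only [Matrix.add_mul, Matrix.trace_add, hx, hy]
  | smul c x _ hx => simp only [Matrix.smul_mul, Matrix.trace_smul, hx]

lemma prodOp_single (p q : Fin N → Fin d) :
    (prodOp fun i => Matrix.single (p i) (q i) (1 : ℂ)) = Matrix.single p q 1 := by
  ext s t
  simp only [prodOp, Matrix.of_apply, Matrix.single_apply, Finset.prod_ite_zero, Finset.prod_const_one,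
    Finset.mem_univ, true_implies]
  refine if_congr ?_ rfl rfl
  simp only [funext_iff, forall_and]

lemma foldr_eq_prod_ofFn {V : Type*} [AddCommMonoid V] [Module ℂ V] :
    ∀ {n : ℕ} (g : Fin n → Module.End ℂ V) (v : V),
      Fin.foldr n (fun i b => g i b) v = (List.ofFn g).prod v
  | 0, _, _ => by simp
  | n + 1, g, v => by
    rw [Fin.foldr_succ, foldr_eq_prod_ofFn (fun i => g i.succ), List.ofFn_succ, List.prod_cons]
    rfl

lemma trace_mul_single_one (ω : ChainOp d N) (p q : Fin N → Fin d) :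
    (ω * Matrix.single p q 1).trace = ω q p := by
  rw [Matrix.trace_mul_single]
  simp

/-- The Schwarz inequality `|ρ(b)|² ≤ ρ(b†b)` is combined with `b†b ≤ ‖b‖² 1`. -/
lemma norm_rho_le (ρ : B →ₗ[ℂ] ℂ)
    (hρ : ∀ b : B, (b : Matrix (Fin dB) (Fin dB) ℂ).PosSemidef → 0 ≤ ρ b) (h1 : ρ 1 = 1) (b : B) :
    ‖ρ b‖ ≤ ‖b.1‖ := by
  have hpos : ∀ x : B, 0 ≤ ρ (star x * x) := fun x => hρ _ (by
    have := Matrix.posSemidef_conjTranspose_mul_self x.1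
    exact this)
  have hexp : ∀ z : ℂ, ρ (star (z • 1 + b) * (z • 1 + b)) =
      star z * z + star z * ρ b + z * ρ (star b) + ρ (star b * b) := by
    intro z
    simp only [star_add, star_smul, star_one, add_mul, mul_add, smul_mul_assoc, mul_smul_comm,
      one_mul, mul_one, map_add, map_smul, h1, smul_eq_mul]
    ring
  have him : ∀ z : ℂ, (star z * ρ b + z * ρ (star b)).im = 0 := by
    intro z
    have h2 := (Complex.le_def.1 (hpos (z • 1 + b))).2
    have h3 := (Complex.le_def.1 (hpos b)).2
    rw [hexp] at h2
    simp [Complex.add_im, Complex.mul_im] at h2 h3 ⊢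
    linarith
  -- Reality of `ρ((z + b)†(z + b))` at `z = 1` and `z = i` fixes the imaginary and the real part.
  have hstar : ρ (star b) = star (ρ b) := by
    have h2 := him 1
    have h3 := him Complex.I
    simp [Complex.add_im, Complex.mul_im] at h2 h3
    refine Complex.ext ?_ ?_
    · simp; linarith
    · simp; linarith
  -- The value `z = -ρ(b)` minimizes the quadratic expression in `z`, and the minimum is `ρ(b†b) -
  -- |ρ(b)|²`.
  have h4 := (Complex.le_def.1 (hpos ((-ρ b) • 1 + b))).1
  rw [hexp, hstar] at h4
  have h5 : (star (-ρ b) * (-ρ b) + star (-ρ b) * ρ b + (-ρ b) * star (ρ b) + ρ (star b * b)).re =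
      (ρ (star b * b)).re - ‖ρ b‖ ^ 2 := by
    rw [Complex.sq_norm, Complex.normSq_apply]
    simp [Complex.add_re, Complex.mul_re]
    ring
  rw [h5] at h4
  have h6 : 0 ≤ ρ (((‖b.1‖ ^ 2 : ℝ) : ℂ) • 1 - star b * b) := by
    refine hρ _ ?_
    rw [Matrix.posSemidef_iff_dotProduct_mulVec]
    refine ⟨?_, fun v => ?_⟩
    · have : IsSelfAdjoint (((‖b.1‖ ^ 2 : ℝ) : ℂ) • 1 - star b * b) := by
        refine IsSelfAdjoint.sub ?_ (IsSelfAdjoint.star_mul_self b)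
        rw [isSelfAdjoint_iff]
        simp
      exact congrArg Subtype.val this
    · have h7 : star v ⬝ᵥ ((((‖b.1‖ ^ 2 : ℝ) : ℂ) • 1 - star b * b : B).1 *ᵥ v) =
          ((‖b.1‖ ^ 2 * vnorm v ^ 2 - vnorm (b.1 *ᵥ v) ^ 2 : ℝ) : ℂ) := by
        change star v ⬝ᵥ ((((‖b.1‖ ^ 2 : ℝ) : ℂ) • (1 : Matrix (Fin dB) (Fin dB) ℂ) -
          b.1ᴴ * b.1) *ᵥ v) = _
        rw [Matrix.sub_mulVec, Matrix.smul_mulVec, Matrix.one_mulVec, dotProduct_sub,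
          ← Matrix.mulVec_mulVec, Matrix.dotProduct_mulVec _ b.1ᴴ, ← Matrix.star_mulVec, vnorm_sq,
          vnorm_sq, dotProduct_smul]
        simp only [dotProduct, Pi.star_apply, RCLike.star_def, RCLike.conj_mul]
        push_cast
        rfl
      rw [h7]
      norm_cast
      have := vnorm_mulVec_le b.1 v
      rw [sub_nonneg, ← mul_pow]
      exact pow_le_pow_left₀ (vnorm_nonneg _) this 2
  have h8 := (Complex.le_def.1 h6).1
  rw [map_sub, map_smul, h1, smul_eq_mul, mul_one, Complex.sub_re, Complex.ofReal_re] at h8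
  refine le_of_sq_le_sq ?_ (norm_nonneg _)
  simp only [Complex.zero_re] at h4 h8
  linarith

/-- The site maps are composed with the conditional expectation. As `ω` lies in the chain algebra,
its values at matrix units are its values at their expectations, which the given realization
computes. -/
lemma CStarRealization.exists_realizes {A : StarSubalgebra ℂ (Matrix (Fin d) (Fin d) ℂ)}
    (R : CStarRealization A B N) {ω : ChainOp d N} (hω : IsState A ω) (hR : R.Generates ω) :
    ∃ φ : Fin N → Fin d → Fin d → B →ₗ[ℂ] B, Realizes φ R.rho ω := by
  refine ⟨fun x p q => extend (R.E x) (Matrix.single p q 1),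
    fun x => isChannel_extend _ (R.E_cp x) (R.E_unital x), norm_rho_le R.rho R.rho_nonneg R.rho_one,
    fun p q => ?_⟩
  refine (trace_mul_single_one ω p q).symm.trans ?_
  rw [← prodOp_single, ← trace_mul_prodOp_condExp hω.mem, hR]
  congr 1
  refine (foldr_eq_prod_ofFn (fun i => (extend (R.E i) (Matrix.single (p i) (q i) 1) :
    Module.End ℂ B)) 1).trans ?_
  congr 2
  refine congrArg List.ofFn (funext fun x => ?_)
  have hx : 0 ≤ x.val ∧ x.val < N := ⟨Nat.zero_le _, x.2⟩
  rw [dif_pos hx]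
  rfl

variable {φ : Fin N → Fin d → Fin d → B →ₗ[ℂ] B} {ρ : B →ₗ[ℂ] ℂ} {ω : ChainOp d N}

lemma blockMap_of_le {a b b' : ℕ} (hb : N ≤ b) (hbb : b ≤ b') (p q : Cfg d N a b') :
    blockMap φ a b' p q = blockMap φ a b (p.res a b le_rfl hbb) (q.res a b le_rfl hbb) := by
  rw [blockMap, blockMap]
  congr 2
  funext x
  by_cases h : a ≤ x.val
  · rw [dif_pos ⟨h, by omega⟩, dif_pos ⟨h, by omega⟩]
    rfl
  · rw [dif_neg (by omega), dif_neg (by omega)]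

/-- The marginals of a state in terms of a realization. -/
lemma Realizes.marginal_apply (h : Realizes φ ρ ω) {a b : ℕ} (hab : a ≤ b) (p q : Cfg d N a b) :
    marginal ω a b q p = ∑ e : Cfg d N 0 a, ρ (blockMap φ 0 a e e (blockMap φ a b p q 1)) := by
  -- The right end `N + b` stands for the end of the chain: it exceeds `b` even if the block sticks
  -- out, and the sites beyond `N` do not exist.
  have hbT : b ≤ N + b := Nat.le_add_left b N
  let split := (Equiv.piEquivPiSubtypeProd (fun x : Fin N => a ≤ x.val ∧ x.val < b)
    (fun _ => Fin d)).symm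
  let g : (Cfg d N 0 a × Cfg d N b (N + b)) ≃
      ({x : Fin N // ¬(a ≤ x.val ∧ x.val < b)} → Fin d) :=
    { toFun := fun e x => if hx : x.1.val < a then e.1 ⟨x.1, Nat.zero_le _, hx⟩ else
        e.2 ⟨x.1, by have := x.2; omega, by omega⟩
      invFun := fun e => (fun x => e ⟨x.1, by have := x.2; omega⟩,
        fun x => e ⟨x.1, by have := x.2; omega⟩)
      left_inv := fun e => by
        refine Prod.ext ?_ ?_
        · funext x
          simp [x.2.2]
        · funext x
          have : ¬ x.1.val < a := by have := x.2; omega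
          simp [this]
      right_inv := fun e => by
        funext x
        dsimp only
        split_ifs <;> rfl }
  have key : ∀ (e : Cfg d N 0 a × Cfg d N b (N + b)),
      ω (split (q, g e)) (split (p, g e)) =
        ρ (blockMap φ 0 a e.1 e.1 (blockMap φ a b p q (blockMap φ b (N + b) e.2 e.2 1))) := by
    intro e
    rw [h.apply, ← res_restr (Nat.zero_le 0) (Nat.le_add_right N b) (split (p, g e)),
      ← res_restr (Nat.zero_le 0) (Nat.le_add_right N b) (split (q, g e)),
      ← blockMap_of_le le_rfl (Nat.le_add_right N b),
      blockMap_split φ (Nat.zero_le a) (hab.trans hbT), blockMap_split φ hab hbT]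
    have h1 : ∀ p : Cfg d N a b, Cfg.res 0 a le_rfl (hab.trans hbT)
        (restr 0 (N + b) (split (p, g e))) = e.1 := by
      intro p
      funext x
      have : ¬ (a ≤ x.1.val ∧ x.1.val < b) := by have := x.2; omega
      simp [Cfg.res, restr, split, this, g, x.2.2]
    have h2 : ∀ p : Cfg d N a b, Cfg.res a b le_rfl hbT (Cfg.res a (N + b) (Nat.zero_le a) le_rfl
        (restr 0 (N + b) (split (p, g e)))) = p := by
      intro p
      funext x
      simp [Cfg.res, restr, split, x.2]
    have h3 : ∀ p : Cfg d N a b, Cfg.res b (N + b) hab le_rfl (Cfg.res a (N + b) (Nat.zero_le a)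
        le_rfl (restr 0 (N + b) (split (p, g e)))) = e.2 := by
      intro p
      funext x
      have h4 : ¬ (a ≤ x.1.val ∧ x.1.val < b) := by have := x.2; omega
      have h5 : ¬ x.1.val < a := by have := x.2; omega
      simp [Cfg.res, restr, split, h4, h5, g]
    rw [h1, h1, h2, h2, h3, h3]
    rfl
  have h0 : marginal ω a b q p = ∑ e, ω (split (q, e)) (split (p, e)) := rfl
  rw [h0, ← g.sum_comp]
  simp_rw [key]
  rw [Fintype.sum_prod_type]
  refine Finset.sum_congr rfl fun e _ => ?_
  -- The sites after the block are traced out, and by unitality they act on `1` as the identity.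
  have h6 := congrArg (fun v => ρ (blockMap φ 0 a e e (blockMap φ a b p q v)))
    (isChannel_blockMap_of_le h.channel hbT).unital
  simp only [map_sum] at h6
  exact h6

/-- The functional on the block `[a, j)` that is the value of the realization at an element of the
memory algebra, with the identity on all sites before `a`. -/
def leftFun (φ : Fin N → Fin d → Fin d → B →ₗ[ℂ] B) (ρ : B →ₗ[ℂ] ℂ) (a j : ℕ) :
    B →ₗ[ℂ] (Cfg d N a j × Cfg d N a j → ℂ) :=
  LinearMap.pi fun y => ∑ e : Cfg d N 0 a, ρ ∘ₗ blockMap φ 0 a e e ∘ₗ blockMap φ a j y.1 y.2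

/-- The element of the memory algebra that belongs to an operator on the block `[j, b)`. -/
def rightElt (φ : Fin N → Fin d → Fin d → B →ₗ[ℂ] B) (j b : ℕ) :
    (Cfg d N j b × Cfg d N j b → ℂ) →ₗ[ℂ] B :=
  Fintype.linearCombination ℂ fun x => blockMap φ j b x.1 x.2 1

lemma leftFun_apply (a j : ℕ) (b : B) (y : Cfg d N a j × Cfg d N a j) :
    leftFun φ ρ a j b y =
      ∑ e : Cfg d N 0 a, ρ (blockMap φ 0 a e e (blockMap φ a j y.1 y.2 b)) := by
  simp [leftFun]

lemma rightElt_apply (j b : ℕ) (z : Cfg d N j b × Cfg d N j b → ℂ) :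
    rightElt φ j b z = ∑ x, z x • blockMap φ j b x.1 x.2 1 := rfl

lemma rightElt_single (j b : ℕ) (x : Cfg d N j b × Cfg d N j b) :
    rightElt φ j b (Pi.single x 1) = blockMap φ j b x.1 x.2 1 := by
  simp [rightElt]

lemma Realizes.corrMat_marginal_apply (h : Realizes φ ρ ω) {a j b : ℕ} (haj : a ≤ j) (hjb : j ≤ b)
    (y : Cfg d N a j × Cfg d N a j) (x : Cfg d N j b × Cfg d N j b) :
    corrMat haj hjb (marginal ω a b) y x = leftFun φ ρ a j (blockMap φ j b x.1 x.2 1) y := by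
  rw [corrMat_apply, h.marginal_apply (haj.trans hjb), leftFun_apply, blockMap_split φ haj hjb]
  simp only [Cfg.res_split_symm_left, Cfg.res_split_symm_right]
  rfl

lemma Realizes.corrMat_marginal_mulVec (h : Realizes φ ρ ω) {a j b : ℕ} (haj : a ≤ j) (hjb : j ≤ b)
    (z : Cfg d N j b × Cfg d N j b → ℂ) :
    corrMat haj hjb (marginal ω a b) *ᵥ z = leftFun φ ρ a j (rightElt φ j b z) := by
  funext y
  rw [rightElt_apply, map_sum, Finset.sum_apply]
  simp only [Matrix.mulVec, dotProduct, map_smul, Pi.smul_apply, smul_eq_mul,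
    h.corrMat_marginal_apply]
  exact Finset.sum_congr rfl fun x _ => mul_comm _ _

end Realizes

/-! ### Bounds for the passages between operators, memory elements and functionals. -/

section Bounds

variable {d N dB : ℕ} {B : StarSubalgebra ℂ (Matrix (Fin dB) (Fin dB) ℂ)}
variable {κ ι : Type} [Fintype κ] [DecidableEq κ] [Fintype ι] [DecidableEq ι]

lemma norm_entry_le_bnorm (x : Matrix κ κ B) (a b : κ) : ‖(x a b).1‖ ≤ bnorm x := by
  refine l2_opNorm_le_of_mulVec _ (bnorm_nonneg x) fun v => ?_
  refine le_of_sq_le_sq ?_ (mul_nonneg (bnorm_nonneg x) (norm_nonneg _))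
  rw [mul_pow]
  exact (Finset.single_le_sum (f := fun c => vnorm ((x c b).1 *ᵥ v) ^ 2)
    (fun _ _ => by positivity) (Finset.mem_univ a)).trans (bnorm_column_le x b v)

lemma IsChannel.norm_apply_le {ψ : ι → ι → B →ₗ[ℂ] B} (h : IsChannel ψ) (x : Matrix ι ι B) :
    ‖(∑ p, ∑ q, ψ p q (x p q)).1‖ ≤ bnorm x := by
  let y : Matrix (Unit × ι) (Unit × ι) B := x.submatrix Prod.snd Prod.snd
  have h1 := (norm_entry_le_bnorm (amp ψ y) () ()).trans (h.bnorm_amp_le y)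
  have h2 : bnorm y = bnorm x := bnorm_submatrix_equiv x (Equiv.punitProd ι)
  rw [h2] at h1
  exact h1

variable {φ : Fin N → Fin d → Fin d → B →ₗ[ℂ] B} {ρ : B →ₗ[ℂ] ℂ} {ω : ChainOp d N}

/-- The element is the image of `z ⊗ 1` under a channel, and the operator norm of `z` is at most its
Hilbert–Schmidt norm. -/
lemma Realizes.norm_rightElt_le (h : Realizes φ ρ ω) {j b : ℕ} (hjb : j ≤ b)
    (z : Cfg d N j b × Cfg d N j b → ℂ) : ‖(rightElt φ j b z).1‖ ≤ vnorm z := by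
  have h1 := bnorm_sum_smul_le (B := B) (κ := Unit) (fun _ => Matrix.of fun p q => z (p, q))
    (fun _ => 1) zero_le_one (by intro η; simp)
  rw [mul_one] at h1
  have h2 := ((isChannel_blockMap_of_le h.channel hjb).norm_apply_le _).trans h1
  have h3 : √(∑ c : Unit, ∑ i, ∑ j, ‖z (i, j)‖ ^ 2) = vnorm z := by
    rw [Fintype.sum_unique, ← Fintype.sum_prod_type', ← vnorm_sq, Real.sqrt_sq (vnorm_nonneg z)]
  simp only [Matrix.of_apply] at h2
  rw [h3] at h2
  have h4 : rightElt φ j b z = ∑ p, ∑ q, blockMap φ j b p q (∑ _c : Unit, z (p, q) • 1) := by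
    rw [rightElt_apply, Fintype.sum_prod_type]
    refine Finset.sum_congr rfl fun p _ => Finset.sum_congr rfl fun q _ => ?_
    simp
  rw [h4]
  exact h2

/-- The sum is `ρ` of two successive channels applied to `u`, with the identity on the sites before
`a` inserted between them; all of these are contractions. -/
lemma Realizes.norm_sum_leftFun_le (h : Realizes φ ρ ω) {a j : ℕ} (haj : a ≤ j)
    (u : Matrix (Cfg d N a j) (Cfg d N a j) B) :
    ‖∑ y, leftFun φ ρ a j (u y.1 y.2) y‖ ≤ bnorm u := by
  set v : B := ∑ p, ∑ q, blockMap φ a j p q (u p q) with hv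
  have h1 : ‖v.1‖ ≤ bnorm u := (isChannel_blockMap_of_le h.channel haj).norm_apply_le u
  have h2 := (isChannel_blockMap_of_le h.channel (Nat.zero_le a)).norm_apply_le
    (Matrix.diagonal fun _ => v)
  have h3 : ∑ p, ∑ q, blockMap φ 0 a p q (Matrix.diagonal (fun _ => v) p q) =
      ∑ e, blockMap φ 0 a e e v := by
    refine Finset.sum_congr rfl fun p _ => ?_
    rw [Finset.sum_eq_single p]
    · simp
    · intro q _ hq
      simp [Matrix.diagonal_apply_ne' _ hq]
    · simp
  have h4 : ∑ y, leftFun φ ρ a j (u y.1 y.2) y = ρ (∑ e, blockMap φ 0 a e e v) := by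
    simp only [leftFun_apply, hv, map_sum]
    rw [Finset.sum_comm]
    exact Finset.sum_congr rfl fun e _ => Fintype.sum_prod_type _
  rw [h4]
  refine (h.rho_le _).trans ?_
  rw [← h3]
  exact h2.trans ((bnorm_diagonal_le v).trans h1)

/-- Self-testing: pairing the functionals with their own conjugates gives `S` on one side and at
most `√S * bnorm x` on the other, by contractivity and Cauchy–Schwarz. -/
lemma Realizes.sum_column_leftFun_le (h : Realizes φ ρ ω) {a j : ℕ} (haj : a ≤ j)
    (x : Matrix κ κ B) (c' : κ) :
    ∑ c, vnorm (leftFun φ ρ a j (x c c')) ^ 2 ≤ bnorm x ^ 2 := by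
  set S := ∑ c, vnorm (leftFun φ ρ a j (x c c')) ^ 2 with hS
  have hS0 : 0 ≤ S := by positivity
  let Y : κ → Matrix (Cfg d N a j) (Cfg d N a j) ℂ := fun c =>
    Matrix.of fun p q => star (leftFun φ ρ a j (x c c') (p, q))
  have h1 := (h.norm_sum_leftFun_le haj _).trans
    (bnorm_sum_smul_le Y (fun c => x c c') (bnorm_nonneg x) fun η => bnorm_column_le x c' η)
  have h2 : ∑ c, ∑ i, ∑ k, ‖Y c i k‖ ^ 2 = S := by
    rw [hS]
    refine Finset.sum_congr rfl fun c _ => ?_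
    rw [vnorm_sq, Fintype.sum_prod_type]
    simp [Y]
  have h3 : ∑ y : Cfg d N a j × Cfg d N a j, leftFun φ ρ a j
      ((Matrix.of fun i k => ∑ c, Y c i k • x c c' :
        Matrix (Cfg d N a j) (Cfg d N a j) B) y.1 y.2) y = (S : ℂ) := by
    simp only [Matrix.of_apply, map_sum, map_smul, Finset.sum_apply, Pi.smul_apply]
    rw [Finset.sum_comm, hS]
    push_cast
    refine Finset.sum_congr rfl fun c _ => ?_
    rw [← Complex.ofReal_pow, vnorm_sq]
    push_cast
    refine Finset.sum_congr rfl fun y _ => ?_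
    simp only [Y, Matrix.of_apply, Prod.mk.eta, smul_eq_mul, RCLike.star_def, RCLike.conj_mul]
    rfl
  rw [h2, h3, Complex.norm_real, Real.norm_of_nonneg hS0] at h1
  have h4 := Real.mul_self_sqrt hS0
  have h5 := Real.sqrt_nonneg S
  have h6 : √S ≤ bnorm x := by
    rcases h5.eq_or_lt with h0 | h0
    · rw [← h0]; exact bnorm_nonneg x
    · nlinarith
  nlinarith [bnorm_nonneg x]

lemma Realizes.sum_leftFun_le (h : Realizes φ ρ ω) {a j : ℕ} (haj : a ≤ j) (x : Matrix κ κ B) :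
    ∑ c, ∑ c', vnorm (leftFun φ ρ a j (x c c')) ^ 2 ≤ Fintype.card κ * bnorm x ^ 2 := by
  rw [Finset.sum_comm]
  refine (Finset.sum_le_sum fun c' _ => h.sum_column_leftFun_le haj x c').trans_eq ?_
  simp

/-- For nonnegative eigenvalues the sum of squares is at most the square of the sum. -/
lemma hsNorm_le_trace {n : Type} [Fintype n] [DecidableEq n] {M : Matrix n n ℂ}
    (hM : M.PosSemidef) : hsNorm M ≤ M.trace.re := by
  have h1 : M.trace.re = ∑ i, hM.1.eigenvalues i := by
    rw [hM.1.trace_eq_sum_eigenvalues]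
    simp
  have h2 : ((hsNorm M ^ 2 : ℝ) : ℂ) = (Mᴴ * M).trace := by
    rw [hsNorm_sq, Finset.sum_comm]
    simp only [Matrix.trace, Matrix.diag, Matrix.mul_apply, Matrix.conjTranspose_apply,
      RCLike.star_def, RCLike.conj_mul]
    push_cast
    rfl
  have h3 : hsNorm M ^ 2 = ∑ i, hM.1.eigenvalues i * hM.1.eigenvalues i := by
    rw [hM.1.eq] at h2
    have h4 : M * M = hM.1.cfc (fun x => x * x) := by
      rw [← cfc_mul_cfc, cfc_id']
    rw [h4, trace_cfc] at h2
    exact_mod_cast h2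
  have h5 := hM.eigenvalues_nonneg
  refine le_of_sq_le_sq ?_ (h1 ▸ Finset.sum_nonneg fun i _ => h5 i)
  rw [h1, h3, sq, Finset.sum_mul_sum]
  refine Finset.sum_le_sum fun i _ => ?_
  exact Finset.single_le_sum (f := fun k => hM.1.eigenvalues i * hM.1.eigenvalues k)
    (fun k _ => mul_nonneg (h5 i) (h5 k)) (Finset.mem_univ i)

lemma posSemidef_marginal (hω : ω.PosSemidef) (a b : ℕ) : (marginal ω a b).PosSemidef := by
  have : marginal ω a b = ∑ e : {x : Fin N // ¬(a ≤ x.val ∧ x.val < b)} → Fin d,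
      ω.submatrix (fun p => (Equiv.piEquivPiSubtypeProd (fun x : Fin N => a ≤ x.val ∧ x.val < b)
            (fun _ => Fin d)).symm (p, e)) (fun p => (Equiv.piEquivPiSubtypeProd
            (fun x : Fin N => a ≤ x.val ∧ x.val < b) (fun _ => Fin d)).symm (p, e)) := by
    ext p q
    simp [marginal, Matrix.sum_apply]
  rw [this]
  exact Matrix.posSemidef_sum _ fun e _ => hω.submatrix _

lemma trace_marginal (ω : ChainOp d N) (a b : ℕ) : (marginal ω a b).trace = ω.trace := by
  simp only [Matrix.trace, Matrix.diag, marginal, Matrix.of_apply]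
  rw [← Fintype.sum_prod_type']
  exact (Equiv.piEquivPiSubtypeProd (fun x : Fin N => a ≤ x.val ∧ x.val < b)
    (fun _ => Fin d)).symm.sum_comp fun p => ω p p

variable {A : StarSubalgebra ℂ (Matrix (Fin d) (Fin d) ℂ)}

lemma IsState.hsNorm_marginal_le (hω : IsState A ω) (a b : ℕ) : hsNorm (marginal ω a b) ≤ 1 := by
  refine (hsNorm_le_trace (posSemidef_marginal hω.posSemidef a b)).trans_eq ?_
  rw [trace_marginal, hω.trace_eq_one, Complex.one_re]

lemma IsState.norm_corrMat_marginal_le (hω : IsState A ω) {a j b : ℕ} (haj : a ≤ j) (hjb : j ≤ b) :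
    ‖corrMat haj hjb (marginal ω a b)‖ ≤ 1 :=
  (l2_opNorm_le_hsNorm _).trans ((hsNorm_corrMat haj hjb _).trans_le (hω.hsNorm_marginal_le a b))

lemma IsState.localCorr_ne_zero (hω : IsState A ω) (l r j : ℕ) : localCorr ω l r j ≠ 0 := by
  intro h0
  have h1 : hsNorm (marginal ω (j - l) (j + r)) = 0 := by
    rw [← hsNorm_corrMat (Nat.sub_le j l) (Nat.le_add_right j r)]
    change hsNorm (localCorr ω l r j) = 0
    rw [h0]
    simp [hsNorm]
  have h2 : marginal ω (j - l) (j + r) = 0 :=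
    norm_le_zero_iff.1 ((l2_opNorm_le_hsNorm _).trans_eq h1)
  have h3 := trace_marginal ω (j - l) (j + r)
  rw [h2, hω.trace_eq_one] at h3
  simp at h3

lemma IsState.sigmaMin_pos (hω : IsState A ω) (l r j : ℕ) : 0 < sigmaMin ω l r j :=
  singVal_pos _ (hω.localCorr_ne_zero l r j)

lemma IsState.sigmaMin_le_one (hω : IsState A ω) (l r j : ℕ) : sigmaMin ω l r j ≤ 1 := by
  have h1 := singVal_le_add (localCorr ω l r j) 0 ((localCorr ω l r j).rank - 1)
  have h2 : singVal (0 : Matrix (Cfg d N (j - l) j × Cfg d N (j - l) j)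
      (Cfg d N j (j + r) × Cfg d N j (j + r)) ℂ) ((localCorr ω l r j).rank - 1) = 0 := by
    rw [singVal, map_zero, LinearMap.singularValues_zero]
    rfl
  rw [h2, sub_zero, zero_add] at h1
  exact h1.trans (hω.norm_corrMat_marginal_le _ _)

end Bounds

/-! ### One step of the estimated pseudo-inverse. -/

section Perturbation

variable {L R K : Type} [Fintype L] [Fintype R] [Fintype K] [DecidableEq L] [DecidableEq R]
  [DecidableEq K]

lemma truncPinv_mul_truncPinv (M : Matrix L R ℂ) {η : ℝ} (hη : 0 < η) :
    truncPinv η M * M * truncPinv η M = truncPinv η M := by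
  rw [truncPinv_mul_self M hη, truncPinv, ← Matrix.mul_assoc, cfc_mul_cfc]
  congr 2
  funext x
  split_ifs <;> simp

/-- The data of an estimate `M'` of the matrix `M` at precision `e`, well below the smallest nonzero
singular value of `M`, and a threshold `η` in between. -/
structure IsEstimate (M M' : Matrix L R ℂ) (e η σ : ℝ) : Prop where
  ne_zero : M ≠ 0
  sigma_eq : σ = singVal M (M.rank - 1)
  sigma_le : σ ≤ 1
  pos : 0 < e
  norm_le : ‖M' - M‖ ≤ e
  le_sigma : e ≤ σ / 20
  le_eta : 2 * e ≤ η
  eta_le : η ≤ σ / 2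

namespace IsEstimate

variable {M M' : Matrix L R ℂ} {e η σ : ℝ} (h : IsEstimate M M' e η σ)

include h

lemma sigma_pos : 0 < σ := by have := h.pos; have := h.le_sigma; linarith

lemma eta_pos : 0 < η := by have := h.pos; have := h.le_eta; linarith

/-- A kept singular value is at least `η ≥ 2e`, above the lower side of the gap, hence at least `σ -
e ≥ 19σ/20`. -/
lemma norm_pinv_le : ‖truncPinv η M'‖ ≤ (19 / 20 * σ)⁻¹ := by
  have := h.sigma_pos
  refine norm_truncPinv_le M' (by positivity) fun i hi => ?_
  rcases sqrt_eigenvalues_gap M M' h.norm_le i with h1 | h1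
  · have := h.pos; have := h.le_eta; linarith
  · have := h.le_sigma; rw [← h.sigma_eq] at h1; linarith

/-- The upper side of the gap starts at `σ - e`, above `η ≤ σ/2`, so a discarded singular value is
at most `e`. -/
lemma norm_mul_one_sub_le : ‖M' * (1 - truncPinv η M' * M')‖ ≤ e := by
  refine norm_mul_one_sub_truncPinv_mul_le M' h.eta_pos h.pos.le fun i hi => ?_
  rcases sqrt_eigenvalues_gap M M' h.norm_le i with h1 | h1
  · exact h1
  · have := h.le_sigma; have := h.eta_le; have := h.sigma_pos
    rw [← h.sigma_eq] at h1; exact absurd (by linarith) hi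

lemma norm_pinv_mul_sub_le : ‖truncPinv η M' * (M' - M)‖ ≤ 1 / 19 := by
  have h0 := h.sigma_pos
  have h1 : ‖truncPinv η M' * (M' - M)‖ ≤ (19 / 20 * σ)⁻¹ * (σ / 20) :=
    (Matrix.l2_opNorm_mul _ _).trans (mul_le_mul h.norm_pinv_le (h.norm_le.trans h.le_sigma)
      (norm_nonneg _) (by positivity))
  refine h1.trans_eq ?_
  field_simp

/-- On outputs of the estimated pseudo-inverse `P` the exact matrix `M` can be undone: `P M P = (1 -
T) P` with `T = P (M' - M)` small, so `Q = (1 - T)⁻¹ P` works. Thus a reconstructed tail operator is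
recovered from its exact functional. -/
lemma exists_leftInverse : ∃ Q : Matrix R L ℂ, ‖Q‖ ≤ 2 / σ ∧
    Q * (M * truncPinv η M') = truncPinv η M' := by
  set P := truncPinv η M' with hP
  set T := P * (M' - M) with hT
  have hT1 : ‖T‖ ≤ 1 / 19 := h.norm_pinv_mul_sub_le
  have h0 := h.sigma_pos
  obtain ⟨u, hu⟩ : IsUnit (1 - T) := isUnit_one_sub_of_norm_lt_one (by linarith)
  have h1 : (1 - T) * P = P * (M * P) := by
    rw [hT, Matrix.sub_mul, Matrix.one_mul, Matrix.mul_sub, Matrix.sub_mul,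
      truncPinv_mul_truncPinv M' h.eta_pos, sub_sub_cancel, Matrix.mul_assoc]
  have h2 : (1 - T) * ((↑u⁻¹ : Matrix R R ℂ) * P) = P := by
    rw [← Matrix.mul_assoc, ← hu, Units.mul_inv, Matrix.one_mul]
  refine ⟨(↑u⁻¹ : Matrix R R ℂ) * P, ?_, ?_⟩
  · set Q := (↑u⁻¹ : Matrix R R ℂ) * P
    have h3 : Q = P + T * Q := by
      rw [Matrix.sub_mul, Matrix.one_mul] at h2
      rw [← h2]
      abel
    have h4 : ‖Q‖ ≤ (19 / 20 * σ)⁻¹ + 1 / 19 * ‖Q‖ := by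
      calc ‖Q‖ = ‖P + T * Q‖ := by rw [← h3]
        _ ≤ ‖P‖ + ‖T‖ * ‖Q‖ := (norm_add_le _ _).trans
            (add_le_add le_rfl (Matrix.l2_opNorm_mul _ _))
        _ ≤ _ := by
          gcongr
          exact h.norm_pinv_le
    have h5 : (19 / 20 * σ)⁻¹ = 20 / 19 * (1 / σ) := by field_simp
    have h6 : 2 / σ = 2 * (1 / σ) := by ring
    have h7 : 0 < 1 / σ := by positivity
    rw [h5] at h4
    rw [h6]
    linarith
  · rw [Matrix.mul_assoc, ← h1, ← Matrix.mul_assoc, ← hu, Units.inv_mul, Matrix.one_mul]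

/-- This serves the right end of the chain, where the right block is empty. A nonzero `M` on a space
of dimension at most one is injective with lower bound `σ`, so the discarded projection `U`
satisfies `σ‖U‖ ≤ ‖M U‖ ≤ 2e‖U‖` and vanishes, as `20e ≤ σ`. -/
lemma pinv_mul_eq_one [Subsingleton R] : truncPinv η M' * M' = 1 := by
  set P := truncPinv η M'
  set P₀ := truncPinv (singVal M (M.rank - 1)) M
  have h0 := h.sigma_pos
  set U := 1 - P * M' with hU
  have hUU : U * U = U := by
    have : P * M' * (P * M') = P * M' := by
      rw [← Matrix.mul_assoc, truncPinv_mul_truncPinv M' h.eta_pos]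
    rw [hU, Matrix.sub_mul, Matrix.mul_sub, Matrix.mul_sub, this]
    simp
  have h1 : ‖M' * U‖ ≤ e * ‖U‖ := by
    rw [← hUU, ← Matrix.mul_assoc]
    refine (Matrix.l2_opNorm_mul _ _).trans ?_
    rw [hUU]
    exact mul_le_mul_of_nonneg_right h.norm_mul_one_sub_le (norm_nonneg _)
  have hscalar : ∀ X : Matrix R R ℂ, ∃ c : ℂ, X = c • 1 := by
    intro X
    rcases isEmpty_or_nonempty R with hR | ⟨⟨i⟩⟩
    · exact ⟨0, by ext i; exact hR.elim i⟩
    · refine ⟨X i i, ?_⟩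
      ext a b
      rw [Subsingleton.elim a i, Subsingleton.elim b i]
      simp
  have h2 : P₀ * M = 1 := by
    obtain ⟨c, hc⟩ := hscalar (P₀ * M)
    have h3 := mul_truncPinv_mul_self M h.ne_zero
    rw [Matrix.mul_assoc, hc, Matrix.mul_smul, Matrix.mul_one] at h3
    have h4 : (c - 1) • M = 0 := by rw [sub_smul, h3, one_smul, sub_self]
    rcases smul_eq_zero.1 h4 with h5 | h5
    · rw [hc, sub_eq_zero.1 h5, one_smul]
    · exact absurd h5 h.ne_zero
  have h3 : σ * ‖U‖ ≤ ‖M * U‖ := by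
    have h4 : U = P₀ * (M * U) := by rw [← Matrix.mul_assoc, h2, Matrix.one_mul]
    have h5 : ‖U‖ ≤ σ⁻¹ * ‖M * U‖ := by
      calc ‖U‖ = ‖P₀ * (M * U)‖ := by rw [← h4]
        _ ≤ ‖P₀‖ * ‖M * U‖ := Matrix.l2_opNorm_mul _ _
        _ ≤ _ := by
          gcongr
          rw [h.sigma_eq]
          exact norm_truncPinv_singVal_le M h.ne_zero
    calc σ * ‖U‖ ≤ σ * (σ⁻¹ * ‖M * U‖) := by gcongr
      _ = _ := by field_simp
  have h4 : ‖M * U‖ ≤ ‖M' * U‖ + e * ‖U‖ := by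
    have h5 : M * U = M' * U - (M' - M) * U := by rw [Matrix.sub_mul]; abel
    rw [h5]
    refine (norm_sub_le _ _).trans (add_le_add le_rfl ?_)
    exact (Matrix.l2_opNorm_mul _ _).trans (mul_le_mul_of_nonneg_right h.norm_le (norm_nonneg _))
  have h5 : ‖U‖ = 0 := by
    have := h.le_sigma
    have := norm_nonneg U
    nlinarith
  exact (sub_eq_zero.1 (norm_eq_zero.1 h5)).symm

/-- The error of one step of the reconstruction. -/
lemma norm_step_le {S S' : Matrix L K ℂ} (hS : ‖S‖ ≤ 1) (hS' : ‖S' - S‖ ≤ e)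
    (hr : M * truncPinv (singVal M (M.rank - 1)) M * S = S) :
    ‖M * truncPinv η M' * S' - S‖ ≤ 6 * e / σ := by
  set P := truncPinv η M'
  set P₀ := truncPinv (singVal M (M.rank - 1)) M
  have h0 := h.sigma_pos
  have he := h.pos
  have hP : ‖P‖ ≤ (19 / 20 * σ)⁻¹ := h.norm_pinv_le
  have hP₀ : ‖P₀‖ ≤ σ⁻¹ := by
    rw [h.sigma_eq]; exact norm_truncPinv_singVal_le M h.ne_zero
  have hMP' : ‖M' * P‖ ≤ 1 := norm_mul_truncPinv_le M' h.eta_pos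
  have hsub : ‖(M - M') * P‖ ≤ e * (19 / 20 * σ)⁻¹ := by
    refine (Matrix.l2_opNorm_mul _ _).trans (mul_le_mul ?_ hP (norm_nonneg _) he.le)
    rw [norm_sub_rev]; exact h.norm_le
  have hMP : ‖M * P‖ ≤ 20 / 19 := by
    have h1 : M * P = M' * P + (M - M') * P := by rw [Matrix.sub_mul]; abel
    rw [h1]
    refine (norm_add_le _ _).trans ((add_le_add hMP' hsub).trans ?_)
    have : e * (19 / 20 * σ)⁻¹ ≤ σ / 20 * (19 / 20 * σ)⁻¹ := by
      gcongr
      exact h.le_sigma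
    have h2 : σ / 20 * (19 / 20 * σ)⁻¹ = 1 / 19 := by field_simp
    linarith
  have hproj : ‖(M' * P - 1) * (M * (P₀ * S))‖ ≤ 3 * e * σ⁻¹ := by
    -- Replacing `M` by `M'` leaves the discarded part of `M'`, of norm at most `e`, and an error of
    -- norm at most `2e`; hence the constant `3`.
    have h1 : (M' * P - 1) * M = -(M' * (1 - P * M')) + (M' * P - 1) * (M - M') := by
      simp only [Matrix.sub_mul, Matrix.mul_sub, Matrix.mul_one, Matrix.one_mul, Matrix.mul_assoc]
      abel
    have hL : ‖M' * P - 1‖ ≤ 2 := by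
      have h3 : ‖(1 : Matrix L L ℂ)‖ ≤ 1 := by
        refine l2_opNorm_le_of_mulVec _ zero_le_one fun v => ?_
        rw [Matrix.one_mulVec, one_mul]
      exact (norm_sub_le _ _).trans (by linarith)
    have h2 : ‖(M' * P - 1) * M‖ ≤ 3 * e := by
      rw [h1]
      refine (norm_add_le _ _).trans ?_
      rw [norm_neg]
      have h3 := h.norm_mul_one_sub_le
      have h4 : ‖(M' * P - 1) * (M - M')‖ ≤ 2 * e := by
        refine (Matrix.l2_opNorm_mul _ _).trans (mul_le_mul hL ?_ (norm_nonneg _) zero_le_two)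
        rw [norm_sub_rev]; exact h.norm_le
      linarith
    rw [← Matrix.mul_assoc]
    refine (Matrix.l2_opNorm_mul _ _).trans (mul_le_mul h2 ?_ (norm_nonneg _) (by positivity))
    exact (Matrix.l2_opNorm_mul _ _).trans ((mul_le_mul hP₀ hS (norm_nonneg _)
      (by positivity)).trans_eq (mul_one _))
  -- The three terms are the error of `S'`, the error of `M'`, and the failure of the estimated
  -- projection `M' P` to fix `S = M P₀ S`.
  have hdec : M * P * S' - S =
      M * P * (S' - S) + (M - M') * P * S + (M' * P - 1) * (M * (P₀ * S)) := by
    rw [← Matrix.mul_assoc M P₀, hr]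
    simp only [Matrix.sub_mul, Matrix.mul_sub, Matrix.one_mul]
    abel
  have h1 : ‖M * P * (S' - S)‖ ≤ 20 / 19 * e :=
    (Matrix.l2_opNorm_mul _ _).trans (mul_le_mul hMP hS' (norm_nonneg _) (by norm_num))
  have h2 : ‖(M - M') * P * S‖ ≤ e * (19 / 20 * σ)⁻¹ :=
    (Matrix.l2_opNorm_mul _ _).trans ((mul_le_mul hsub hS (norm_nonneg _)
      (by positivity)).trans_eq (mul_one _))
  have h3 : ‖M * P * S' - S‖ ≤ 20 / 19 * e + e * (19 / 20 * σ)⁻¹ + 3 * e * σ⁻¹ := by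
    rw [hdec]
    exact (norm_add₃_le).trans (add_le_add_three h1 h2 hproj)
  refine h3.trans ?_
  have h5 : (19 / 20 * σ)⁻¹ = 20 / 19 * σ⁻¹ := by field_simp
  have h6 : e ≤ e * σ⁻¹ := by
    have : 1 ≤ σ⁻¹ := (one_le_inv₀ h0).2 h.sigma_le
    nlinarith
  rw [h5]
  have h7 : 6 * e / σ = 6 * (e * σ⁻¹) := by ring
  rw [h7]
  have h8 : 0 < e * σ⁻¹ := by positivity
  nlinarith

end IsEstimate

end Perturbation

/-! ### Linear algebra of the rank condition. -/

section Factor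

open Module

/-- The space `g (f T')` lies in `g (f T)`, whose dimension is at most that of `f T`. Equality of
the outer dimensions makes the two images equal and `g` injective on `f T`. -/
lemma factor_of_finrank_map_eq {V W W' : Type*} [AddCommGroup V] [Module ℂ V] [AddCommGroup W]
    [Module ℂ W] [FiniteDimensional ℂ W] [AddCommGroup W'] [Module ℂ W'] [FiniteDimensional ℂ W']
    (f : V →ₗ[ℂ] W) (g : W →ₗ[ℂ] W')
    {T T' : Submodule ℂ V} (hT : T' ≤ T)
    (h : finrank ℂ (T.map f) = finrank ℂ (T'.map (g ∘ₗ f))) :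
    (∀ b ∈ T, ∃ b' ∈ T', g (f b) = g (f b')) ∧
      ∀ b ∈ T, ∀ b' ∈ T, g (f b) = g (f b') → f b = f b' := by
  set U := T.map f
  have h1 : T'.map (g ∘ₗ f) ≤ U.map g := by
    rw [Submodule.map_comp]
    exact Submodule.map_mono (Submodule.map_mono hT)
  have h2 : T'.map (g ∘ₗ f) = U.map g :=
    Submodule.eq_of_le_of_finrank_le h1 (h ▸ Submodule.finrank_map_le g U)
  constructor
  · intro b hb
    have h3 : g (f b) ∈ T'.map (g ∘ₗ f) := by
      rw [h2]
      exact Submodule.mem_map_of_mem (Submodule.mem_map_of_mem hb)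
    obtain ⟨b', hb', hg⟩ := h3
    exact ⟨b', hb', hg.symm⟩
  · intro b hb b' hb' hg
    have h3 := LinearMap.finrank_range_add_finrank_ker (g.domRestrict U)
    rw [LinearMap.range_domRestrict, ← h2, ← h, Nat.add_eq_left, Submodule.finrank_eq_zero,
      LinearMap.ker_eq_bot] at h3
    have h4 : (⟨f b, Submodule.mem_map_of_mem hb⟩ : U) = ⟨f b', Submodule.mem_map_of_mem hb'⟩ :=
      h3 hg
    exact congrArg Subtype.val h4

end Factor

/-! ### Finite correlation in the memory algebra. -/

section TailSpace

variable {d N dB : ℕ} {B : StarSubalgebra ℂ (Matrix (Fin dB) (Fin dB) ℂ)}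
variable {φ : Fin N → Fin d → Fin d → B →ₗ[ℂ] B} {ρ : B →ₗ[ℂ] ℂ} {ω : ChainOp d N}
variable {A : StarSubalgebra ℂ (Matrix (Fin d) (Fin d) ℂ)}

instance uniqueCfgSelf (a : ℕ) : Unique (Cfg d N a a) :=
  have : IsEmpty {x : Fin N // a ≤ x.val ∧ x.val < a} := ⟨fun x => by have := x.2; omega⟩
  inferInstance

lemma blockMap_self (a : ℕ) (p q : Cfg d N a a) : blockMap φ a a p q = 1 :=
  blockMap_eq_one φ (fun x => by omega) p q

lemma leftFun_zero (j : ℕ) (b : B) (y : Cfg d N 0 j × Cfg d N 0 j) :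
    leftFun φ ρ 0 j b y = ρ (blockMap φ 0 j y.1 y.2 b) := by
  rw [leftFun_apply, Fintype.sum_unique, blockMap_self]
  rfl

/-- Restriction of a functional to a smaller block on the right. -/
def restrictFun {a j : ℕ} (haj : a ≤ j) :
    (Cfg d N 0 j × Cfg d N 0 j → ℂ) →ₗ[ℂ] (Cfg d N a j × Cfg d N a j → ℂ) :=
  LinearMap.pi fun y => ∑ e : Cfg d N 0 a, LinearMap.proj
    ((Cfg.split (Nat.zero_le a) haj).symm (e, y.1), (Cfg.split (Nat.zero_le a) haj).symm (e, y.2))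

lemma restrictFun_comp_leftFun {a j : ℕ} (haj : a ≤ j) :
    restrictFun haj ∘ₗ leftFun φ ρ 0 j = leftFun φ ρ a j := by
  ext1 b
  funext y
  simp only [restrictFun, LinearMap.comp_apply, LinearMap.pi_apply, LinearMap.sum_apply,
    LinearMap.proj_apply, leftFun_zero]
  rw [leftFun_apply]
  refine Finset.sum_congr rfl fun e _ => ?_
  rw [blockMap_split φ (Nat.zero_le a) haj]
  simp only [Cfg.res_split_symm_left, Cfg.res_split_symm_right]
  rfl

/-- The elements of the memory algebra that belong to the operators on the sites after `j`. -/
def tailSpace (φ : Fin N → Fin d → Fin d → B →ₗ[ℂ] B) (j : ℕ) : Submodule ℂ B :=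
  LinearMap.range (rightElt φ j N)

/-- If the block ends before `N`, the remaining sites carry the identity, a sum of matrix units that
unitality sends to `1`. -/
lemma Realizes.blockMap_one_mem (h : Realizes φ ρ ω) {j b : ℕ} (hjb : j ≤ b)
    (p q : Cfg d N j b) : blockMap φ j b p q 1 ∈ tailSpace φ j := by
  have hmem : ∀ p q : Cfg d N j N, blockMap φ j N p q 1 ∈ tailSpace φ j := fun p q =>
    ⟨Pi.single (p, q) 1, rightElt_single j N (p, q)⟩
  rcases le_total N b with hb | hb
  · rw [blockMap_of_le le_rfl hb]
    exact hmem _ _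
  · rw [← (isChannel_blockMap_of_le h.channel hb).unital, map_sum]
    refine sum_mem fun e _ => ?_
    have h1 := hmem ((Cfg.split hjb hb).symm (p, e)) ((Cfg.split hjb hb).symm (q, e))
    rw [blockMap_split φ hjb hb] at h1
    simpa only [Cfg.res_split_symm_left, Cfg.res_split_symm_right, Module.End.mul_apply] using h1

lemma Realizes.rightElt_mem (h : Realizes φ ρ ω) {j b : ℕ} (hjb : j ≤ b)
    (z : Cfg d N j b × Cfg d N j b → ℂ) : rightElt φ j b z ∈ tailSpace φ j := by
  rw [rightElt_apply]
  exact sum_mem fun x _ => Submodule.smul_mem _ _ (h.blockMap_one_mem hjb _ _)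

lemma Realizes.rank_corrMat (h : Realizes φ ρ ω) {a j b : ℕ} (haj : a ≤ j) (hjb : j ≤ b) :
    (corrMat haj hjb (marginal ω a b)).rank =
      Module.finrank ℂ ((LinearMap.range (rightElt φ j b)).map (leftFun φ ρ a j)) := by
  have h1 : (corrMat haj hjb (marginal ω a b)).mulVecLin = leftFun φ ρ a j ∘ₗ rightElt φ j b :=
    LinearMap.ext fun z => h.corrMat_marginal_mulVec haj hjb z
  rw [Matrix.rank, h1, LinearMap.range_comp]

lemma Realizes.localCorr_mulVec (h : Realizes φ ρ ω) (l r j : ℕ)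
    (z : Cfg d N j (j + r) × Cfg d N j (j + r) → ℂ) :
    localCorr ω l r j *ᵥ z = leftFun φ ρ (j - l) j (rightElt φ j (j + r) z) :=
  h.corrMat_marginal_mulVec _ _ z

/-- The pseudo-inverse of the correlation matrix at its smallest nonzero singular value. -/
def localPinv (ω : ChainOp d N) (l r j : ℕ) :
    Matrix (Cfg d N j (j + r) × Cfg d N j (j + r)) (Cfg d N (j - l) j × Cfg d N (j - l) j) ℂ :=
  truncPinv (sigmaMin ω l r j) (localCorr ω l r j)

/-- Both ranks are dimensions of spaces of functionals: those of the whole tail on the whole left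
part, and those of the next `r` sites on the last `l` sites. Restriction maps the first space into
functionals on the last `l` sites, and equal ranks give the two claims. -/
lemma Realizes.factor (h : Realizes φ ρ ω) {l r m : ℕ} (hfc : IsFinitelyCorrelated l r m ω) {j : ℕ}
    (hj : j ≤ N) :
    (∀ b ∈ tailSpace φ j, ∃ z, leftFun φ ρ (j - l) j b = localCorr ω l r j *ᵥ z) ∧
      ∀ b ∈ tailSpace φ j, ∀ b' ∈ tailSpace φ j,
        leftFun φ ρ (j - l) j b = leftFun φ ρ (j - l) j b' →
          leftFun φ ρ 0 j b = leftFun φ ρ 0 j b' := by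
  have h1 : LinearMap.range (rightElt φ j (j + r)) ≤ tailSpace φ j := by
    rintro _ ⟨z, rfl⟩
    exact h.rightElt_mem (Nat.le_add_right j r) z
  have h2 := (hfc j hj).1
  rw [localCorr, h.rank_corrMat, h.rank_corrMat,
    ← restrictFun_comp_leftFun (Nat.sub_le j l)] at h2
  have h3 := factor_of_finrank_map_eq _ _ h1 h2
  have h4 : ∀ b, restrictFun (Nat.sub_le j l) (leftFun φ ρ 0 j b) = leftFun φ ρ (j - l) j b :=
    fun b => LinearMap.congr_fun (restrictFun_comp_leftFun (Nat.sub_le j l)) b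
  simp only [h4] at h3
  refine ⟨fun b hb => ?_, h3.2⟩
  obtain ⟨_, ⟨z, rfl⟩, hz⟩ := h3.1 b hb
  exact ⟨z, by rw [hz, h.localCorr_mulVec]⟩

lemma Realizes.localCorr_mulVec_localPinv (h : Realizes φ ρ ω) (hω : IsState A ω) {l r m : ℕ}
    (hfc : IsFinitelyCorrelated l r m ω) {j : ℕ} (hj : j ≤ N) {b : B} (hb : b ∈ tailSpace φ j) :
    localCorr ω l r j *ᵥ (localPinv ω l r j *ᵥ leftFun φ ρ (j - l) j b) =
      leftFun φ ρ (j - l) j b := by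
  obtain ⟨z, hz⟩ := (h.factor hfc hj).1 b hb
  rw [hz, Matrix.mulVec_mulVec, Matrix.mulVec_mulVec, localPinv, sigmaMin,
    mul_truncPinv_mul_self _ (hω.localCorr_ne_zero l r j)]

/-- The lifted operator reproduces the local functional of `b`, and local functionals of tail
elements determine the functionals on the whole left part. -/
lemma Realizes.leftFun_rightElt_localPinv (h : Realizes φ ρ ω) (hω : IsState A ω) {l r m : ℕ}
    (hfc : IsFinitelyCorrelated l r m ω) {j : ℕ} (hj : j ≤ N) {b : B} (hb : b ∈ tailSpace φ j) :
    leftFun φ ρ 0 j (rightElt φ j (j + r) (localPinv ω l r j *ᵥ leftFun φ ρ (j - l) j b)) =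
      leftFun φ ρ 0 j b := by
  refine (h.factor hfc hj).2 _ (h.rightElt_mem (Nat.le_add_right j r) _) _ hb ?_
  rw [← h.localCorr_mulVec, h.localCorr_mulVec_localPinv hω hfc hj hb]

end TailSpace

/-! ### Functionals combined with the operators on one site. -/

section Spread

variable {d N dB : ℕ} {B : StarSubalgebra ℂ (Matrix (Fin dB) (Fin dB) ℂ)}
variable {φ : Fin N → Fin d → Fin d → B →ₗ[ℂ] B} {ρ : B →ₗ[ℂ] ℂ} {ω : ChainOp d N}

/-- The map `id ⊗ Γ`, from `M ⊗ ℬ` with matrices `M` on the block `[i, j)` to operators on `[i, b)`. -/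
def spread {i j b : ℕ} (hij : i ≤ j) (hjb : j ≤ b)
    (Γ : B →ₗ[ℂ] (Cfg d N j b × Cfg d N j b → ℂ)) :
    Matrix (Cfg d N i j) (Cfg d N i j) B →ₗ[ℂ] (Cfg d N i b × Cfg d N i b → ℂ) where
  toFun x u := Γ (x (u.1.res i j le_rfl hjb) (u.2.res i j le_rfl hjb))
    (u.1.res j b hij le_rfl, u.2.res j b hij le_rfl)
  map_add' x y := by
    funext u
    simp
  map_smul' c x := by
    funext u
    simp

lemma vnorm_spread_sq {i j b : ℕ} (hij : i ≤ j) (hjb : j ≤ b)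
    (Γ : B →ₗ[ℂ] (Cfg d N j b × Cfg d N j b → ℂ)) (x : Matrix (Cfg d N i j) (Cfg d N i j) B) :
    vnorm (spread hij hjb Γ x) ^ 2 = ∑ c, ∑ c', vnorm (Γ (x c c')) ^ 2 := by
  let e : (Cfg d N i j × Cfg d N i j) × (Cfg d N j b × Cfg d N j b) ≃ Cfg d N i b × Cfg d N i b :=
    (Equiv.prodProdProdComm _ _ _ _).trans
      ((Cfg.split hij hjb).symm.prodCongr (Cfg.split hij hjb).symm)
  simp_rw [vnorm_sq]
  rw [← e.sum_comp, Fintype.sum_prod_type, Fintype.sum_prod_type]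
  refine Finset.sum_congr rfl fun c _ => Finset.sum_congr rfl fun c' _ =>
    Finset.sum_congr rfl fun z _ => ?_
  simp [e, spread, Cfg.res_split_symm_left, Cfg.res_split_symm_right]

lemma spread_single {i j b : ℕ} (hij : i ≤ j) (hjb : j ≤ b)
    (Γ : B →ₗ[ℂ] (Cfg d N j b × Cfg d N j b → ℂ)) (c c' : Cfg d N i j) (v : B) :
    spread hij hjb Γ (Matrix.single c c' v) = fun u => tensorOp hij hjb (Matrix.single c c' 1)
      (Matrix.of fun p q => Γ v (p, q)) u.1 u.2 := by
  funext u
  simp only [spread, LinearMap.coe_mk, AddHom.coe_mk, tensorOp, Matrix.of_apply,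
    Matrix.single_apply]
  split_ifs <;> simp

lemma rightElt_tensorOp {i j b : ℕ} (hij : i ≤ j) (hjb : j ≤ b) (c c' : Cfg d N i j)
    (W : Op d N j b) :
    rightElt φ i b (fun u => tensorOp hij hjb (Matrix.single c c' 1) W u.1 u.2) =
      blockMap φ i j c c' (rightElt φ j b fun x => W x.1 x.2) := by
  let e : (Cfg d N i j × Cfg d N i j) × (Cfg d N j b × Cfg d N j b) ≃ Cfg d N i b × Cfg d N i b :=
    (Equiv.prodProdProdComm _ _ _ _).trans
      ((Cfg.split hij hjb).symm.prodCongr (Cfg.split hij hjb).symm)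
  rw [rightElt_apply, ← e.sum_comp, Fintype.sum_prod_type, Fintype.sum_eq_single (c, c')]
  · rw [rightElt_apply, map_sum]
    refine Finset.sum_congr rfl fun z _ => ?_
    rw [map_smul, blockMap_split φ hij hjb]
    simp [e, tensorOp, Cfg.res_split_symm_left, Cfg.res_split_symm_right]
  · intro y hy
    have : ¬ (c = y.1 ∧ c' = y.2) := fun h => hy (Prod.ext h.1.symm h.2.symm)
    refine Finset.sum_eq_zero fun z _ => ?_
    simp [e, tensorOp, Cfg.res_split_symm_left, Matrix.single_apply, this]

lemma leftFun_zero_blockMap {i j : ℕ} (hij : i ≤ j) (c c' : Cfg d N i j) (v : B)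
    (y : Cfg d N 0 i × Cfg d N 0 i) :
    leftFun φ ρ 0 i (blockMap φ i j c c' v) y = leftFun φ ρ 0 j v
      ((Cfg.split (Nat.zero_le i) hij).symm (y.1, c),
        (Cfg.split (Nat.zero_le i) hij).symm (y.2, c')) := by
  rw [leftFun_zero, leftFun_zero, blockMap_split φ (Nat.zero_le i) hij]
  simp only [Cfg.res_split_symm_left, Cfg.res_split_symm_right]
  rfl

lemma card_cfg_site {i : ℕ} (hi : i < N) : Fintype.card (Cfg d N i (i + 1)) = d := by
  have : Fintype.card {x : Fin N // i ≤ x.val ∧ x.val < i + 1} = 1 := by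
    rw [Fintype.card_eq_one_iff]
    refine ⟨⟨⟨i, hi⟩, le_rfl, Nat.lt_succ_self i⟩, fun x => Subtype.ext (Fin.ext ?_)⟩
    have := x.2
    show x.1.val = i
    omega
  rw [Fintype.card_fun, this, Fintype.card_fin, pow_one]

/-- Each of the `d` columns of `x` contributes at most `bnorm x ^ 2` to the squared norm of the
functionals; this is the origin of `√d_𝒜` in the precision. -/
lemma Realizes.vnorm_spread_le (h : Realizes φ ρ ω) {a i b : ℕ} (ha : a ≤ i + 1) (hb : i + 1 ≤ b)
    (hi : i < N) (Q : Matrix (Cfg d N (i + 1) b × Cfg d N (i + 1) b)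
      (Cfg d N a (i + 1) × Cfg d N a (i + 1)) ℂ)
    (x : Matrix (Cfg d N i (i + 1)) (Cfg d N i (i + 1)) B) :
    vnorm (spread (Nat.le_add_right i 1) hb (Q.mulVecLin ∘ₗ leftFun φ ρ a (i + 1)) x) ≤
      ‖Q‖ * √d * bnorm x := by
  refine le_of_sq_le_sq ?_ (mul_nonneg (by positivity) (bnorm_nonneg x))
  rw [vnorm_spread_sq, mul_pow, mul_pow, Real.sq_sqrt (Nat.cast_nonneg d), mul_assoc]
  have h1 := h.sum_leftFun_le ha x
  rw [card_cfg_site hi] at h1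
  refine le_trans ?_ (mul_le_mul_of_nonneg_left h1 (sq_nonneg ‖Q‖))
  rw [Finset.mul_sum]
  refine Finset.sum_le_sum fun c _ => ?_
  rw [Finset.mul_sum]
  refine Finset.sum_le_sum fun c' _ => ?_
  rw [← mul_pow]
  exact pow_le_pow_left₀ (vnorm_nonneg _) (vnorm_mulVec_le Q _) 2

end Spread

/-! ### The reconstruction as a perturbed evolution in the memory algebra. -/

section Recursion

variable {d N l r dB : ℕ} {B : StarSubalgebra ℂ (Matrix (Fin dB) (Fin dB) ℂ)}
variable {φ : Fin N → Fin d → Fin d → B →ₗ[ℂ] B} {ρ : B →ₗ[ℂ] ℂ} {ω : ChainOp d N}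

/-- The correlation matrix of a functional on the block `[i - l, i + 1 + r)` at the cut `i`. -/
abbrev longCorr (l r i : ℕ) (M : Op d N (i - l) (i + 1 + r)) :
    Matrix (Cfg d N (i - l) i × Cfg d N (i - l) i)
      (Cfg d N i (i + 1 + r) × Cfg d N i (i + 1 + r)) ℂ :=
  corrMat (Nat.sub_le i l) ((Nat.le_add_right i 1).trans (Nat.le_add_right (i + 1) r)) M

/-- The correlation matrix of a functional on the block `[i - l, i + r)` at the cut `i`. -/
abbrev shortCorr (l r i : ℕ) (M : Op d N (i - l) (i + r)) :
    Matrix (Cfg d N (i - l) i × Cfg d N (i - l) i) (Cfg d N i (i + r) × Cfg d N i (i + r)) ℂ :=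
  corrMat (Nat.sub_le i l) (Nat.le_add_right i r) M

/-- The entries of `tailOp` at matrix units. -/
def tailVec (η : ℝ) (est : MarginalEstimates d N l r) (p q : Fin N → Fin d) (k i : ℕ) :
    Cfg d N i (i + r) × Cfg d N i (i + r) → ℂ :=
  fun x => tailOp η est (fun j => Matrix.single (restr j (j + 1) p) (restr j (j + 1) q) 1) k i x.1 x.2

lemma siteFunctional_single (est : MarginalEstimates d N l r) (i : ℕ) (a : Op d N i (i + 1))
    (W : Op d N (i + 1) (i + 1 + r)) (y : Cfg d N (i - l) i × Cfg d N (i - l) i) :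
    siteFunctional est i a W (Matrix.single y.1 y.2 1) =
      (longCorr l r i (est.long i) *ᵥ fun u => tensorOp (Nat.le_add_right i 1)
        (Nat.le_add_right (i + 1) r) a W u.1 u.2) y :=
  corr_single _ _ _ _ _

lemma tailVec_succ (η : ℝ) (est : MarginalEstimates d N l r) (p q : Fin N → Fin d) (k i : ℕ) :
    tailVec η est p q (k + 1) i = truncPinv η (shortCorr l r i (est.short i)) *ᵥ
      (longCorr l r i (est.long i) *ᵥ fun u => tensorOp (Nat.le_add_right i 1)
        (Nat.le_add_right (i + 1) r)
        (Matrix.single (restr i (i + 1) p) (restr i (i + 1) q) 1)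
        (Matrix.of fun a b => tailVec η est p q k (i + 1) (a, b)) u.1 u.2) := by
  funext x
  simp only [tailVec, tailOp, liftFunctional, Matrix.of_apply]
  congr 2
  funext y
  exact siteFunctional_single _ _ _ _ _

/-- The action of the maps of a block on `M ⊗ ℬ`. -/
def blockSum (φ : Fin N → Fin d → Fin d → B →ₗ[ℂ] B) (i j : ℕ) :
    Matrix (Cfg d N i j) (Cfg d N i j) B →ₗ[ℂ] B where
  toFun x := ∑ c, ∑ c', blockMap φ i j c c' (x c c')
  map_add' x y := by simp [Finset.sum_add_distrib]
  map_smul' c x := by simp [Finset.smul_sum]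

lemma blockSum_single (i j : ℕ) (c c' : Cfg d N i j) (v : B) :
    blockSum φ i j (Matrix.single c c' v) = blockMap φ i j c c' v := by
  simp only [blockSum, LinearMap.coe_mk, AddHom.coe_mk]
  rw [Fintype.sum_eq_single c, Fintype.sum_eq_single c']
  · simp
  · intro b hb
    simp [hb.symm]
  · intro a ha
    refine Finset.sum_eq_zero fun b _ => ?_
    simp [ha.symm]

variable (φ ρ ω) (η : ℝ) (est : MarginalEstimates d N l r)
  (Q : ∀ j, Matrix (Cfg d N j (j + r) × Cfg d N j (j + r)) (Cfg d N (j - l) j × Cfg d N (j - l) j) ℂ)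

/-- The error of one step of the reconstruction, on the range of the exact correlation matrix. -/
def stepDiff (i : ℕ) : Matrix (Cfg d N (i - l) i × Cfg d N (i - l) i)
    (Cfg d N i (i + 1 + r) × Cfg d N i (i + 1 + r)) ℂ :=
  localCorr ω l r i * truncPinv η (shortCorr l r i (est.short i)) * longCorr l r i (est.long i) -
    longCorr l r i (marginal ω (i - l) (i + 1 + r))

/-- The operator on the block after `i` that the reconstruction assigns to elements of the memory
algebra after the site `i`. -/
def recover (i : ℕ) : Matrix (Cfg d N i (i + 1)) (Cfg d N i (i + 1)) B →ₗ[ℂ]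
    (Cfg d N i (i + 1 + r) × Cfg d N i (i + 1 + r) → ℂ) :=
  spread (Nat.le_add_right i 1) (Nat.le_add_right (i + 1) r)
    ((Q (i + 1)).mulVecLin ∘ₗ leftFun φ ρ (i + 1 - l) (i + 1))

/-- The error of one step of the reconstruction, lifted to the memory algebra. -/
def stepError (i : ℕ) : Matrix (Cfg d N i (i + 1)) (Cfg d N i (i + 1)) B →ₗ[ℂ] B :=
  rightElt φ i (i + r) ∘ₗ (localPinv ω l r i).mulVecLin ∘ₗ (stepDiff ω η est i).mulVecLin ∘ₗ
    recover φ ρ Q i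

/-- The elements of the memory algebra that represent the operators `tailOp`. -/
def memElt (p q : Fin N → Fin d) : ℕ → ℕ → B
  | 0, _ => 1
  | k + 1, i => blockSum φ i (i + 1) (Matrix.single (restr i (i + 1) p) (restr i (i + 1) q)
      (memElt p q k (i + 1))) + stepError φ ρ ω η est Q i
        (Matrix.single (restr i (i + 1) p) (restr i (i + 1) q) (memElt p q k (i + 1)))

/-- The estimates are accurate and `Q` inverts the correlation matrices on the reconstructed
operators. -/
structure Setting (A : StarSubalgebra ℂ (Matrix (Fin d) (Fin d) ℂ)) (m : ℕ) (e : ℝ) : Prop where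
  realizes : Realizes φ ρ ω
  isState : IsState A ω
  finCorr : IsFinitelyCorrelated l r m ω
  isEstimate : ∀ j, 1 ≤ j → j ≤ N →
    IsEstimate (localCorr ω l r j) (shortCorr l r j (est.short j)) e η (sigmaMin ω l r j)
  long_le : ∀ i, i < N →
    ‖longCorr l r i (est.long i) - longCorr l r i (marginal ω (i - l) (i + 1 + r))‖ ≤ e
  norm_Q_le : ∀ j, 1 ≤ j → j ≤ N → ‖Q j‖ ≤ 2 / sigmaMin ω l r j
  Q_mul : ∀ j, 1 ≤ j → j ≤ N →
    Q j * (localCorr ω l r j * truncPinv η (shortCorr l r j (est.short j))) =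
      truncPinv η (shortCorr l r j (est.short j))

variable {φ ρ ω η est Q} {A : StarSubalgebra ℂ (Matrix (Fin d) (Fin d) ℂ)} {m : ℕ} {e : ℝ}

namespace Setting

variable (S : Setting φ ρ ω η est Q A m e)

include S

lemma Q_mulVec_tailVec (p q : Fin N → Fin d) {k i : ℕ} (hi : 1 ≤ i) (hk : i + k = N) :
    Q i *ᵥ (localCorr ω l r i *ᵥ tailVec η est p q k i) = tailVec η est p q k i := by
  have hiN : i ≤ N := by omega
  have key : ∀ v, Q i *ᵥ (localCorr ω l r i *ᵥ (truncPinv η (shortCorr l r i (est.short i)) *ᵥ v)) =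
      truncPinv η (shortCorr l r i (est.short i)) *ᵥ v := by
    intro v
    rw [Matrix.mulVec_mulVec, Matrix.mulVec_mulVec, Matrix.mul_assoc, S.Q_mul i hi hiN]
  cases k with
  | zero =>
    have : IsEmpty {x : Fin N // i ≤ x.val ∧ x.val < i + r} := ⟨fun x => by have := x.2; omega⟩
    -- At `i = N` the tail is the identity on an empty block and not an output of the pseudo-inverse
    -- by construction. It becomes one because the pseudo-inverse is a genuine left inverse there.
    have h1 : tailVec η est p q 0 i = truncPinv η (shortCorr l r i (est.short i)) *ᵥ
        (shortCorr l r i (est.short i) *ᵥ tailVec η est p q 0 i) := by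
      rw [Matrix.mulVec_mulVec, (S.isEstimate i hi hiN).pinv_mul_eq_one, Matrix.one_mulVec]
    rw [h1, key]
  | succ k =>
    rw [tailVec_succ, key]

/-- The map `recover` sees `t` only through its functional, and this agrees with the functional of
the reconstructed tail, which `Q` inverts exactly. Hence the choice of representative does not
matter. -/
lemma recover_single (p q : Fin N → Fin d) {k i : ℕ} (hk : i + 1 + k = N) {t : B}
    (ht : leftFun φ ρ 0 (i + 1) t =
      leftFun φ ρ 0 (i + 1) (rightElt φ (i + 1) (i + 1 + r) (tailVec η est p q k (i + 1))))
    (c c' : Cfg d N i (i + 1)) :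
    recover φ ρ Q i (Matrix.single c c' t) = fun u => tensorOp (Nat.le_add_right i 1)
      (Nat.le_add_right (i + 1) r) (Matrix.single c c' 1)
      (Matrix.of fun a b => tailVec η est p q k (i + 1) (a, b)) u.1 u.2 := by
  have h : ((Q (i + 1)).mulVecLin ∘ₗ leftFun φ ρ (i + 1 - l) (i + 1)) t =
      tailVec η est p q k (i + 1) := by
    rw [LinearMap.comp_apply, ← restrictFun_comp_leftFun (Nat.sub_le (i + 1) l),
      LinearMap.comp_apply, ht, ← LinearMap.comp_apply (restrictFun _),
      restrictFun_comp_leftFun, ← S.realizes.localCorr_mulVec, Matrix.mulVecLin_apply]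
    exact S.Q_mulVec_tailVec p q (by omega) hk
  rw [recover, spread_single, h]

/-- The operator `tailOp` and its representative in the memory algebra give the same functional. -/
lemma leftFun_memElt (p q : Fin N → Fin d) : ∀ {k i : ℕ}, 1 ≤ i → i + k = N →
    leftFun φ ρ 0 i (memElt φ ρ ω η est Q p q k i) =
      leftFun φ ρ 0 i (rightElt φ i (i + r) (tailVec η est p q k i))
  | 0, i, hi, hk => by
    congr 1
    rw [memElt, rightElt_apply, Fintype.sum_prod_type]
    refine (isChannel_blockMap S.realizes.channel i r).unital.symm.trans
      (Finset.sum_congr rfl fun c _ => ?_)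
    rw [Fintype.sum_eq_single c]
    · simp [tailVec, tailOp]
    · intro c' hc'
      simp [tailVec, tailOp, hc'.symm]
  | k + 1, i, hi, hk => by
    have hiN : i ≤ N := by omega
    have ih := leftFun_memElt p q (k := k) (i := i + 1) (by omega) (by omega)
    set c := restr i (i + 1) p with hc
    set c' := restr i (i + 1) q with hc'
    set t := memElt φ ρ ω η est Q p q k (i + 1) with ht
    set z := tailVec η est p q k (i + 1) with hz
    have hir : i ≤ i + r := Nat.le_add_right i r
    set b₁ := blockMap φ i (i + 1) c c' (rightElt φ (i + 1) (i + 1 + r) z) with hb₁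
    -- The exact step respects equality of functionals: inserting a matrix unit at the site only
    -- evaluates the functional on the longer left block.
    have h1 : leftFun φ ρ 0 i (blockMap φ i (i + 1) c c' t) = leftFun φ ρ 0 i b₁ := by
      funext y
      rw [hb₁, leftFun_zero_blockMap (Nat.le_add_right i 1),
        leftFun_zero_blockMap (Nat.le_add_right i 1), ih]
    have h3 := S.recover_single p q (by omega) ih c c'
    have h4 : rightElt φ i (i + 1 + r) (recover φ ρ Q i (Matrix.single c c' t)) = b₁ := by
      rw [h3, rightElt_tensorOp]
      rfl
    -- The step error measures the reconstructed step minus the exact one. Both come from the tail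
    -- space, so lifting it back adds the missing difference on the whole left part, and the exact
    -- term cancels.
    have h5 : stepDiff ω η est i *ᵥ recover φ ρ Q i (Matrix.single c c' t) =
        leftFun φ ρ (i - l) i (rightElt φ i (i + r) (tailVec η est p q (k + 1) i)) -
          leftFun φ ρ (i - l) i b₁ := by
      rw [stepDiff, Matrix.sub_mulVec, ← h4, S.realizes.corrMat_marginal_mulVec,
        ← S.realizes.localCorr_mulVec, tailVec_succ, ← h3, Matrix.mulVec_mulVec,
        Matrix.mulVec_mulVec, Matrix.mul_assoc]
    have hm : rightElt φ i (i + r) (tailVec η est p q (k + 1) i) ∈ tailSpace φ i :=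
      S.realizes.rightElt_mem hir _
    have hm₁ : b₁ ∈ tailSpace φ i := by
      rw [← h4]
      exact S.realizes.rightElt_mem (by omega) _
    have h6 := S.realizes.leftFun_rightElt_localPinv S.isState S.finCorr hiN hm
    have h7 := S.realizes.leftFun_rightElt_localPinv S.isState S.finCorr hiN hm₁
    rw [memElt, blockSum_single, map_add, h1, stepError, LinearMap.comp_apply, LinearMap.comp_apply,
      LinearMap.comp_apply, Matrix.mulVecLin_apply, Matrix.mulVecLin_apply, h5, Matrix.mulVec_sub,
      map_sub, map_sub, h6, h7]
    abel

end Setting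

end Recursion

/-! ### From matrix units to arbitrary operators on the chain. -/

section Assemble

variable {d N dB : ℕ} {B : StarSubalgebra ℂ (Matrix (Fin dB) (Fin dB) ℂ)}

/-- The matrix on the block `[0, i)` whose entries are the sums `∑ X p q • t p q` over the labels
`p`, `q` with given restrictions to this block. -/
def assemble {V : Type*} [AddCommMonoid V] [Module ℂ V] (X : ChainOp d N) (i : ℕ)
    (t : (Fin N → Fin d) → (Fin N → Fin d) → V) : Matrix (Cfg d N 0 i) (Cfg d N 0 i) V :=
  Matrix.of fun a b => ∑ p, ∑ q, if restr 0 i p = a ∧ restr 0 i q = b then X p q • t p q else 0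

lemma restr_eq_split_symm_iff {i : ℕ} (p : Fin N → Fin d) (a : Cfg d N 0 i)
    (c : Cfg d N i (i + 1)) :
    restr 0 (i + 1) p = (Cfg.split (Nat.zero_le i) (Nat.le_add_right i 1)).symm (a, c) ↔
      restr 0 i p = a ∧ restr i (i + 1) p = c := by
  rw [Equiv.eq_symm_apply, Cfg.split_apply, Prod.mk.injEq]
  rfl

/-- With the labels before site `i` fixed, the rest of the sum is a matrix over the labels of site
`i`, to which the linear map `Θ` is applied once. A rule for matrix units thus becomes an amplified
map. -/
lemma assemble_linear {V : Type*} [AddCommMonoid V] [Module ℂ V] (X : ChainOp d N) {i : ℕ}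
    (Θ : Matrix (Cfg d N i (i + 1)) (Cfg d N i (i + 1)) B →ₗ[ℂ] V)
    (t : (Fin N → Fin d) → (Fin N → Fin d) → B) (a b : Cfg d N 0 i) :
    assemble X i (fun p q => Θ (Matrix.single (restr i (i + 1) p) (restr i (i + 1) q) (t p q))) a b =
      Θ (Matrix.of fun c c' => assemble X (i + 1) t
        ((Cfg.split (Nat.zero_le i) (Nat.le_add_right i 1)).symm (a, c))
        ((Cfg.split (Nat.zero_le i) (Nat.le_add_right i 1)).symm (b, c'))) := by
  have h : (Matrix.of fun c c' => assemble X (i + 1) t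
        ((Cfg.split (Nat.zero_le i) (Nat.le_add_right i 1)).symm (a, c))
        ((Cfg.split (Nat.zero_le i) (Nat.le_add_right i 1)).symm (b, c')) :
          Matrix (Cfg d N i (i + 1)) (Cfg d N i (i + 1)) B) =
      ∑ p, ∑ q, if restr 0 i p = a ∧ restr 0 i q = b then
        X p q • Matrix.single (restr i (i + 1) p) (restr i (i + 1) q) (t p q) else 0 := by
    ext1 c c'
    simp only [assemble, Matrix.of_apply, Matrix.sum_apply, restr_eq_split_symm_iff]
    refine Finset.sum_congr rfl fun p _ => Finset.sum_congr rfl fun q _ => ?_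
    by_cases h1 : restr 0 i p = a ∧ restr 0 i q = b
    · rw [if_pos h1, Matrix.smul_apply, Matrix.single_apply]
      by_cases h2 : restr i (i + 1) p = c ∧ restr i (i + 1) q = c'
      · rw [if_pos ⟨⟨h1.1, h2.1⟩, h1.2, h2.2⟩, if_pos h2]
      · rw [if_neg (fun h3 => h2 ⟨h3.1.2, h3.2.2⟩), if_neg h2, smul_zero]
    · rw [if_neg h1, if_neg (fun h3 => h1 ⟨h3.1.1, h3.2.1⟩), Matrix.zero_apply]
  rw [h, map_sum, assemble, Matrix.of_apply]
  refine Finset.sum_congr rfl fun p _ => ?_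
  rw [map_sum]
  refine Finset.sum_congr rfl fun q _ => ?_
  split_ifs
  · rw [map_smul]
  · rw [map_zero]

lemma bnorm_map_smul_one_le {κ : Type} [Fintype κ] [DecidableEq κ] (X : Matrix κ κ ℂ) :
    bnorm (Matrix.of fun a b => X a b • (1 : B)) ≤ ‖X‖ := by
  refine bnorm_le_of _ (norm_nonneg _) fun η => ?_
  have h1 : ∀ a, ∑ b, ((Matrix.of fun a b => X a b • (1 : B) : Matrix κ κ B) a b).1 *ᵥ η b =
      fun s => (X *ᵥ fun b => η b s) a := by
    intro a
    funext s
    simp [Matrix.mulVec, dotProduct, Finset.sum_apply, Matrix.smul_apply, Matrix.one_apply]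
  simp_rw [h1, vnorm_sq]
  rw [Finset.sum_comm, Finset.sum_comm (f := fun b s => ‖η b s‖ ^ 2), Finset.mul_sum]
  refine Finset.sum_le_sum fun s _ => ?_
  have h2 := pow_le_pow_left₀ (vnorm_nonneg _) (vnorm_mulVec_le X fun b => η b s) 2
  rwa [mul_pow, vnorm_sq, vnorm_sq] at h2

lemma bnorm_assemble_le (X : ChainOp d N) :
    bnorm (assemble X N fun _ _ => (1 : B)) ≤ ‖X‖ := by
  let e : Cfg d N 0 N ≃ (Fin N → Fin d) :=
    { toFun := fun a x => a ⟨x, Nat.zero_le _, x.2⟩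
      invFun := restr 0 N
      left_inv := fun _ => rfl
      right_inv := fun _ => rfl }
  have h1 : assemble X N (fun _ _ => (1 : B)) =
      (Matrix.of fun a b => X.submatrix e e a b • (1 : B)) := by
    ext1 a b
    have h2 : ∀ p c, restr 0 N p = c ↔ p = e c := fun p c => (e.symm_apply_eq (x := p) (y := c))
    simp only [assemble, Matrix.of_apply, h2, Matrix.submatrix_apply]
    rw [Fintype.sum_eq_single (e a), Fintype.sum_eq_single (e b)]
    · simp
    · intro q hq
      simp [hq]
    · intro p hp
      simp [hp]
  rw [h1]
  exact (bnorm_map_smul_one_le _).trans_eq (l2_opNorm_submatrix_equiv X e)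

end Assemble

/-! ### Accumulation of the errors along the chain. -/

section Bounds

variable {d N l r dB : ℕ} {B : StarSubalgebra ℂ (Matrix (Fin dB) (Fin dB) ℂ)}
variable {φ : Fin N → Fin d → Fin d → B →ₗ[ℂ] B} {ρ : B →ₗ[ℂ] ℂ} {ω : ChainOp d N}
  {η : ℝ} {est : MarginalEstimates d N l r}
  {Q : ∀ j, Matrix (Cfg d N j (j + r) × Cfg d N j (j + r)) (Cfg d N (j - l) j × Cfg d N (j - l) j) ℂ}
  {A : StarSubalgebra ℂ (Matrix (Fin d) (Fin d) ℂ)} {m : ℕ} {e : ℝ}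

namespace Setting

variable (S : Setting φ ρ ω η est Q A m e)

include S

/-- The exact long correlation matrix has its range in the functionals of tail elements, which the
exact projection fixes; this is the hypothesis of the one-step bound. -/
lemma norm_stepDiff_le {i : ℕ} (hi : 1 ≤ i) (hiN : i ≤ N) (hiN' : i < N) :
    ‖stepDiff ω η est i‖ ≤ 6 * e / sigmaMin ω l r i := by
  refine (S.isEstimate i hi hiN).norm_step_le (S.isState.norm_corrMat_marginal_le _ _)
    (S.long_le i hiN') ?_
  refine Matrix.toLin'.injective (LinearMap.ext fun v => ?_)
  rw [Matrix.toLin'_apply, Matrix.toLin'_apply, Matrix.mul_assoc, ← Matrix.mulVec_mulVec,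
    ← Matrix.mulVec_mulVec, S.realizes.corrMat_marginal_mulVec]
  exact S.realizes.localCorr_mulVec_localPinv S.isState S.finCorr hiN
    (S.realizes.rightElt_mem (by omega) v)

lemma vnorm_recover_le {i : ℕ} (hi : i < N) (x : Matrix (Cfg d N i (i + 1)) (Cfg d N i (i + 1)) B) :
    vnorm (recover φ ρ Q i x) ≤ 2 / sigmaMin ω l r (i + 1) * √d * bnorm x := by
  refine (S.realizes.vnorm_spread_le (Nat.sub_le (i + 1) l) (Nat.le_add_right (i + 1) r) hi _
    x).trans ?_
  have := bnorm_nonneg x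
  have := S.norm_Q_le (i + 1) (by omega) hi
  gcongr

/-- The three factors belong to `localPinv`, `stepDiff` and `recover`; the final passage `rightElt`
to `ℬ` is a contraction. -/
lemma norm_stepError_le {i : ℕ} (hi : 1 ≤ i) (hiN : i < N)
    (x : Matrix (Cfg d N i (i + 1)) (Cfg d N i (i + 1)) B) :
    ‖(stepError φ ρ ω η est Q i x).1‖ ≤ (sigmaMin ω l r i)⁻¹ * (6 * e / sigmaMin ω l r i *
      (2 / sigmaMin ω l r (i + 1) * √d)) * bnorm x := by
  have h0 := S.isState.sigmaMin_pos l r i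
  have h1 : ‖localPinv ω l r i‖ ≤ (sigmaMin ω l r i)⁻¹ :=
    norm_truncPinv_singVal_le _ (S.isState.localCorr_ne_zero l r i)
  have h2 := S.norm_stepDiff_le hi hiN.le hiN
  have h3 := S.vnorm_recover_le hiN x
  have he := (S.isEstimate i hi hiN.le).pos
  refine (S.realizes.norm_rightElt_le (Nat.le_add_right i r) _).trans ?_
  refine (vnorm_mulVec_le (localPinv ω l r i) _).trans ?_
  rw [mul_assoc]
  refine mul_le_mul h1 ?_ (vnorm_nonneg _) (by positivity)
  refine (vnorm_mulVec_le (stepDiff ω η est i) _).trans ?_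
  rw [mul_assoc]
  exact mul_le_mul h2 h3 (vnorm_nonneg _) (by positivity)

end Setting

/-- The elements of the memory algebra that represent the matrix units on the sites after `i`. -/
def trueElt (φ : Fin N → Fin d → Fin d → B →ₗ[ℂ] B) (i : ℕ) (p q : Fin N → Fin d) : B :=
  blockMap φ i N (restr i N p) (restr i N q) 1

lemma trueElt_eq_blockSum {i : ℕ} (hi : i < N) (p q : Fin N → Fin d) :
    trueElt φ i p q = blockSum φ i (i + 1)
      (Matrix.single (restr i (i + 1) p) (restr i (i + 1) q) (trueElt φ (i + 1) p q)) := by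
  rw [blockSum_single, trueElt, blockMap_split φ (Nat.le_add_right i 1) hi]
  rfl

/-- Regrouping of the sites before `i + 1`. -/
abbrev regroup {V : Type*} {i : ℕ} (x : Matrix (Cfg d N 0 (i + 1)) (Cfg d N 0 (i + 1)) V) :
    Matrix (Cfg d N 0 i × Cfg d N i (i + 1)) (Cfg d N 0 i × Cfg d N i (i + 1)) V :=
  x.submatrix (Cfg.split (Nat.zero_le i) (Nat.le_add_right i 1)).symm
    (Cfg.split (Nat.zero_le i) (Nat.le_add_right i 1)).symm

lemma assemble_trueElt (X : ChainOp d N) {i : ℕ} (hi : i < N) :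
    assemble X i (trueElt φ i) =
      amp (blockMap φ i (i + 1)) (regroup (assemble X (i + 1) (trueElt φ (i + 1)))) := by
  ext1 a b
  have h : trueElt φ i = fun p q => blockSum φ i (i + 1)
      (Matrix.single (restr i (i + 1) p) (restr i (i + 1) q) (trueElt φ (i + 1) p q)) :=
    funext fun p => funext fun q => trueElt_eq_blockSum hi p q
  rw [h, assemble_linear]
  rfl

lemma assemble_memElt (X : ChainOp d N) (k i : ℕ) :
    assemble X i (fun p q => memElt φ ρ ω η est Q p q (k + 1) i) =
      amp (blockMap φ i (i + 1))
        (regroup (assemble X (i + 1) fun p q => memElt φ ρ ω η est Q p q k (i + 1))) +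
      Matrix.of fun a b => stepError φ ρ ω η est Q i (Matrix.of fun c c' =>
        regroup (assemble X (i + 1) fun p q => memElt φ ρ ω η est Q p q k (i + 1)) (a, c) (b, c')) := by
  ext1 a b
  exact assemble_linear X (blockSum φ i (i + 1) + stepError φ ρ ω η est Q i)
    (fun p q => memElt φ ρ ω η est Q p q k (i + 1)) a b

namespace Setting

variable (S : Setting φ ρ ω η est Q A m e)

include S

/-- The channel does not increase either norm, and the amplified error adds at most `κ * (1 + κ) ^
k`. Both bounds then follow by induction from the end of the chain, where the two families coincide.
-/
lemma bnorm_assemble_memElt_le {κ : ℝ} (hκ0 : 0 ≤ κ)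
    (hκ : ∀ i, 1 ≤ i → i < N → dB * ((sigmaMin ω l r i)⁻¹ * (6 * e / sigmaMin ω l r i *
      (2 / sigmaMin ω l r (i + 1) * √d))) ≤ κ) {X : ChainOp d N} (hX : ‖X‖ ≤ 1) :
    ∀ {k i : ℕ}, 1 ≤ i → i + k = N →
      bnorm (assemble X i fun p q => memElt φ ρ ω η est Q p q k i) ≤ (1 + κ) ^ k ∧
      bnorm (assemble X i (fun p q => memElt φ ρ ω η est Q p q k i) - assemble X i (trueElt φ i)) ≤
        (1 + κ) ^ k - 1
  | 0, i, hi, hk => by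
    obtain rfl : i = N := by omega
    have h1 : trueElt φ i = fun _ _ => 1 := by
      funext p q
      rw [trueElt, blockMap_self]
      rfl
    have h2 : (fun p q => memElt φ ρ ω η est Q p q 0 i) = fun _ _ => 1 := rfl
    rw [h1, h2, sub_self, pow_zero, sub_self]
    refine ⟨(bnorm_assemble_le X).trans hX, ?_⟩
    have := bnorm_smul (0 : ℂ) (0 : Matrix (Cfg d i 0 i) (Cfg d i 0 i) B)
    rw [zero_smul, norm_zero, zero_mul] at this
    exact this.le
  | k + 1, i, hi, hk => by
    have hiN : i < N := by omega
    obtain ⟨ih1, ih2⟩ := bnorm_assemble_memElt_le hκ0 hκ hX (k := k) (i := i + 1) (by omega)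
      (by omega)
    have hc := isChannel_blockMap S.realizes.channel i 1
    rw [assemble_trueElt X hiN, assemble_memElt]
    set x := assemble X (i + 1) fun p q => memElt φ ρ ω η est Q p q k (i + 1)
    set y := assemble X (i + 1) (trueElt φ (i + 1))
    set E : Matrix (Cfg d N 0 i) (Cfg d N 0 i) B := Matrix.of fun a b =>
      stepError φ ρ ω η est Q i (Matrix.of fun c c' => regroup x (a, c) (b, c'))
    have hx : bnorm (regroup x) = bnorm x := bnorm_submatrix_equiv x _
    have hxy : bnorm (regroup (x - y)) = bnorm (x - y) := bnorm_submatrix_equiv (x - y) _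
    have h0 := S.isState.sigmaMin_pos l r i
    have h0' := S.isState.sigmaMin_pos l r (i + 1)
    have he := (S.isEstimate i hi hiN.le).pos
    have hE : bnorm E ≤ κ * (1 + κ) ^ k := by
      refine (bnorm_amplify_le _ (by positivity) (S.norm_stepError_le hi hiN) (regroup x)).trans ?_
      rw [hx]
      exact mul_le_mul (hκ i hi hiN) ih1 (bnorm_nonneg x) hκ0
    have h1 := bnorm_add_le (amp (blockMap φ i (i + 1)) (regroup x)) E
    have h2 := hc.bnorm_amp_le (regroup x)
    have h3 := hc.bnorm_amp_le (regroup (x - y))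
    have h4 : amp (blockMap φ i (i + 1)) (regroup x) + E - amp (blockMap φ i (i + 1)) (regroup y) =
        amp (blockMap φ i (i + 1)) (regroup (x - y)) + E := by
      have : regroup x = regroup (x - y) + regroup y := by
        ext1 a b
        simp [regroup]
      rw [this, amp_add]
      abel
    have h5 := bnorm_add_le (amp (blockMap φ i (i + 1)) (regroup (x - y))) E
    rw [h4, pow_succ]
    constructor <;> linarith

end Setting

/-- The linear functional on `M ⊗ ℬ` for the first site, by which the reconstruction ends. -/
def firstStep (φ : Fin N → Fin d → Fin d → B →ₗ[ℂ] B) (ρ : B →ₗ[ℂ] ℂ) (ω : ChainOp d N)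
    (est : MarginalEstimates d N l r)
    (Q : ∀ j, Matrix (Cfg d N j (j + r) × Cfg d N j (j + r))
      (Cfg d N (j - l) j × Cfg d N (j - l) j) ℂ) (y : Cfg d N (0 - l) 0 × Cfg d N (0 - l) 0) :
    Matrix (Cfg d N 0 (0 + 1)) (Cfg d N 0 (0 + 1)) B →ₗ[ℂ] ℂ :=
  LinearMap.proj y ∘ₗ (longCorr l r 0 (est.long 0) -
    longCorr l r 0 (marginal ω (0 - l) (0 + 1 + r))).mulVecLin ∘ₗ recover φ ρ Q 0

lemma leftFun_zero_sub (y : Cfg d N (0 - l) 0 × Cfg d N (0 - l) 0) (b : B) :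
    leftFun φ ρ (0 - l) 0 b y = ρ b := by
  have : IsEmpty {x : Fin N // 0 ≤ x.val ∧ x.val < 0 - l} := ⟨fun x => by have := x.2; omega⟩
  rw [leftFun_apply, Fintype.sum_unique, blockMap_eq_one φ (fun x => by omega),
    blockMap_eq_one φ (fun x => by omega)]
  rfl

namespace Setting

variable (S : Setting φ ρ ω η est Q A m e)

include S

/-- The first site needs no pseudo-inverse: its estimated functional is the exact one plus the
estimation error, and the exact one evaluates to `ρ` after the first channel. -/
lemma spectralReconstruction_apply {k : ℕ} (hk : 0 + 1 + k = N)
    (y : Cfg d N (0 - l) 0) (p q : Fin N → Fin d) :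
    spectralReconstruction η est q p = (ρ ∘ₗ blockSum φ 0 (0 + 1) + firstStep φ ρ ω est Q (y, y))
      (Matrix.single (restr 0 (0 + 1) p) (restr 0 (0 + 1) q)
        (memElt φ ρ ω η est Q p q k (0 + 1))) := by
  have : IsEmpty {x : Fin N // 0 - l ≤ x.val ∧ x.val < 0} := ⟨fun x => by have := x.2; omega⟩
  have hone : (1 : Op d N (0 - l) 0) = Matrix.single y y 1 := by
    ext a b
    rw [Subsingleton.elim a y, Subsingleton.elim b y]
    simp
  have hmem := S.leftFun_memElt p q (k := k) (i := 0 + 1) (by omega) hk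
  have hrec := S.recover_single p q hk hmem (restr 0 (0 + 1) p) (restr 0 (0 + 1) q)
  have hval : spectralReconstruction η est q p = siteFunctional est 0
      (Matrix.single (restr 0 (0 + 1) p) (restr 0 (0 + 1) q) 1)
      (Matrix.of fun a b => tailVec η est p q k (0 + 1) (a, b)) (Matrix.single y y 1) := by
    obtain rfl : k = N - 1 := by omega
    rw [← hone]
    rfl
  have htrue : (longCorr l r 0 (marginal ω (0 - l) (0 + 1 + r)) *ᵥ recover φ ρ Q 0
      (Matrix.single (restr 0 (0 + 1) p) (restr 0 (0 + 1) q)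
        (memElt φ ρ ω η est Q p q k (0 + 1)))) (y, y) =
      ρ (blockMap φ 0 (0 + 1) (restr 0 (0 + 1) p) (restr 0 (0 + 1) q)
        (memElt φ ρ ω η est Q p q k (0 + 1))) := by
    rw [S.realizes.corrMat_marginal_mulVec, leftFun_zero_sub, hrec, rightElt_tensorOp,
      ← leftFun_zero (φ := φ) (ρ := ρ) (0 + 1) _ (restr 0 (0 + 1) p, restr 0 (0 + 1) q),
      ← leftFun_zero (φ := φ) (ρ := ρ) (0 + 1) _ (restr 0 (0 + 1) p, restr 0 (0 + 1) q), hmem]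
    rfl
  rw [hval, siteFunctional_single est 0 _ _ (y, y), ← hrec, LinearMap.add_apply,
    LinearMap.comp_apply, blockSum_single, ← htrue]
  simp only [firstStep, LinearMap.comp_apply, LinearMap.proj_apply, Matrix.mulVecLin_apply,
    Matrix.sub_mulVec, Pi.sub_apply]
  ring

/-- The first term carries the error accumulated on the later sites through an exact step, the
second is the error of the first site on the reconstructed tail. -/
lemma trace_sub_mul_eq {k : ℕ} (hk : 0 + 1 + k = N) (y : Cfg d N (0 - l) 0) (X : ChainOp d N) :
    ((spectralReconstruction η est - ω) * X).trace =
      ρ (blockSum φ 0 (0 + 1) (Matrix.of fun c c' => regroup (assemble X (0 + 1)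
        (fun p q => memElt φ ρ ω η est Q p q k (0 + 1)) - assemble X (0 + 1) (trueElt φ (0 + 1)))
          (default, c) (default, c'))) +
      firstStep φ ρ ω est Q (y, y) (Matrix.of fun c c' => regroup (assemble X (0 + 1)
        fun p q => memElt φ ρ ω η est Q p q k (0 + 1)) (default, c) (default, c')) := by
  have htr : ∀ M : ChainOp d N, (M * X).trace = assemble X 0 (fun p q => M q p) default default := by
    intro M
    simp only [assemble, Matrix.of_apply, Subsingleton.elim _ (default : Cfg d N 0 0), and_self,
      if_true, Matrix.trace, Matrix.diag, Matrix.mul_apply, smul_eq_mul]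
    rw [Finset.sum_comm]
    exact Finset.sum_congr rfl fun p _ => Finset.sum_congr rfl fun q _ => mul_comm _ _
  have h1 : (fun p q => spectralReconstruction η est q p) = fun p q =>
      (ρ ∘ₗ blockSum φ 0 (0 + 1) + firstStep φ ρ ω est Q (y, y))
        (Matrix.single (restr 0 (0 + 1) p) (restr 0 (0 + 1) q)
          (memElt φ ρ ω η est Q p q k (0 + 1))) :=
    funext fun p => funext fun q => S.spectralReconstruction_apply hk y p q
  have h2 : (fun p q => ω q p) = fun p q => (ρ ∘ₗ blockSum φ 0 (0 + 1))
      (Matrix.single (restr 0 (0 + 1) p) (restr 0 (0 + 1) q) (trueElt φ (0 + 1) p q)) := by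
    funext p q
    rw [S.realizes.apply, LinearMap.comp_apply, ← trueElt_eq_blockSum (by omega)]
    rfl
  rw [Matrix.sub_mul, Matrix.trace_sub, htr, htr, h1, h2, assemble_linear, assemble_linear,
    LinearMap.add_apply, LinearMap.comp_apply, LinearMap.comp_apply, add_sub_right_comm,
    ← map_sub ρ, ← map_sub (blockSum φ 0 (0 + 1))]
  rfl

lemma norm_firstStep_le (hN : 0 < N) (y : Cfg d N (0 - l) 0 × Cfg d N (0 - l) 0)
    (x : Matrix (Cfg d N 0 (0 + 1)) (Cfg d N 0 (0 + 1)) B) :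
    ‖firstStep φ ρ ω est Q y x‖ ≤ e * (2 / sigmaMin ω l r (0 + 1) * √d) * bnorm x := by
  have h1 := S.vnorm_recover_le hN x
  have h2 := S.long_le 0 hN
  have he := (S.isEstimate 1 le_rfl hN).pos
  refine (PiLp.norm_apply_le (WithLp.toLp 2 _) y).trans ((vnorm_mulVec_le _ _).trans ?_)
  rw [mul_assoc]
  exact mul_le_mul h2 h1 (vnorm_nonneg _) he.le

lemma norm_trace_sub_mul_le (hN : 0 < N) {κ : ℝ} (hκ0 : 0 ≤ κ)
    (hκ : ∀ i, 1 ≤ i → i < N → dB * ((sigmaMin ω l r i)⁻¹ * (6 * e / sigmaMin ω l r i *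
      (2 / sigmaMin ω l r (i + 1) * √d))) ≤ κ)
    (hκ1 : e * (2 / sigmaMin ω l r (0 + 1) * √d) ≤ κ) {X : ChainOp d N} (hX : ‖X‖ ≤ 1) :
    ‖((spectralReconstruction η est - ω) * X).trace‖ ≤ (1 + κ) ^ N - 1 := by
  have : IsEmpty {x : Fin N // 0 - l ≤ x.val ∧ x.val < 0} := ⟨fun x => by have := x.2; omega⟩
  obtain ⟨k, hk⟩ : ∃ k, 0 + 1 + k = N := ⟨N - 1, by omega⟩
  obtain ⟨h1, h2⟩ := S.bnorm_assemble_memElt_le hκ0 hκ hX (by omega) hk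
  have hr : ∀ x : Matrix (Cfg d N 0 (0 + 1)) (Cfg d N 0 (0 + 1)) B,
      bnorm (Matrix.of fun c c' => regroup x (default, c) (default, c')) = bnorm x := fun x =>
    bnorm_submatrix_equiv x ((Equiv.uniqueProd (Cfg d N 0 (0 + 1)) (Cfg d N 0 0)).symm.trans
      (Cfg.split (Nat.zero_le 0) (Nat.le_add_right 0 1)).symm)
  rw [S.trace_sub_mul_eq hk (fun x => isEmptyElim x) X]
  set x := assemble X (0 + 1) fun p q => memElt φ ρ ω η est Q p q k (0 + 1)
  set y := assemble X (0 + 1) (trueElt φ (0 + 1))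
  have h3 := S.norm_firstStep_le hN (fun x => isEmptyElim x, fun x => isEmptyElim x)
    (Matrix.of fun c c' => regroup x (default, c) (default, c'))
  have h4 := (S.realizes.rho_le _).trans ((isChannel_blockMap S.realizes.channel 0 1).norm_apply_le
    (Matrix.of fun c c' => regroup (x - y) (default, c) (default, c')))
  rw [hr] at h3 h4
  have h5 : e * (2 / sigmaMin ω l r (0 + 1) * √d) * bnorm x ≤ κ * (1 + κ) ^ k :=
    mul_le_mul hκ1 h1 (bnorm_nonneg x) hκ0
  have h6 : (1 + κ) ^ N = (1 + κ) ^ k * (1 + κ) := by rw [← pow_succ, ← hk]; congr 1; omega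
  rw [h6]
  refine (norm_add_le _ _).trans ((add_le_add h4 h3).trans ?_)
  linarith

end Setting

end Bounds

/-! ### Choice of constants and the deterministic bound. -/

section Main

variable {d N l r dB : ℕ} {B : StarSubalgebra ℂ (Matrix (Fin dB) (Fin dB) ℂ)}
variable {φ : Fin N → Fin d → Fin d → B →ₗ[ℂ] B} {ρ : B →ₗ[ℂ] ℂ} {ω : ChainOp d N}
  {A : StarSubalgebra ℂ (Matrix (Fin d) (Fin d) ℂ)}

lemma IsState.pos_dim (hω : IsState A ω) (hN : 1 ≤ N) : 0 < d := by
  rcases Nat.eq_zero_or_pos d with rfl | h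
  · have : IsEmpty (Fin N → Fin 0) := ⟨fun p => (p ⟨0, hN⟩).elim0⟩
    have h1 := hω.trace_eq_one
    simp [Matrix.trace] at h1
  · exact h

lemma pos_dim_of_apply_one (h : ρ 1 = 1) : 0 < dB := by
  rcases Nat.eq_zero_or_pos dB with rfl | h0
  · have h1 : (1 : B) = 0 := Subtype.ext (Subsingleton.elim _ _)
    rw [h1, map_zero] at h
    exact absurd h zero_ne_one
  · exact h0

lemma requiredPrecision_le (ω : ChainOp d N) (l r dB : ℕ) (ε : ℝ) {j : ℕ} (hj : j ≤ N) :
    requiredPrecision ω l r dB ε ≤ ε * sigmaMin ω l r j ^ 3 / (20 * N * dB * √d) :=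
  ciInf_le (Set.finite_range _).bddBelow (⟨j, Nat.lt_succ_of_le hj⟩ : Fin (N + 1))

lemma IsState.requiredPrecision_pos (hω : IsState A ω) (hN : 1 ≤ N) (hd : 0 < d) (hB : 0 < dB)
    {ε : ℝ} (hε : 0 < ε) : 0 < requiredPrecision ω l r dB ε := by
  obtain ⟨j, hj⟩ := exists_eq_ciInf_of_finite
    (f := fun j : Fin (N + 1) => ε * sigmaMin ω l r j ^ 3 / (20 * N * dB * √d))
  rw [requiredPrecision, ← hj]
  have := hω.sigmaMin_pos l r j
  positivity

lemma norm_corrMat_sub_le {a j b : ℕ} (haj : a ≤ j) (hjb : j ≤ b) {M M' : Op d N a b} {e : ℝ}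
    (h : hsNorm (M - M') ≤ e) : ‖corrMat haj hjb M - corrMat haj hjb M'‖ ≤ e := by
  rw [← corrMat_sub]
  exact (l2_opNorm_le_hsNorm _).trans ((hsNorm_corrMat haj hjb _).trans_le h)

lemma Realizes.exists_setting (h : Realizes φ ρ ω) (hω : IsState A ω) {m : ℕ}
    (hfc : IsFinitelyCorrelated l r m ω) {η e : ℝ} {est : MarginalEstimates d N l r}
    (hest : est.Accurate ω e) (he : 0 < e) (hσ : ∀ j ≤ N, e ≤ sigmaMin ω l r j / 20)
    (hη : 2 * e ≤ η) (hη' : ∀ j ≤ N, η ≤ sigmaMin ω l r j / 2) :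
    ∃ Q, Setting φ ρ ω η est Q A m e := by
  have hE : ∀ j, 1 ≤ j → j ≤ N →
      IsEstimate (localCorr ω l r j) (shortCorr l r j (est.short j)) e η (sigmaMin ω l r j) :=
    fun j hj hjN =>
    { ne_zero := hω.localCorr_ne_zero l r j
      sigma_eq := rfl
      sigma_le := hω.sigmaMin_le_one l r j
      pos := he
      norm_le := norm_corrMat_sub_le _ _ (hest.1 j hj hjN)
      le_sigma := hσ j hjN
      le_eta := hη
      eta_le := hη' j hjN }
  have hQ : ∀ j, ∃ Q : Matrix (Cfg d N j (j + r) × Cfg d N j (j + r))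
      (Cfg d N (j - l) j × Cfg d N (j - l) j) ℂ, 1 ≤ j → j ≤ N → ‖Q‖ ≤ 2 / sigmaMin ω l r j ∧
        Q * (localCorr ω l r j * truncPinv η (shortCorr l r j (est.short j))) =
          truncPinv η (shortCorr l r j (est.short j)) := by
    intro j
    by_cases hj : 1 ≤ j ∧ j ≤ N
    · obtain ⟨Q, hQ⟩ := (hE j hj.1 hj.2).exists_leftInverse
      exact ⟨Q, fun _ _ => hQ⟩
    · exact ⟨0, fun h1 h2 => absurd ⟨h1, h2⟩ hj⟩
  choose Q hQ using hQ
  exact ⟨Q, h, hω, hfc, hE, fun i hi => norm_corrMat_sub_le _ _ (hest.2 i hi),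
    fun j h1 h2 => (hQ j h1 h2).1, fun j h1 h2 => (hQ j h1 h2).2⟩

/-- The deterministic error bound for the spectral state reconstruction. -/
theorem Realizes.traceDist_spectralReconstruction_le (h : Realizes φ ρ ω) (hρ : ρ 1 = 1)
    (hω : IsState A ω) {m : ℕ} (hfc : IsFinitelyCorrelated l r m ω) (hN : 1 ≤ N) {ε η : ℝ}
    (hε : 0 < ε) (hε1 : ε < 1) (hη : η ≤ (⨅ j : Fin (N + 1), sigmaMin ω l r j) / 2)
    (hη' : 2 * requiredPrecision ω l r dB ε ≤ η) {est : MarginalEstimates d N l r}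
    (hest : est.Accurate ω (requiredPrecision ω l r dB ε)) :
    traceDist (spectralReconstruction η est) ω ≤ ε := by
  have hd := hω.pos_dim hN
  have hB := pos_dim_of_apply_one hρ
  have he := hω.requiredPrecision_pos (l := l) (r := r) hN hd hB hε
  have hle : ∀ j ≤ N, requiredPrecision ω l r dB ε ≤
      ε * sigmaMin ω l r j ^ 3 / (20 * N * dB * √d) := fun j hj => requiredPrecision_le ω l r dB ε hj
  set e := requiredPrecision ω l r dB ε
  have hN' : (1 : ℝ) ≤ N := by exact_mod_cast hN
  have hB' : (1 : ℝ) ≤ dB := by exact_mod_cast hB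
  have hd' : (1 : ℝ) ≤ √d := Real.one_le_sqrt.2 (by exact_mod_cast hd)
  have hσ := fun j => hω.sigmaMin_pos l r j
  have hσ1 := fun j => hω.sigmaMin_le_one l r j
  have hmul : ∀ j ≤ N, e * (dB * √d) ≤ sigmaMin ω l r j ^ 3 * (ε / (20 * N)) := by
    intro j hj
    have := hle j hj
    rw [le_div_iff₀ (by positivity)] at this
    rw [← mul_div_assoc, le_div_iff₀ (by positivity)]
    linarith
  have hBd : 1 ≤ dB * √d := one_le_mul_of_one_le_of_one_le hB' hd'
  have hεN : ε / (20 * N) ≤ 1 / 20 := by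
    rw [div_le_div_iff₀ (by positivity) (by norm_num)]
    nlinarith
  have hσe : ∀ j ≤ N, e ≤ sigmaMin ω l r j / 20 := by
    intro j hj
    have h1 : sigmaMin ω l r j ^ 3 ≤ sigmaMin ω l r j := pow_le_of_le_one (hσ j).le (hσ1 j) (by norm_num)
    calc e ≤ e * (dB * √d) := le_mul_of_one_le_right he.le hBd
      _ ≤ sigmaMin ω l r j ^ 3 * (ε / (20 * N)) := hmul j hj
      _ ≤ sigmaMin ω l r j * (1 / 20) := mul_le_mul h1 hεN (by positivity) (hσ j).le
      _ = _ := by ring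
  have hησ : ∀ j ≤ N, η ≤ sigmaMin ω l r j / 2 := fun j hj => hη.trans
    (div_le_div_of_nonneg_right (ciInf_le (f := fun j : Fin (N + 1) => sigmaMin ω l r j)
      (Set.finite_range _).bddBelow ⟨j, Nat.lt_succ_of_le hj⟩) zero_le_two)
  obtain ⟨Q, S⟩ := h.exists_setting hω hfc hest he hσe hη' hησ
  have hκ : ∀ i, 1 ≤ i → i < N → dB * ((sigmaMin ω l r i)⁻¹ * (6 * e / sigmaMin ω l r i *
      (2 / sigmaMin ω l r (i + 1) * √d))) ≤ ε / N := by
    intro i _ hi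
    have hs := hσ i
    have ht := hσ (i + 1)
    have h1 := hmul i hi.le
    have h2 := hmul (i + 1) hi
    set s := sigmaMin ω l r i
    set t := sigmaMin ω l r (i + 1)
    -- The precision is bounded by the cubes at both cuts, and the smaller of `s ^ 3` and `t ^ 3` is
    -- at most `s ^ 2 * t`.
    have h3 : e * (dB * √d) ≤ s ^ 2 * t * (ε / (20 * N)) := by
      rcases le_total s t with hst | hst
      · refine h1.trans (mul_le_mul_of_nonneg_right ?_ (by positivity))
        rw [pow_succ]
        gcongr
      · refine h2.trans (mul_le_mul_of_nonneg_right ?_ (by positivity))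
        rw [pow_succ]
        gcongr
    -- The constant `12 = 6 * 2` stays below the `20` in the precision.
    calc dB * (s⁻¹ * (6 * e / s * (2 / t * √d))) = 12 * (e * (dB * √d)) / (s ^ 2 * t) := by
          field_simp
          ring
      _ ≤ 12 * (s ^ 2 * t * (ε / (20 * N))) / (s ^ 2 * t) := by gcongr
      _ = 12 / 20 * (ε / N) := by field_simp
      _ ≤ ε / N := mul_le_of_le_one_left (by positivity) (by norm_num)
  have hκ1 : e * (2 / sigmaMin ω l r (0 + 1) * √d) ≤ ε / N := by
    have hs := hσ (0 + 1)
    have hs1 := hσ1 (0 + 1)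
    have h1 := hmul (0 + 1) hN
    set s := sigmaMin ω l r (0 + 1)
    have h2 : s ^ 3 ≤ s := pow_le_of_le_one hs.le hs1 (by norm_num)
    calc e * (2 / s * √d) ≤ dB * (e * (2 / s * √d)) := le_mul_of_one_le_left (by positivity) hB'
      _ = 2 * (e * (dB * √d)) / s := by field_simp
      _ ≤ 2 * (s * (ε / (20 * N))) / s := by
          exact div_le_div_of_nonneg_right (mul_le_mul_of_nonneg_left
            (h1.trans (mul_le_mul_of_nonneg_right h2 (by positivity))) zero_le_two) hs.le
      _ = 2 / 20 * (ε / N) := by field_simp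
      _ ≤ ε / N := mul_le_of_le_one_left (by positivity) (by norm_num)
  obtain ⟨X, hX, htr⟩ := exists_traceNorm_eq (spectralReconstruction η est - ω)
  have h1 := S.norm_trace_sub_mul_le hN (by positivity) hκ hκ1 hX
  have h2 : traceNorm (spectralReconstruction η est - ω) ≤ (1 + ε / N) ^ N - 1 := by
    rw [← htr, Complex.norm_real] at h1
    exact (le_abs_self _).trans h1
  have h3 : (1 + ε / N) ^ N ≤ Real.exp ε := by
    calc (1 + ε / N) ^ N ≤ Real.exp (ε / N) ^ N := by
          gcongr
          linarith [Real.add_one_le_exp (ε / N)]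
      _ = Real.exp ε := by
          rw [← Real.exp_nat_mul]
          congr 1
          field_simp
  -- For `ε ≤ 1` this gives `exp ε - 1 ≤ 2ε`; the factor `2` is absorbed by the `½` in the trace
  -- distance.
  have h4 := Real.abs_exp_sub_one_le (x := ε) (by rw [abs_of_pos hε]; exact hε1.le)
  rw [abs_of_pos hε] at h4
  have h5 := (le_abs_self _).trans h4
  rw [traceDist, div_le_iff₀ two_pos]
  linarith

end Main

end SpinChain

end

/-! ### The theorem. -/

theorem mainTheorem7 (dA N l r : ℕ) (hN : 1 ≤ N)
    (T : SpinChain.LocalProtocol dA N (l + r + 1) (SpinChain.MarginalEstimates dA N l r))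
    (n : ℕ) (hn : T.copies ≤ n) (η : ℝ) :
    (SpinChain.learn T η).copies ≤ n ∧
      ∀ (A : StarSubalgebra ℂ (Matrix (Fin dA) (Fin dA) ℂ))
        (dB : ℕ) (B : StarSubalgebra ℂ (Matrix (Fin dB) (Fin dB) ℂ)) (m : ℕ)
        (ω : SpinChain.ChainOp dA N) (R : SpinChain.CStarRealization A B N) (ε δ : ℝ),
        SpinChain.IsState A ω → R.Generates ω → SpinChain.IsFinitelyCorrelated l r m ω →
        0 < ε → ε < 1 →
        η ≤ (⨅ j : Fin (N + 1), SpinChain.sigmaMin ω l r j) / 2 →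
        2 * SpinChain.requiredPrecision ω l r dB ε ≤ η →
        T.SucceedsWithProb ω
          (fun est => est.Accurate ω (SpinChain.requiredPrecision ω l r dB ε)) (1 - δ) →
        (SpinChain.learn T η).SucceedsWithProb ω
          (fun ωhat => SpinChain.traceDist ωhat ω ≤ ε) (1 - δ) := by
  refine ⟨hn, fun A dB B m ω R ε δ hω hR hfc hε hε1 hη hη' hT => ?_⟩
  obtain ⟨φ, hφ⟩ := R.exists_realizes hω hR
  obtain ⟨S, hS, hgood, hp⟩ := hT
  -- Classical processing leaves the measurement unchanged, so the success event of the subroutine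
  -- serves with the same probability.
  exact ⟨S, hS, fun x hx => hφ.traceDist_spectralReconstruction_le R.rho_one hω hfc hN hε hε1 hη hη'
    (hgood x hx), hp⟩
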